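/- Theorem (localization for tree approximation). Let $d\ge 2$ and $\ell\ge 1$. Let $\mathcal T_0$ be a conforming mesh of tagged $d$-simplices of a polyhedral domain $\Omega\subset\mathbb R^d$ (so $\Omega$ is the interior of $\bigcup_{K\in\mathcal T_0}K$) that satisfies the matching condition for bisection recalled below. Let $\mathbb T_c$ be the set of conforming meshes obtained from $\mathcal T_0$ by successive bisections. Each $\mathcal T\in\mathbb T_c$ is the set of leaves of a finite tree (forest) $\mathbb{t}$ of simplices with roots $\mathcal T_0$, in which the successors of a bisected simplex are its two children. For $\mathcal T\in\mathbb T_c$ let $S^{\ell,0}(\mathcal T)$ be the space of continuous functions that are polynomials of degree at most $\ell$ on every element of $\mathcal T$. For a face ($(d-1)$-dimensional, possibly on $\partial\Omega$) $E$ of $\mathcal T$ let $\omega_{\mathcal T}(E)$ be the union of the elements of $\mathcal T$ having $E$ as a face, and define the minimal pair $$\omega^\star_E:=\bigcap\{\omega_{\mathcal T'}(E):\ \mathcal T'\in\mathbb T_c,\ E\text{ is a face of }\mathcal T'\}.$$ Let $S|_{\omega^\star_E}$ be the space of restrictions to $\omega^\star_E$ of functions in $S^{\ell,0}(\mathcal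 T')$, where $\mathcal T'\in\mathbb T_c$ is any mesh having $E$ as a face (the choice is immaterial). For $\varepsilon>0$ put $|||w|||_\omega:=\big(\|w\|_{L^2(\omega)}^2+\varepsilon\|\nabla w\|_{L^2(\omega)}^2\big)^{1/2}$, and for $u\in H^1(\Omega)$ let $$e(K):=\sum_{E\text{ face of }K}\ \inf_{P\in S|_{\omega^\star_E}}|||u-P|||_{\omega^\star_E}^2,\qquad \mathcal E(\mathbb t):=\sum_{K\text{ leaf of }\mathbb t}e(K).$$ Then there are constants $c,C>0$ depending only on $\ell$, $d$ and $\mathcal T_0$ (in particular not on $\varepsilon$, $u$ or $\mathcal T$) such that for all $\varepsilon>0$, all $u\in H^1(\Omega)$ and all face-connected $\mathcal T\in\mathbb T_c$ with corresponding tree $\mathbb t$, $$c\,\mathcal E(\mathbb t)^{1/2}\ \le\ \inf_{v\in S^{\ell,0}(\mathcal T)}|||u-v|||_\Omega\ \le\ C\,\mathcal E(\mathbb t)^{1/2}.$$ Here $\mathcal T$ is face-connected if, for any node $z$ of $S^{\ell,0}(\mathcal T)$ (point of an element with barycentric coordinates in $\ell^{-1}\mathbb Z$) and any two elements $K,K'\in\mathcal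 T$ containing $z$, there is a finite sequence of distinct elements of $\mathcal T$ from $K$ to $K'$ such that any two consecutive ones intersect in a common face containing $z$. Bisection: the children of a tagged simplex $K=(z_0,\dots,z_d)_t$, $t\in\{0,\dots,d-1\}$, are $(z_0,\bar z,z_1,\dots,z_t,z_{t+1},\dots,z_{d-1})_{t'}$ and $(z_d,\bar z,z_1,\dots,z_t,z_{d-1},\dots,z_{t+1})_{t'}$ with $\bar z=(z_0+z_d)/2$ and $t'=(t+1)\bmod d$; the edge $z_0z_d$ is the refinement edge of $K$. Matching condition: all elements of $\mathcal T_0$ have the same type $t$ and, for any two $K,K'\in\mathcal T_0$ sharing a face, if the refinement edge of $K$ or of $K'$ lies in that face, then $K,K'$ are reflected neighbours; otherwise, their children containing that face are reflected neighbours. Two simplices of the same type $t$ sharing a face are reflected neighbours if the ordered vertices of the first simplex $(z_0,\dots,z_d)_t$, or of its reflection $(z_d,z_1,\dots,z_t,z_{d-1},\dots,z_{t+1},z_0)_t$, coincide with those of the second one at all but one position. -/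

import Mathlib

open scoped ContDiff

noncomputable section

namespace TreeApprox

/-- The Euclidean space `ℝ^d`. -/
abbrev Pt (d : ℕ) : Type := EuclideanSpace ℝ (Fin d)

/-! ### Tagged simplices and bisection -/

/-- A tagged `d`-simplex `(z₀, …, z_d)_t`: an ordered list of vertices together with a
type `t ∈ {0, …, d-1}`.  Nondegeneracy is required where meshes are defined. -/
@[ext] structure TaggedSimplex (d : ℕ) where
  vert : Fin (d + 1) → Pt d
  tag : Fin d

namespace TaggedSimplex

variable {d : ℕ}

/-- The set of vertices. -/
def vertices (K : TaggedSimplex d) : Set (Pt d) := Set.range K.vert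

/-- The closed simplex spanned by the vertices. -/
def carrier (K : TaggedSimplex d) : Set (Pt d) := convexHull ℝ K.vertices

/-- The (closed, `(d-1)`-dimensional) face opposite to the vertex with number `i`. -/
def face (K : TaggedSimplex d) (i : Fin (d + 1)) : Set (Pt d) :=
  convexHull ℝ (K.vert '' {i}ᶜ)

/-- The end points `z₀`, `z_d` of the refinement edge. -/
def refEdge (K : TaggedSimplex d) : Set (Pt d) := {K.vert 0, K.vert (Fin.last d)}

/-- The midpoint of the refinement edge. -/
def mid (K : TaggedSimplex d) : Pt d := midpoint ℝ (K.vert 0) (K.vert (Fin.last d))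

/-- The type `(t + 1) mod d` of the two children. -/
def nextTag (K : TaggedSimplex d) : Fin d :=
  ⟨(K.tag.1 + 1) % d, Nat.mod_lt _ (lt_of_le_of_lt (Nat.zero_le _) K.tag.2)⟩

/-- First child `(z₀, z̄, z₁, …, z_t, z_{t+1}, …, z_{d-1})` of type `(t+1) mod d`,
where `z̄` is the midpoint of the refinement edge. -/
def child₁ (K : TaggedSimplex d) : TaggedSimplex d where
  vert := fun i =>
    if _h₀ : i.1 = 0 then K.vert 0
    else if _h₁ : i.1 = 1 then K.mid
    else K.vert ⟨i.1 - 1, by omega⟩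
  tag := K.nextTag

/-- Second child `(z_d, z̄, z₁, …, z_t, z_{d-1}, …, z_{t+1})` of type `(t+1) mod d`. -/
def child₂ (K : TaggedSimplex d) : TaggedSimplex d where
  vert := fun i =>
    if _h₀ : i.1 = 0 then K.vert (Fin.last d)
    else if _h₁ : i.1 = 1 then K.mid
    else if _h₂ : i.1 ≤ K.tag.1 + 1 then K.vert ⟨i.1 - 1, by omega⟩
    else K.vert ⟨d + K.tag.1 + 1 - i.1, by omega⟩
  tag := K.nextTag

/-- The reflected simplex `(z_d, z₁, …, z_t, z_{d-1}, …, z_{t+1}, z₀)_t`; it has the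
same two children. -/
def reflect (K : TaggedSimplex d) : TaggedSimplex d where
  vert := fun i =>
    if _h₀ : i.1 = 0 then K.vert (Fin.last d)
    else if _h₁ : i.1 = d then K.vert 0
    else if _h₂ : i.1 ≤ K.tag.1 then K.vert i
    else K.vert ⟨d + K.tag.1 - i.1, by omega⟩
  tag := K.tag

/-- Two distinct simplices are neighbours if they have a common face. -/
def Neighbours (K K' : TaggedSimplex d) : Prop :=
  K ≠ K' ∧ (K.vertices ∩ K'.vertices).ncard = d

/-- Reflected neighbours: neighbours of the same type such that the ordered vertices of
`K` or of its reflection coincide with those of `K'` at all but one position. -/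
def ReflectedNeighbours (K K' : TaggedSimplex d) : Prop :=
  Neighbours K K' ∧ K.tag = K'.tag ∧
    ((∃! i, K.vert i ≠ K'.vert i) ∨ (∃! i, K.reflect.vert i ≠ K'.vert i))

end TaggedSimplex

open TaggedSimplex

variable {d : ℕ}

/-- Conforming simplicial meshes: the elements are nondegenerate simplices, different
elements are different simplices, and two elements intersect in a common (possibly empty)
subsimplex. -/
structure IsConforming (T : Finset (TaggedSimplex d)) : Prop where
  nondegenerate : ∀ K ∈ T, AffineIndependent ℝ K.vert
  vertices_ne : ∀ K ∈ T, ∀ K' ∈ T, K ≠ K' → K.vertices ≠ K'.vertices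
  inter : ∀ K ∈ T, ∀ K' ∈ T, K.carrier ∩ K'.carrier = convexHull ℝ (K.vertices ∩ K'.vertices)

/-- The matching condition for the initial mesh: all elements have the same type and, for
neighbours `K`, `K'`, if the refinement edge of one of them lies in the common face, then
`K`, `K'` are reflected neighbours; otherwise, the children of `K` and `K'` that contain
the common face are reflected neighbours. -/
def MatchingCondition (T : Finset (TaggedSimplex d)) : Prop :=
  (∀ K ∈ T, ∀ K' ∈ T, K.tag = K'.tag) ∧
  ∀ K ∈ T, ∀ K' ∈ T, Neighbours K K' →
    ((K.refEdge ⊆ K.vertices ∩ K'.vertices ∨ K'.refEdge ⊆ K.vertices ∩ K'.vertices) →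
      ReflectedNeighbours K K') ∧
    (¬ (K.refEdge ⊆ K.vertices ∩ K'.vertices ∨ K'.refEdge ⊆ K.vertices ∩ K'.vertices) →
      ∃ C ∈ ({K.child₁, K.child₂} : Set (TaggedSimplex d)),
      ∃ C' ∈ ({K'.child₁, K'.child₂} : Set (TaggedSimplex d)),
        K.vertices ∩ K'.vertices ⊆ C.vertices ∧ K.vertices ∩ K'.vertices ⊆ C'.vertices ∧
        ReflectedNeighbours C C')

/-! ### Trees and the conforming meshes generated by bisection -/

open Classical in
/-- The leaves of a tree: the nodes without children in the tree. -/
def leaves (𝒯 : Finset (TaggedSimplex d)) : Finset (TaggedSimplex d) :=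
  𝒯.filter fun K => K.child₁ ∉ 𝒯 ∧ K.child₂ ∉ 𝒯

open Classical in
/-- The finite subtrees (more precisely, forests) of the master tree with roots `T₀`: they
arise from `T₀` by successively adding the two children of a leaf, i.e. by successive
bisections of elements of the mesh formed by the leaves. -/
inductive IsTree (T₀ : Finset (TaggedSimplex d)) : Finset (TaggedSimplex d) → Prop
  | roots : IsTree T₀ T₀
  | bisect {𝒯 : Finset (TaggedSimplex d)} {K : TaggedSimplex d} :
      IsTree T₀ 𝒯 → K ∈ leaves 𝒯 → IsTree T₀ (𝒯 ∪ {K.child₁, K.child₂})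

/-- The set `𝕋_c` of all conforming meshes generated from `T₀` by successive bisections. -/
def conformingRefinements (T₀ : Finset (TaggedSimplex d)) : Set (Finset (TaggedSimplex d)) :=
  {T | IsConforming T ∧ ∃ 𝒯, IsTree T₀ 𝒯 ∧ leaves 𝒯 = T}

/-- The closed set covered by a mesh. -/
def meshUnion (T : Finset (TaggedSimplex d)) : Set (Pt d) := ⋃ K ∈ T, K.carrier

/-- The open polyhedral domain `Ω` subdivided by a mesh. -/
def meshDomain (T : Finset (TaggedSimplex d)) : Set (Pt d) := interior (meshUnion T)

/-- `F` is a face of (some element of) the mesh `T`. -/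
def IsFaceOf (T : Finset (TaggedSimplex d)) (F : Set (Pt d)) : Prop :=
  ∃ K ∈ T, ∃ i, K.face i = F

/-- The pair `ω_F`: the union of the elements of `T` sharing the face `F`. -/
def facePair (T : Finset (TaggedSimplex d)) (F : Set (Pt d)) : Set (Pt d) :=
  ⋃ K ∈ {K ∈ T | ∃ i, K.face i = F}, K.carrier

/-- The minimal pair `ω⋆_F`: the intersection of the pairs `ω_F` over all conforming
refinements of `T₀` that have `F` as a face. -/
def minimalPair (T₀ : Finset (TaggedSimplex d)) (F : Set (Pt d)) : Set (Pt d) :=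
  ⋂ T ∈ {T ∈ conformingRefinements T₀ | IsFaceOf T F}, facePair T F

/-! ### Finite element spaces and face-connectedness -/

/-- The Lagrange nodes of degree `ℓ` of a simplex: the points whose barycentric coordinates
are integer multiples of `1/ℓ`. -/
def lagrangeNodes (ℓ : ℕ) (K : TaggedSimplex d) : Set (Pt d) :=
  {z | ∃ a : Fin (d + 1) → ℕ, ∑ i, a i = ℓ ∧ z = ∑ i, ((a i : ℝ) / (ℓ : ℝ)) • K.vert i}

/-- `T` is face-connected: any two elements `K`, `K'` that contain a node `z` of
`S^{ℓ,0}(T)` can be joined by a finite sequence of pairwise distinct elements of `T` such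
that consecutive elements intersect in an interelement face containing `z`. -/
def FaceConnected (ℓ : ℕ) (T : Finset (TaggedSimplex d)) : Prop :=
  ∀ z : Pt d, (∃ K ∈ T, z ∈ lagrangeNodes ℓ K) →
    ∀ K ∈ T, ∀ K' ∈ T, z ∈ K.carrier → z ∈ K'.carrier →
      ∃ (n : ℕ) (path : Fin (n + 1) → TaggedSimplex d),
        Function.Injective path ∧ (∀ j, path j ∈ T) ∧
        path 0 = K ∧ path (Fin.last n) = K' ∧
        ∀ j : Fin n, ∃ i i' : Fin (d + 1),
          (path j.castSucc).carrier ∩ (path j.succ).carrier = (path j.castSucc).face i ∧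
          (path j.castSucc).face i = (path j.succ).face i' ∧
          z ∈ (path j.castSucc).face i

/-- The space `S^{ℓ,0}(T)` of continuous functions that are polynomials of (total) degree at
most `ℓ` on every element.  Functions are total; only their values on the mesh matter. -/
def feSpace (ℓ : ℕ) (T : Finset (TaggedSimplex d)) : Set (Pt d → ℝ) :=
  {v | ContinuousOn v (meshUnion T) ∧
    ∀ K ∈ T, ∃ p : MvPolynomial (Fin d) ℝ, p.totalDegree ≤ ℓ ∧
      ∀ x ∈ K.carrier, v x = MvPolynomial.eval (fun i => x i) p}

/-- Representatives of the space `S|_{ω⋆_F}` of restrictions to the minimal pair of `F`: all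
finite element functions over conforming refinements `T` of `T₀` having `F` as a face.  (The
restrictions to `ω⋆_F` do not depend on `T`, as they are the continuous functions
that are polynomial on both simplices forming `ω⋆_F`.) -/
def localSpace (ℓ : ℕ) (T₀ : Finset (TaggedSimplex d)) (F : Set (Pt d)) : Set (Pt d → ℝ) :=
  {v | ∃ T ∈ conformingRefinements T₀, IsFaceOf T F ∧ v ∈ feSpace ℓ T}

/-! ### `H¹` and the reaction-diffusion norm -/

/-- `u ∈ H¹(Ω)` with weak gradient `G` (which is unique almost everywhere on `Ω`). -/
structure IsH1 (Ω : Set (Pt d)) (u : Pt d → ℝ) (G : Pt d → Pt d) : Prop where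
  memLp : MeasureTheory.MemLp u 2 (MeasureTheory.volume.restrict Ω)
  memLp_grad : MeasureTheory.MemLp G 2 (MeasureTheory.volume.restrict Ω)
  weak : ∀ φ : Pt d → ℝ, ContDiff ℝ ∞ φ → HasCompactSupport φ → tsupport φ ⊆ Ω →
    ∀ y : Pt d, ∫ x in Ω, u x * fderiv ℝ φ x y = - ∫ x in Ω, inner ℝ (G x) y * φ x

/-- The reaction-diffusion norm `(‖w‖²_W + ε ‖∇w‖²_W)^{1/2}` of a function `w` with
gradient `g`. -/
def rdNorm (ε : ℝ) (W : Set (Pt d)) (w : Pt d → ℝ) (g : Pt d → Pt d) : ℝ :=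
  Real.sqrt ((∫ x in W, w x ^ 2) + ε * ∫ x in W, ‖g x‖ ^ 2)

/-- The error `u - v` in the reaction-diffusion norm on `W`, where `G` is the weak gradient
of `u` and `v` is a finite element function; the latter is differentiable almost everywhere
on `W` (in the interior of each element) and this gradient is its weak one. -/
def rdError (ε : ℝ) (W : Set (Pt d)) (u : Pt d → ℝ) (G : Pt d → Pt d) (v : Pt d → ℝ) : ℝ :=
  rdNorm ε W (fun x => u x - v x) (fun x => G x - gradient v x)

/-- The global best error in `S^{ℓ,0}(T)`. -/
def bestError (ℓ : ℕ) (ε : ℝ) (u : Pt d → ℝ) (G : Pt d → Pt d)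
    (T : Finset (TaggedSimplex d)) : ℝ :=
  ⨅ v : feSpace ℓ T, rdError ε (meshDomain T) u G v

/-- The local error functional `e(K)`: the sum over the faces of `K` (boundary faces
included) of the squared best errors on their minimal pairs. -/
def localError (ℓ : ℕ) (T₀ : Finset (TaggedSimplex d)) (ε : ℝ) (u : Pt d → ℝ)
    (G : Pt d → Pt d) (K : TaggedSimplex d) : ℝ :=
  ∑ i, ⨅ P : localSpace ℓ T₀ (K.face i),
    rdError ε (minimalPair T₀ (K.face i)) u G P ^ 2

/-- The global error functional of a tree: the sum of `e(K)` over its leaves. -/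
def treeError (ℓ : ℕ) (T₀ : Finset (TaggedSimplex d)) (ε : ℝ) (u : Pt d → ℝ)
    (G : Pt d → Pt d) (𝒯 : Finset (TaggedSimplex d)) : ℝ :=
  ∑ K ∈ leaves 𝒯, localError ℓ T₀ ε u G K

end TreeApprox

end

/-!
The lower bound restricts a global function `v` to each minimal pair, where it competes for the
local infimum. The minimal pair of a face of `K` lies in the elements touching `K`, and shape
regularity bounds the number of these, so the integrals over all minimal pairs sum to at most a
constant times the global ones (`sum_setIntegral_minimalPair_le`, `exists_treeError_le`).

The upper bound uses a quasi-interpolant (`exists_quasiInterpolant`) whose `L²` and gradient errors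
are bounded separately by those of the local approximations; this makes the constant independent
of `ε`. The geometric input is that a simplex whose refinement edge lies in its face `E` cannot be
bisected without destroying `E`. Hence it is contained in the minimal pair of `E`
(`carrier_subset_minimalPair`), and functions of the local space are polynomials on it. Two
consequences are used:

* Each element `K` lies in the minimal pair of its face opposite to the vertex `1`. A near-best
  approximation for that face yields a polynomial on `K`, normalized by a constant so that its
  weighted mean error over the inscribed ball of `K` vanishes (`exists_isLocalApprox`).
* On each side of a face `E` the minimal pair contains the adjacent element or one of its children
  (`exists_minimal_desc`).

The quasi-interpolant takes, at each node `z`, the value of the polynomial of one element containing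
`z`. On any other element containing `z` the nodal values differ by jumps across faces, summed along
a chain of elements around `z`, which face-connectedness provides (`sum_nodal_le`).

The jump across `E` is compared with a function `P` of the local space of `E` (`exists_jump_le`).
For the `L²` part, the values of a polynomial are bounded by its `L²` norm on a ball
(`exists_poly_bound_scaled`). For the gradient part they are bounded by its gradient and one mean
value. Means of Sobolev functions over balls of comparable size in a convex set differ by their
gradient (`exists_bumpMean_sub_le`), so the mean of `u - P` can be moved from either side of `E` to a
ball around the barycentre of `E` inside the minimal pair, where it is the same for both sides and
cancels in the jump.

All constants are uniform because, up to translation and scaling, bisection produces only finitely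
many simplices (`exists_uniform_regularity`).
-/

open scoped ContDiff

noncomputable section

namespace TreeApprox

open TaggedSimplex MeasureTheory

variable {d : ℕ}

namespace TaggedSimplex
variable {K : TaggedSimplex d}

/-! ### Barycentric coordinates -/

theorem affineIndependent_vert_iff :
    AffineIndependent ℝ K.vert ↔ affineSpan ℝ (Set.range K.vert) = ⊤ := by
  have hcard : Fintype.card (Fin (d + 1)) = Module.finrank ℝ (Pt d) + 1 := by simp
  constructor
  · intro h
    exact h.affineSpan_eq_top_iff_card_eq_finrank_add_one.2 hcard
  · intro h
    rw [affineIndependent_iff_finrank_vectorSpan_eq ℝ K.vert (n := d) (by simp)]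
    have : vectorSpan ℝ (Set.range K.vert) = ⊤ := by
      rw [← direction_affineSpan, h, AffineSubspace.direction_top]
    rw [this, finrank_top]
    simp

/-- The vertices of a nondegenerate simplex as an affine basis of `ℝ^d`. -/
def basis (hK : AffineIndependent ℝ K.vert) : AffineBasis (Fin (d + 1)) ℝ (Pt d) :=
  ⟨K.vert, hK, affineIndependent_vert_iff.1 hK⟩

/-- The `i`-th barycentric coordinate of a nondegenerate simplex, an affine function on `ℝ^d`. -/
def lam (hK : AffineIndependent ℝ K.vert) (i : Fin (d + 1)) : Pt d →ᵃ[ℝ] ℝ :=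
  (basis hK).coord i

variable (hK : AffineIndependent ℝ K.vert)
include hK

theorem lam_vert (i j : Fin (d + 1)) : lam hK i (K.vert j) = if i = j then 1 else 0 :=
  (basis hK).coord_apply i j

theorem sum_lam (x : Pt d) : ∑ i, lam hK i x = 1 := (basis hK).sum_coord_apply_eq_one x

theorem sum_lam_smul (x : Pt d) : ∑ i, lam hK i x • K.vert i = x :=
  (basis hK).linear_combination_coord_eq_self x

theorem lam_sum {ι : Type*} (s : Finset ι) (w : ι → ℝ) (p : ι → Pt d) (hw : ∑ j ∈ s, w j = 1)
    (i : Fin (d + 1)) : lam hK i (∑ j ∈ s, w j • p j) = ∑ j ∈ s, w j * lam hK i (p j) := by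
  rw [← s.affineCombination_eq_linear_combination p w hw, Finset.map_affineCombination _ _ _ hw,
    Finset.affineCombination_eq_linear_combination _ _ _ hw]
  simp

theorem lam_combination (w : Fin (d + 1) → ℝ) (hw : ∑ j, w j = 1) (i : Fin (d + 1)) :
    lam hK i (∑ j, w j • K.vert j) = w i := by
  rw [lam_sum hK _ _ _ hw]
  simp [lam_vert]

theorem eq_of_lam_eq {x y : Pt d} (h : ∀ i, lam hK i x = lam hK i y) : x = y :=
  (basis hK).ext_elem h

theorem lam_lineMap (i : Fin (d + 1)) (x y : Pt d) (t : ℝ) :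
    lam hK i (x + t • (y - x)) = lam hK i x + t * (lam hK i y - lam hK i x) := by
  have h := (lam hK i).apply_lineMap x y t
  rw [AffineMap.lineMap_apply, AffineMap.lineMap_apply] at h
  simp only [vsub_eq_sub, vadd_eq_add, smul_eq_mul] at h
  rw [add_comm x, h, add_comm]

theorem continuous_lam (i : Fin (d + 1)) : Continuous (lam hK i) :=
  (lam hK i).continuous_of_finiteDimensional

theorem mem_carrier_iff {x : Pt d} : x ∈ K.carrier ↔ ∀ i, 0 ≤ lam hK i x := by
  have := (basis hK).convexHull_eq_nonneg_coord
  exact Set.ext_iff.1 this x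

theorem mem_interior_carrier_iff {x : Pt d} : x ∈ interior K.carrier ↔ ∀ i, 0 < lam hK i x := by
  have := (basis hK).interior_convexHull
  exact Set.ext_iff.1 this x

theorem mem_convexHull_image_iff (S : Set (Fin (d + 1))) {x : Pt d} :
    x ∈ convexHull ℝ (K.vert '' S) ↔ (∀ i, 0 ≤ lam hK i x) ∧ ∀ i ∉ S, lam hK i x = 0 := by
  classical
  constructor
  · intro hx
    have hsub : K.vert '' S ⊆ {x | (∀ i, 0 ≤ lam hK i x) ∧ ∀ i ∉ S, lam hK i x = 0} := by
      rintro _ ⟨j, hj, rfl⟩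
      refine ⟨fun i => ?_, fun i hi => ?_⟩
      · rw [lam_vert]; split_ifs <;> norm_num
      · rw [lam_vert, if_neg]; rintro rfl; exact hi hj
    refine convexHull_min hsub ?_ hx
    have h1 : Convex ℝ (⋂ i, (lam hK i) ⁻¹' Set.Ici 0) :=
      convex_iInter fun i => (convex_Ici 0).affine_preimage _
    have h2 : Convex ℝ (⋂ i ∈ Sᶜ, (lam hK i) ⁻¹' {0}) :=
      convex_iInter₂ fun i _ => (convex_singleton 0).affine_preimage _
    have e : {x | (∀ i, 0 ≤ lam hK i x) ∧ ∀ i ∉ S, lam hK i x = 0}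
        = (⋂ i, (lam hK i) ⁻¹' Set.Ici 0) ∩ ⋂ i ∈ Sᶜ, (lam hK i) ⁻¹' {0} := by
      ext x; simp
    rw [e]
    exact h1.inter h2
  · rintro ⟨h0, h1⟩
    rw [← sum_lam_smul hK x]
    have hs : ∑ i, lam hK i x • K.vert i
        = ∑ i ∈ Finset.univ.filter (· ∈ S), lam hK i x • K.vert i := by
      refine (Finset.sum_subset (Finset.filter_subset _ _) fun i _ hi => ?_).symm
      rw [h1 i (by simpa using hi), zero_smul]
    rw [hs]
    refine (convex_convexHull ℝ _).sum_mem (fun i _ => h0 i) ?_ fun i hi => ?_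
    · rw [← sum_lam hK x]
      refine Finset.sum_subset (Finset.filter_subset _ _) fun i _ hi => ?_
      exact h1 i (by simpa using hi)
    · exact subset_convexHull ℝ _ ⟨i, by simpa using hi, rfl⟩

theorem mem_face_iff (i : Fin (d + 1)) {x : Pt d} :
    x ∈ K.face i ↔ (∀ j, 0 ≤ lam hK j x) ∧ lam hK i x = 0 := by
  rw [face, mem_convexHull_image_iff hK]
  simp

theorem vert_mem_face_iff (i j : Fin (d + 1)) : K.vert j ∈ K.face i ↔ j ≠ i := by
  rw [mem_face_iff hK]
  constructor
  · rintro ⟨_, h⟩ rfl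
    simp [lam_vert] at h
  · intro h
    refine ⟨fun k => ?_, ?_⟩
    · rw [lam_vert]; split_ifs <;> norm_num
    · rw [lam_vert, if_neg (Ne.symm h)]

omit hK

theorem convex_carrier : Convex ℝ K.carrier := convex_convexHull ℝ _

theorem isCompact_carrier : IsCompact K.carrier :=
  (Set.finite_range K.vert).isCompact_convexHull ℝ

theorem isClosed_carrier : IsClosed K.carrier := isCompact_carrier.isClosed

theorem vert_mem_carrier (i : Fin (d + 1)) : K.vert i ∈ K.carrier :=
  subset_convexHull ℝ _ ⟨i, rfl⟩

theorem face_subset_carrier (i : Fin (d + 1)) : K.face i ⊆ K.carrier :=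
  convexHull_mono (Set.image_subset_range _ _)

include hK

theorem interior_carrier_nonempty : (interior K.carrier).Nonempty :=
  interior_convexHull_nonempty_iff_affineSpan_eq_top.2 (affineIndependent_vert_iff.1 hK)

theorem closure_interior_carrier : closure (interior K.carrier) = K.carrier := by
  rw [convex_carrier.closure_interior_eq_closure_of_nonempty_interior
    (interior_carrier_nonempty hK), isClosed_carrier.closure_eq]

theorem inter_interior_nonempty {O : Set (Pt d)} (hO : IsOpen O) (h : (O ∩ K.carrier).Nonempty) :
    (O ∩ interior K.carrier).Nonempty := by
  obtain ⟨x, hxO, hx⟩ := h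
  rw [← closure_interior_carrier hK] at hx
  exact mem_closure_iff.1 hx O hO hxO

omit hK

/-! ### Children -/

theorem one_le_dim (K : TaggedSimplex d) : 1 ≤ d := lt_of_le_of_lt (Nat.zero_le _) K.tag.2

theorem last_ne_zero (K : TaggedSimplex d) : Fin.last d ≠ 0 := by
  have := one_le_dim K
  intro h
  have := congrArg Fin.val h
  simp at this
  omega

theorem vertices_child₁ : K.child₁.vertices = insert K.mid (K.vert '' {Fin.last d}ᶜ) := by
  have hd := one_le_dim K
  ext x
  simp only [vertices, Set.mem_range, child₁, Set.mem_insert_iff, Set.mem_image,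
    Set.mem_compl_iff, Set.mem_singleton_iff]
  constructor
  · rintro ⟨i, rfl⟩
    split_ifs with h0 h1
    · exact Or.inr ⟨0, by simp [Fin.ext_iff]; omega, rfl⟩
    · exact Or.inl rfl
    · exact Or.inr ⟨_, by simp [Fin.ext_iff]; omega, rfl⟩
  · rintro (rfl | ⟨i, hi, rfl⟩)
    · exact ⟨⟨1, by omega⟩, by simp⟩
    · have hi' : i.1 < d := by
        have := i.2; simp only [Fin.ext_iff, Fin.val_last] at hi; omega
      by_cases h0 : i.1 = 0
      · refine ⟨0, ?_⟩
        have : i = 0 := Fin.ext h0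
        simp [this]
      · refine ⟨⟨i.1 + 1, by omega⟩, ?_⟩
        simp [h0]

theorem vertices_child₂ : K.child₂.vertices = insert K.mid (K.vert '' {0}ᶜ) := by
  have hd := one_le_dim K
  have ht := K.tag.2
  ext x
  simp only [vertices, Set.mem_range, child₂, Set.mem_insert_iff, Set.mem_image,
    Set.mem_compl_iff, Set.mem_singleton_iff]
  constructor
  · rintro ⟨i, rfl⟩
    have := i.2
    split_ifs with h0 h1 h2
    · exact Or.inr ⟨Fin.last d, last_ne_zero K, rfl⟩
    · exact Or.inl rfl
    · exact Or.inr ⟨_, by simp [Fin.ext_iff]; omega, rfl⟩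
    · exact Or.inr ⟨_, by simp [Fin.ext_iff]; omega, rfl⟩
  · rintro (rfl | ⟨i, hi, rfl⟩)
    · exact ⟨⟨1, by omega⟩, by simp⟩
    · have hi' : i.1 ≠ 0 := fun h => hi (Fin.ext h)
      have := i.2
      by_cases h0 : i.1 = d
      · refine ⟨0, ?_⟩
        have : i = Fin.last d := Fin.ext h0
        simp [this]
      · by_cases h1 : i.1 ≤ K.tag.1
        · refine ⟨⟨i.1 + 1, by omega⟩, ?_⟩
          simp [h1, hi']
        · refine ⟨⟨d + K.tag.1 + 1 - i.1, by omega⟩, ?_⟩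
          have e1 : d + K.tag.1 + 1 - i.1 ≠ 0 := by omega
          have e2 : d + K.tag.1 + 1 - i.1 ≠ 1 := by omega
          have e3 : ¬ (d + K.tag.1 + 1 - i.1 ≤ K.tag.1 + 1) := by omega
          simp only [e1, e2, e3, dite_false]
          congr 1
          ext
          simp only
          omega

/-- The parent-child relation of the bisection tree. -/
def IsChild (K C : TaggedSimplex d) : Prop := C = K.child₁ ∨ C = K.child₂

theorem mid_eq : K.mid = (1 / 2 : ℝ) • K.vert 0 + (1 / 2 : ℝ) • K.vert (Fin.last d) := by
  rw [mid, midpoint_eq_smul_add, smul_add]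
  norm_num

theorem mid_mem_carrier : K.mid ∈ K.carrier := by
  rw [mid_eq]
  exact convex_carrier (vert_mem_carrier _) (vert_mem_carrier _) (by norm_num) (by norm_num)
    (by norm_num)

theorem carrier_child₁_subset : K.child₁.carrier ⊆ K.carrier := by
  refine convexHull_min ?_ convex_carrier
  rw [vertices_child₁]
  rintro _ (rfl | ⟨i, _, rfl⟩)
  · exact mid_mem_carrier
  · exact vert_mem_carrier _

theorem carrier_child₂_subset : K.child₂.carrier ⊆ K.carrier := by
  refine convexHull_min ?_ convex_carrier
  rw [vertices_child₂]
  rintro _ (rfl | ⟨i, _, rfl⟩)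
  · exact mid_mem_carrier
  · exact vert_mem_carrier _

theorem IsChild.carrier_subset {C : TaggedSimplex d} (h : IsChild K C) : C.carrier ⊆ K.carrier := by
  rcases h with rfl | rfl
  · exact carrier_child₁_subset
  · exact carrier_child₂_subset

include hK

theorem lam_mid (i : Fin (d + 1)) :
    lam hK i K.mid = (if i = 0 then 1 / 2 else 0) + if i = Fin.last d then 1 / 2 else 0 := by
  have h := lam_sum hK (Finset.univ : Finset (Fin 2)) ![1/2, 1/2] ![K.vert 0, K.vert (Fin.last d)]
    (by simp; norm_num) i
  simp only [Fin.sum_univ_two, Matrix.cons_val_zero, Matrix.cons_val_one, lam_vert] at h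
  rw [mid_eq, h]
  split_ifs <;> simp

/-- The first child lies in the half-space where the coordinate of `z₀` dominates that of `z_d`. -/
theorem lam_last_le_of_mem_child₁ {x : Pt d} (hx : x ∈ K.child₁.carrier) :
    lam hK (Fin.last d) x ≤ lam hK 0 x := by
  have hne := last_ne_zero K
  have hconv : Convex ℝ {x | lam hK (Fin.last d) x ≤ lam hK 0 x} := by
    have := (convex_Ici (0 : ℝ)).affine_preimage (lam hK 0 - lam hK (Fin.last d))
    have e : {x | lam hK (Fin.last d) x ≤ lam hK 0 x}
        = (lam hK 0 - lam hK (Fin.last d)) ⁻¹' Set.Ici 0 := by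
      ext x; simp
    rwa [e]
  refine convexHull_min ?_ hconv hx
  rw [vertices_child₁]
  rintro _ (rfl | ⟨i, hi, rfl⟩)
  · simp [lam_mid, hne, hne.symm]
  · simp only [Set.mem_compl_iff, Set.mem_singleton_iff] at hi
    simp only [Set.mem_ofPred_eq, lam_vert, if_neg (Ne.symm hi)]
    split_ifs <;> norm_num

theorem lam_zero_le_of_mem_child₂ {x : Pt d} (hx : x ∈ K.child₂.carrier) :
    lam hK 0 x ≤ lam hK (Fin.last d) x := by
  have hne := last_ne_zero K
  have hconv : Convex ℝ {x | lam hK 0 x ≤ lam hK (Fin.last d) x} := by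
    have := (convex_Ici (0 : ℝ)).affine_preimage (lam hK (Fin.last d) - lam hK 0)
    have e : {x | lam hK 0 x ≤ lam hK (Fin.last d) x}
        = (lam hK (Fin.last d) - lam hK 0) ⁻¹' Set.Ici 0 := by
      ext x; simp
    rwa [e]
  refine convexHull_min ?_ hconv hx
  rw [vertices_child₂]
  rintro _ (rfl | ⟨i, hi, rfl⟩)
  · simp [lam_mid, hne, hne.symm]
  · simp only [Set.mem_compl_iff, Set.mem_singleton_iff] at hi
    simp only [Set.mem_ofPred_eq, lam_vert, if_neg (Ne.symm hi)]
    split_ifs <;> norm_num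

/-- A point of a simplex is a convex combination of the midpoint of the refinement edge and of
the vertices different from the end point `b` of that edge with the smaller coordinate. -/
theorem mem_convexHull_insert_mid {a b : Fin (d + 1)} (hab : a ≠ b)
    (hmid : K.mid = (1 / 2 : ℝ) • K.vert a + (1 / 2 : ℝ) • K.vert b) {x : Pt d}
    (hx : x ∈ K.carrier) (h : lam hK b x ≤ lam hK a x) :
    x ∈ convexHull ℝ (insert K.mid (K.vert '' {b}ᶜ)) := by
  have h0 := (mem_carrier_iff hK).1 hx
  have key : x = (2 * lam hK b x) • K.mid + ∑ i ∈ Finset.univ.erase b,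
      (lam hK i x - if i = a then lam hK b x else 0) • K.vert i := by
    conv_lhs => rw [← sum_lam_smul hK x]
    rw [← Finset.add_sum_erase _ _ (Finset.mem_univ b)]
    simp only [sub_smul, Finset.sum_sub_distrib, ite_smul, zero_smul]
    rw [Finset.sum_ite_eq' (Finset.univ.erase b) a, if_pos (by simp [hab]), hmid, smul_add,
      smul_smul, smul_smul]
    have : 2 * lam hK b x * (1 / 2) = lam hK b x := by ring
    rw [this]
    abel
  have hsum : 2 * lam hK b x + ∑ i ∈ Finset.univ.erase b,
      (lam hK i x - if i = a then lam hK b x else 0) = 1 := by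
    rw [Finset.sum_sub_distrib, Finset.sum_ite_eq' (Finset.univ.erase b) a,
      if_pos (by simp [hab]), ← sum_lam hK x, ← Finset.add_sum_erase _ _ (Finset.mem_univ b)]
    ring
  have hnn : ∀ i ∈ Finset.univ.erase b, 0 ≤ lam hK i x - if i = a then lam hK b x else 0 := by
    intro i _
    split_ifs with hi
    · subst hi; linarith
    · simpa using h0 i
  have hc := convex_convexHull ℝ (insert K.mid (K.vert '' {b}ᶜ))
  have := hc.sum_mem (t := (Finset.univ : Finset (Option {i // i ∈ Finset.univ.erase b})))
    (w := fun o => o.elim (2 * lam hK b x)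
      fun i => lam hK i.1 x - if i.1 = a then lam hK b x else 0)
    (z := fun o => o.elim K.mid fun i => K.vert i.1) ?_ ?_ ?_
  · rw [Fintype.sum_option] at this
    simp only [Option.elim] at this
    rw [Finset.sum_coe_sort (Finset.univ.erase b)
      (fun i => (lam hK i x - if i = a then lam hK b x else 0) • K.vert i), ← key] at this
    exact this
  · rintro (_ | i) _
    · exact mul_nonneg (by norm_num) (h0 b)
    · exact hnn i.1 i.2
  · rw [Fintype.sum_option]
    simp only [Option.elim]
    rw [Finset.sum_coe_sort (Finset.univ.erase b)
      (fun i => (lam hK i x - if i = a then lam hK b x else 0)), hsum]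
  · rintro (_ | i) _
    · exact subset_convexHull ℝ _ (Set.mem_insert _ _)
    · refine subset_convexHull ℝ _ (Set.mem_insert_of_mem _ ⟨i.1, ?_, rfl⟩)
      exact Finset.ne_of_mem_erase i.2

theorem carrier_eq_union_children : K.carrier = K.child₁.carrier ∪ K.child₂.carrier := by
  refine Set.Subset.antisymm (fun x hx => ?_)
    (Set.union_subset carrier_child₁_subset carrier_child₂_subset)
  rcases le_total (lam hK (Fin.last d) x) (lam hK 0 x) with h | h
  · left
    rw [carrier, vertices_child₁]
    exact mem_convexHull_insert_mid hK (last_ne_zero K).symm mid_eq hx h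
  · right
    rw [carrier, vertices_child₂]
    exact mem_convexHull_insert_mid hK (last_ne_zero K) (by rw [mid_eq, add_comm]) hx h

theorem vert_last_notMem_child₁ : K.vert (Fin.last d) ∉ K.child₁.carrier := by
  intro h
  have := lam_last_le_of_mem_child₁ hK h
  simp only [lam_vert, if_true, if_neg (last_ne_zero K).symm] at this
  linarith

theorem vert_zero_notMem_child₂ : K.vert 0 ∉ K.child₂.carrier := by
  intro h
  have := lam_zero_le_of_mem_child₂ hK h
  simp only [lam_vert, if_true, if_neg (last_ne_zero K)] at this
  linarith

theorem disjoint_interior_children :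
    Disjoint (interior K.child₁.carrier) (interior K.child₂.carrier) := by
  rw [Set.disjoint_iff_inter_eq_empty]
  by_contra hne
  obtain ⟨x, hx⟩ := Set.nonempty_iff_ne_empty.2 hne
  set O := interior K.child₁.carrier ∩ interior K.child₂.carrier
  have hO : IsOpen O := isOpen_interior.inter isOpen_interior
  have hcont : Continuous fun t : ℝ => x + t • (K.vert 0 - K.vert (Fin.last d)) := by fun_prop
  have hev : ∀ᶠ t : ℝ in nhds 0, x + t • (K.vert 0 - K.vert (Fin.last d)) ∈ O := by
    apply hcont.continuousAt.eventually_mem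
    simpa using hO.mem_nhds hx
  obtain ⟨δ, hδ, hball⟩ := Metric.eventually_nhds_iff.1 hev
  have ht := @hball (δ / 2) (by simp [abs_of_pos hδ]; linarith)
  have key : ∀ y ∈ O, lam hK 0 y = lam hK (Fin.last d) y := fun y hy =>
    le_antisymm (lam_zero_le_of_mem_child₂ hK (interior_subset hy.2))
      (lam_last_le_of_mem_child₁ hK (interior_subset hy.1))
  have e1 := key x hx
  have e2 := key _ ht
  have hl : ∀ i, lam hK i (x + (δ / 2) • (K.vert 0 - K.vert (Fin.last d)))
      = lam hK i x + δ / 2 * (lam hK i (K.vert 0) - lam hK i (K.vert (Fin.last d))) := by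
    intro i
    have h := (lam hK i).map_vadd x ((δ / 2) • (K.vert 0 - K.vert (Fin.last d)))
    rw [map_smul, ← vsub_eq_sub (K.vert 0), AffineMap.linearMap_vsub] at h
    simp only [vsub_eq_sub, vadd_eq_add, smul_eq_mul] at h
    rw [add_comm x, h, add_comm]
  rw [hl, hl] at e2
  simp only [lam_vert, if_true, if_neg (last_ne_zero K), if_neg (last_ne_zero K).symm] at e2
  linarith

theorem affineIndependent_child₁ : AffineIndependent ℝ K.child₁.vert := by
  rw [affineIndependent_vert_iff, ← top_le_iff, ← affineIndependent_vert_iff.1 hK]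
  change _ ≤ affineSpan ℝ K.child₁.vertices
  rw [affineSpan_le]
  rintro _ ⟨i, rfl⟩
  have hv := vertices_child₁ (K := K)
  have hsub := subset_affineSpan ℝ K.child₁.vertices
  by_cases hi : i = Fin.last d
  · have h0 : K.vert 0 ∈ affineSpan ℝ K.child₁.vertices :=
      hsub (by rw [hv]; exact Or.inr ⟨0, (last_ne_zero K).symm, rfl⟩)
    have hm : K.mid ∈ affineSpan ℝ K.child₁.vertices := hsub (by rw [hv]; exact Or.inl rfl)
    have := AffineMap.lineMap_mem (2 : ℝ) h0 hm
    rw [AffineMap.lineMap_apply, mid_eq] at this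
    simp only [vsub_eq_sub, vadd_eq_add] at this
    have e : K.vert (Fin.last d) = (2 : ℝ) • ((1 / 2 : ℝ) • K.vert 0
        + (1 / 2 : ℝ) • K.vert (Fin.last d) - K.vert 0) + K.vert 0 := by module
    rw [hi, e]
    exact this
  · exact hsub (by rw [hv]; exact Or.inr ⟨i, hi, rfl⟩)

theorem affineIndependent_child₂ : AffineIndependent ℝ K.child₂.vert := by
  rw [affineIndependent_vert_iff, ← top_le_iff, ← affineIndependent_vert_iff.1 hK]
  change _ ≤ affineSpan ℝ K.child₂.vertices
  rw [affineSpan_le]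
  rintro _ ⟨i, rfl⟩
  have hv := vertices_child₂ (K := K)
  have hsub := subset_affineSpan ℝ K.child₂.vertices
  by_cases hi : i = 0
  · have h0 : K.vert (Fin.last d) ∈ affineSpan ℝ K.child₂.vertices :=
      hsub (by rw [hv]; exact Or.inr ⟨Fin.last d, last_ne_zero K, rfl⟩)
    have hm : K.mid ∈ affineSpan ℝ K.child₂.vertices := hsub (by rw [hv]; exact Or.inl rfl)
    have := AffineMap.lineMap_mem (2 : ℝ) h0 hm
    rw [AffineMap.lineMap_apply, mid_eq] at this
    simp only [vsub_eq_sub, vadd_eq_add] at this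
    have e : K.vert 0 = (2 : ℝ) • ((1 / 2 : ℝ) • K.vert 0
        + (1 / 2 : ℝ) • K.vert (Fin.last d) - K.vert (Fin.last d)) + K.vert (Fin.last d) := by
      module
    rw [hi, e]
    exact this
  · exact hsub (by rw [hv]; exact Or.inr ⟨i, hi, rfl⟩)

theorem IsChild.affineIndependent {C : TaggedSimplex d} (h : IsChild K C) :
    AffineIndependent ℝ C.vert := by
  rcases h with rfl | rfl
  · exact affineIndependent_child₁ hK
  · exact affineIndependent_child₂ hK

/-- The children's face opposite to the new vertex, i.e. the face of the parent opposite to an end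
point of its refinement edge. -/
theorem face_one_child₁ (h1 : 1 < d + 1) : K.child₁.face ⟨1, h1⟩ = K.face (Fin.last d) := by
  have hC := affineIndependent_child₁ hK
  have himg : K.child₁.vert '' {⟨1, h1⟩}ᶜ = K.vert '' {Fin.last d}ᶜ := by
    rw [Set.image_compl_eq_range_sdiff_image hC.injective]
    change K.child₁.vertices \ _ = _
    have hm : K.mid ∉ K.vert '' {Fin.last d}ᶜ := by
      rintro ⟨i, hi, he⟩
      have := lam_mid hK (Fin.last d)
      rw [← he, lam_vert] at this
      simp [last_ne_zero K, Ne.symm hi] at this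
    rw [vertices_child₁, Set.image_singleton]
    have : K.child₁.vert ⟨1, h1⟩ = K.mid := by simp [child₁]
    rw [this, Set.insert_sdiff_of_mem _ (Set.mem_singleton _), Set.sdiff_singleton_eq_self hm]
  rw [face, himg, face]

theorem face_one_child₂ (h1 : 1 < d + 1) : K.child₂.face ⟨1, h1⟩ = K.face 0 := by
  have hC := affineIndependent_child₂ hK
  have himg : K.child₂.vert '' {⟨1, h1⟩}ᶜ = K.vert '' {0}ᶜ := by
    rw [Set.image_compl_eq_range_sdiff_image hC.injective]
    change K.child₂.vertices \ _ = _
    have hm : K.mid ∉ K.vert '' {0}ᶜ := by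
      rintro ⟨i, hi, he⟩
      have := lam_mid hK 0
      rw [← he, lam_vert] at this
      simp [(last_ne_zero K).symm, Ne.symm hi] at this
    rw [vertices_child₂, Set.image_singleton]
    have : K.child₂.vert ⟨1, h1⟩ = K.mid := by simp [child₂]
    rw [this, Set.insert_sdiff_of_mem _ (Set.mem_singleton _), Set.sdiff_singleton_eq_self hm]
  rw [face, himg, face]

end TaggedSimplex

/-! ### The bisection forest -/

namespace TaggedSimplex
variable {K : TaggedSimplex d}

/-- `N` is obtained from `K` by finitely many bisections (possibly none). -/
def Desc (K N : TaggedSimplex d) : Prop := Relation.ReflTransGen IsChild K N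

theorem Desc.carrier_subset {N : TaggedSimplex d} (h : Desc K N) : N.carrier ⊆ K.carrier := by
  induction h with
  | refl => exact subset_rfl
  | tail _ hc ih => exact hc.carrier_subset.trans ih

theorem Desc.affineIndependent {N : TaggedSimplex d} (h : Desc K N)
    (hK : AffineIndependent ℝ K.vert) : AffineIndependent ℝ N.vert := by
  induction h with
  | refl => exact hK
  | tail _ hc ih => exact hc.affineIndependent ih

theorem IsChild.not_carrier_subset {C : TaggedSimplex d} (h : IsChild K C)
    (hK : AffineIndependent ℝ K.vert) : ¬ K.carrier ⊆ C.carrier := by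
  intro hs
  rcases h with rfl | rfl
  · exact vert_last_notMem_child₁ hK (hs (vert_mem_carrier _))
  · exact vert_zero_notMem_child₂ hK (hs (vert_mem_carrier _))

theorem Desc.eq_or_exists_child {N : TaggedSimplex d} (h : Desc K N) :
    N = K ∨ ∃ C, IsChild K C ∧ Desc C N := by
  rcases Relation.ReflTransGen.cases_head h with rfl | ⟨C, hC, hCN⟩
  · exact Or.inl rfl
  · exact Or.inr ⟨C, hC, hCN⟩

theorem IsChild.disjoint_or_eq (hK : AffineIndependent ℝ K.vert) {C C' : TaggedSimplex d}
    (h : IsChild K C) (h' : IsChild K C') :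
    C = C' ∨ Disjoint (interior C.carrier) (interior C'.carrier) := by
  rcases h with rfl | rfl <;> rcases h' with rfl | rfl
  · exact Or.inl rfl
  · exact Or.inr (disjoint_interior_children hK)
  · exact Or.inr (disjoint_interior_children hK).symm
  · exact Or.inl rfl

/-- Two descendants of the same simplex are nested, or their interiors are disjoint. -/
theorem Desc.nested (hK : AffineIndependent ℝ K.vert) {N : TaggedSimplex d} (h : Desc K N) :
    ∀ N', Desc K N' → Desc N N' ∨ Desc N' N ∨ Disjoint (interior N.carrier) (interior N'.carrier) := by
  induction h using Relation.ReflTransGen.head_induction_on with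
  | refl => exact fun N' h' => Or.inl h'
  | @head K C hKC hCN ih =>
    intro N' h'
    rcases h'.eq_or_exists_child with rfl | ⟨C', hC', hC'N'⟩
    · exact Or.inr (Or.inl (Relation.ReflTransGen.head hKC hCN))
    · rcases hKC.disjoint_or_eq hK hC' with rfl | hdis
      · exact ih (hKC.affineIndependent hK) N' hC'N'
      · exact Or.inr (Or.inr (hdis.mono (interior_mono (Desc.carrier_subset hCN))
          (interior_mono hC'N'.carrier_subset)))

end TaggedSimplex

theorem IsConforming.disjoint_interior {T : Finset (TaggedSimplex d)} (hT : IsConforming T)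
    {K K' : TaggedSimplex d} (hK : K ∈ T) (hK' : K' ∈ T) (hne : K ≠ K') :
    Disjoint (interior K.carrier) (interior K'.carrier) := by
  have hKn := hT.nondegenerate K hK
  have hKn' := hT.nondegenerate K' hK'
  have hex : ∃ i, K.vert i ∉ K'.vertices := by
    by_contra hall
    push Not at hall
    have hsub : K.vertices ⊆ K'.vertices := by rintro _ ⟨i, rfl⟩; exact hall i
    refine hT.vertices_ne K hK K' hK' hne ?_
    refine Set.eq_of_subset_of_ncard_le hsub ?_ (Set.finite_range _)
    rw [vertices, vertices, ← Set.image_univ, ← Set.image_univ,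
      Set.ncard_image_of_injective _ hKn.injective, Set.ncard_image_of_injective _ hKn'.injective]
  obtain ⟨i, hi⟩ := hex
  rw [Set.disjoint_left]
  intro x hx hx'
  have hmem : x ∈ convexHull ℝ (K.vertices ∩ K'.vertices) := by
    rw [← hT.inter K hK K' hK']
    exact ⟨interior_subset hx, interior_subset hx'⟩
  have hsub : K.vertices ∩ K'.vertices ⊆ K.vert '' {i}ᶜ := by
    rintro _ ⟨⟨j, rfl⟩, hj⟩
    exact ⟨j, by rintro rfl; exact hi hj, rfl⟩
  have := (mem_face_iff hKn i).1 (convexHull_mono hsub hmem)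
  exact absurd this.2 ((mem_interior_carrier_iff hKn).1 hx i).ne'

/-- The nodes of the master forest with roots `T₀`. -/
def IsNode (T₀ : Finset (TaggedSimplex d)) (N : TaggedSimplex d) : Prop := ∃ R ∈ T₀, Desc R N

section Forest
open scoped Classical
variable {T₀ : Finset (TaggedSimplex d)} (hT₀ : IsConforming T₀)
include hT₀

theorem IsNode.affineIndependent {N : TaggedSimplex d} (h : IsNode T₀ N) :
    AffineIndependent ℝ N.vert := by
  obtain ⟨R, hR, h⟩ := h
  exact h.affineIndependent (hT₀.nondegenerate R hR)

omit hT₀ in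
theorem IsNode.desc {N N' : TaggedSimplex d} (h : IsNode T₀ N) (h' : Desc N N') : IsNode T₀ N' := by
  obtain ⟨R, hR, h⟩ := h
  exact ⟨R, hR, Relation.ReflTransGen.trans h h'⟩

omit hT₀ in
theorem IsNode.child {N C : TaggedSimplex d} (h : IsNode T₀ N) (h' : IsChild N C) : IsNode T₀ C :=
  h.desc (Relation.ReflTransGen.single h')

theorem IsNode.nested {N N' : TaggedSimplex d} (h : IsNode T₀ N) (h' : IsNode T₀ N') :
    Desc N N' ∨ Desc N' N ∨ Disjoint (interior N.carrier) (interior N'.carrier) := by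
  obtain ⟨R, hR, h⟩ := h
  obtain ⟨R', hR', h'⟩ := h'
  by_cases hRR : R = R'
  · subst hRR
    exact h.nested (hT₀.nondegenerate R hR) N' h'
  · exact Or.inr (Or.inr ((hT₀.disjoint_interior hR hR' hRR).mono
      (interior_mono h.carrier_subset) (interior_mono h'.carrier_subset)))

theorem IsNode.nested_of_overlap {N N' : TaggedSimplex d} (h : IsNode T₀ N) (h' : IsNode T₀ N')
    (ho : (interior N.carrier ∩ N'.carrier).Nonempty) : Desc N N' ∨ Desc N' N := by
  rcases h.nested hT₀ h' with h1 | h1 | h1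
  · exact Or.inl h1
  · exact Or.inr h1
  · have := inter_interior_nonempty (h'.affineIndependent hT₀) isOpen_interior ho
    exact absurd this (Set.not_nonempty_iff_eq_empty.2 (Set.disjoint_iff_inter_eq_empty.1 h1))

/-- A root is not the child of a node. -/
theorem IsNode.child_notMem_roots {N C : TaggedSimplex d} (h : IsNode T₀ N) (hC : IsChild N C) :
    C ∉ T₀ := by
  intro hCT
  obtain ⟨R, hR, hd⟩ := h
  have hN := hd.affineIndependent (hT₀.nondegenerate R hR)
  have hsub := hC.carrier_subset.trans hd.carrier_subset
  have hRC : R = C := by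
    by_contra hne
    obtain ⟨x, hx⟩ := interior_carrier_nonempty (hC.affineIndependent hN)
    exact Set.disjoint_left.1 (hT₀.disjoint_interior hR hCT hne) (interior_mono hsub hx) hx
  subst hRC
  exact hC.not_carrier_subset hN hd.carrier_subset

theorem IsChild.eq_of_desc {K N C : TaggedSimplex d} (hKn : IsNode T₀ K) (hd : Desc K N)
    (hK : IsChild K C) (hN : IsChild N C) : N = K := by
  have hKi := hKn.affineIndependent hT₀
  have hNi := hd.affineIndependent hKi
  rcases hd.eq_or_exists_child with h | ⟨C', hC', hC'N⟩
  · exact h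
  · exfalso
    rcases hK.disjoint_or_eq hKi hC' with rfl | hdis
    · exact hN.not_carrier_subset hNi hC'N.carrier_subset
    · obtain ⟨x, hx⟩ := interior_carrier_nonempty (hN.affineIndependent hNi)
      exact Set.disjoint_left.1 hdis hx
        (interior_mono (hN.carrier_subset.trans hC'N.carrier_subset) hx)

/-- The parent of a node is unique. -/
theorem IsNode.parent_unique {N K C : TaggedSimplex d} (hN : IsNode T₀ N) (hK : IsNode T₀ K)
    (hNC : IsChild N C) (hKC : IsChild K C) : N = K := by
  have hCi := hNC.affineIndependent (hN.affineIndependent hT₀)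
  obtain ⟨x, hx⟩ := interior_carrier_nonempty hCi
  rcases hN.nested hT₀ hK with h | h | h
  · exact (IsChild.eq_of_desc hT₀ hN h hNC hKC).symm
  · exact IsChild.eq_of_desc hT₀ hK h hKC hNC
  · exact absurd (interior_mono hKC.carrier_subset hx)
      (Set.disjoint_left.1 h (interior_mono hNC.carrier_subset hx))

omit hT₀ in
theorem IsTree.isNode {𝒯 : Finset (TaggedSimplex d)} (h : IsTree T₀ 𝒯) :
    ∀ N ∈ 𝒯, IsNode T₀ N := by
  induction h with
  | roots => exact fun N hN => ⟨N, hN, Relation.ReflTransGen.refl⟩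
  | @bisect 𝒯 K _ hK ih =>
    have hKn : IsNode T₀ K := ih K (Finset.mem_filter.1 hK).1
    intro N hN
    rcases Finset.mem_union.1 hN with hN | hN
    · exact ih N hN
    · rcases Finset.mem_insert.1 hN with rfl | hN
      · exact hKn.child (Or.inl rfl)
      · rw [Finset.mem_singleton.1 hN]
        exact hKn.child (Or.inr rfl)

/-- A tree contains the parent and the sibling of each of its nodes that are not roots. -/
theorem IsTree.parent_sibling {𝒯 : Finset (TaggedSimplex d)} (h : IsTree T₀ 𝒯) :
    ∀ N, IsNode T₀ N → (N.child₁ ∈ 𝒯 ∨ N.child₂ ∈ 𝒯) →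
      N ∈ 𝒯 ∧ N.child₁ ∈ 𝒯 ∧ N.child₂ ∈ 𝒯 := by
  induction h with
  | roots =>
    intro N hN h
    rcases h with h | h
    · exact absurd h (hN.child_notMem_roots hT₀ (Or.inl rfl))
    · exact absurd h (hN.child_notMem_roots hT₀ (Or.inr rfl))
  | @bisect 𝒯 K h𝒯 hK ih =>
    have hKmem := (Finset.mem_filter.1 hK).1
    have hKn : IsNode T₀ K := h𝒯.isNode K hKmem
    intro N hN h
    have key : ∀ C, IsChild N C → C ∈ 𝒯 ∪ {K.child₁, K.child₂} →
        (N.child₁ ∈ 𝒯 ∨ N.child₂ ∈ 𝒯) ∨ N = K := by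
      intro C hC hmem
      rcases Finset.mem_union.1 hmem with hmem | hmem
      · left
        rcases hC with rfl | rfl
        · exact Or.inl hmem
        · exact Or.inr hmem
      · right
        rw [Finset.mem_insert, Finset.mem_singleton] at hmem
        exact hN.parent_unique hT₀ hKn hC hmem
    have h2 : (N.child₁ ∈ 𝒯 ∨ N.child₂ ∈ 𝒯) ∨ N = K := by
      rcases h with h | h
      · exact key _ (Or.inl rfl) h
      · exact key _ (Or.inr rfl) h
    rcases h2 with h2 | rfl
    · obtain ⟨a, b, c⟩ := ih N hN h2
      exact ⟨Finset.mem_union_left _ a, Finset.mem_union_left _ b, Finset.mem_union_left _ c⟩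
    · exact ⟨Finset.mem_union_left _ hKmem, by simp, by simp⟩

theorem IsTree.meshUnion_leaves_eq {𝒯 : Finset (TaggedSimplex d)} (h : IsTree T₀ 𝒯) :
    meshUnion (leaves 𝒯) = meshUnion T₀ := by
  refine Set.Subset.antisymm ?_ ?_
  · refine Set.iUnion₂_subset fun K hK => ?_
    obtain ⟨R, hR, hd⟩ := h.isNode K (Finset.mem_filter.1 hK).1
    exact hd.carrier_subset.trans (Set.subset_biUnion_of_mem (u := fun K => carrier K) hR)
  · have hcov : ∀ N ∈ T₀, N.carrier ⊆ meshUnion (leaves 𝒯) := by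
      induction h with
      | roots =>
        intro N hN
        refine Set.subset_biUnion_of_mem (u := fun K => carrier K) ?_
        have hNn : IsNode T₀ N := ⟨N, hN, Relation.ReflTransGen.refl⟩
        exact Finset.mem_filter.2 ⟨hN, hNn.child_notMem_roots hT₀ (Or.inl rfl),
          hNn.child_notMem_roots hT₀ (Or.inr rfl)⟩
      | @bisect 𝒯 K h𝒯 hK ih =>
        obtain ⟨hKmem, hK1, hK2⟩ := Finset.mem_filter.1 hK
        have hKn : IsNode T₀ K := h𝒯.isNode K hKmem
        have hKi := hKn.affineIndependent hT₀
        have hnew := IsTree.bisect h𝒯 hK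
        intro N hN x hx
        obtain ⟨L, hL, hxL⟩ := Set.mem_iUnion₂.1 (ih N hN hx)
        obtain ⟨hLmem, hL1, hL2⟩ := Finset.mem_filter.1 hL
        have hLn := h𝒯.isNode L hLmem
        -- the children of the bisected leaf are leaves, since their children are not in the tree
        have hchild : ∀ C, IsChild K C → C ∈ leaves (𝒯 ∪ {K.child₁, K.child₂}) := by
          intro C hC
          have hCn := hKn.child hC
          have hCmem : C ∉ 𝒯 := by rcases hC with rfl | rfl <;> assumption
          have hno : ∀ D, IsChild C D → D ∉ 𝒯 ∪ ({K.child₁, K.child₂} : Finset _) := by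
            intro D hD hDm
            rcases Finset.mem_union.1 hDm with hDm | hDm
            · refine hCmem (IsTree.parent_sibling hT₀ h𝒯 C hCn ?_).1
              rcases hD with rfl | rfl
              · exact Or.inl hDm
              · exact Or.inr hDm
            · rw [Finset.mem_insert, Finset.mem_singleton] at hDm
              have := hCn.parent_unique hT₀ hKn hD hDm
              subst this
              exact hC.not_carrier_subset hKi subset_rfl
          refine Finset.mem_filter.2 ⟨?_, hno _ (Or.inl rfl), hno _ (Or.inr rfl)⟩
          rcases hC with rfl | rfl <;> simp
        by_cases hLK : L = K
        · subst hLK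
          rw [carrier_eq_union_children hKi] at hxL
          rcases hxL with hx1 | hx2
          · exact Set.mem_biUnion (hchild _ (Or.inl rfl)) hx1
          · exact Set.mem_biUnion (hchild _ (Or.inr rfl)) hx2
        · refine Set.mem_biUnion (x := L) ?_ hxL
          have hno : ∀ D, IsChild L D → D ∉ 𝒯 → D ∉ 𝒯 ∪ ({K.child₁, K.child₂} : Finset _) := by
            intro D hD hD𝒯 hDm
            rcases Finset.mem_union.1 hDm with hDm | hDm
            · exact hD𝒯 hDm
            · rw [Finset.mem_insert, Finset.mem_singleton] at hDm
              exact hLK (hLn.parent_unique hT₀ hKn hD hDm)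
          exact Finset.mem_filter.2 ⟨Finset.mem_union_left _ hLmem, hno _ (Or.inl rfl) hL1,
            hno _ (Or.inr rfl) hL2⟩
    exact Set.iUnion₂_subset hcov

theorem meshUnion_of_mem_conformingRefinements {T : Finset (TaggedSimplex d)}
    (hT : T ∈ conformingRefinements T₀) : meshUnion T = meshUnion T₀ := by
  obtain ⟨_, 𝒯, h𝒯, rfl⟩ := hT
  exact h𝒯.meshUnion_leaves_eq hT₀

omit hT₀ in
theorem isNode_of_mem_conformingRefinements {T : Finset (TaggedSimplex d)}
    (hT : T ∈ conformingRefinements T₀) {K : TaggedSimplex d} (hK : K ∈ T) : IsNode T₀ K := by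
  obtain ⟨_, 𝒯, h𝒯, rfl⟩ := hT
  exact h𝒯.isNode K (Finset.mem_filter.1 hK).1

/-! ### Minimal pairs -/

omit hT₀ in
/-- If a simplex of a conforming mesh contains a point in the relative interior of a face `E` of
another element, then `E` is also a face of that simplex. -/
theorem IsConforming.exists_face_eq {T : Finset (TaggedSimplex d)} (hT : IsConforming T)
    {K K' : TaggedSimplex d} (hK : K ∈ T) (hK' : K' ∈ T) (i : Fin (d + 1)) {x : Pt d}
    (hx : x ∈ K.carrier) (hx' : x ∈ K'.carrier)
    (hpos : ∀ j ≠ i, 0 < lam (hT.nondegenerate K hK) j x) : ∃ i', K'.face i' = K.face i := by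
  have hKn := hT.nondegenerate K hK
  have hKn' := hT.nondegenerate K' hK'
  have hmem : x ∈ convexHull ℝ (K.vertices ∩ K'.vertices) := by
    rw [← hT.inter K hK K' hK']; exact ⟨hx, hx'⟩
  have hv : ∀ j ≠ i, K.vert j ∈ K'.vertices := by
    intro j hj
    by_contra hno
    have hsub : K.vertices ∩ K'.vertices ⊆ K.vert '' {j}ᶜ := by
      rintro _ ⟨⟨k, rfl⟩, hk⟩
      exact ⟨k, by rintro rfl; exact hno hk, rfl⟩
    have := (mem_face_iff hKn j).1 (convexHull_mono hsub hmem)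
    exact absurd this.2 (hpos j hj).ne'
  -- the `d` vertices of the face are vertices of `K'`, so exactly one vertex of `K'` is left
  set S : Set (Fin (d + 1)) := K'.vert ⁻¹' (K.vert '' {i}ᶜ) with hS
  have himg : K'.vert '' S = K.vert '' {i}ᶜ := by
    rw [hS, Set.image_preimage_eq_of_subset]
    rintro _ ⟨j, hj, rfl⟩
    exact hv j hj
  have hcard : S.ncard = d := by
    rw [← Set.ncard_image_of_injective S hKn'.injective, himg,
      Set.ncard_image_of_injective _ hKn.injective, Set.ncard_compl]
    simp
  have hcard' : Sᶜ.ncard = 1 := by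
    have := Set.ncard_add_ncard_compl S
    simp at this
    omega
  obtain ⟨i', hi'⟩ := Set.ncard_eq_one.1 hcard'
  refine ⟨i', ?_⟩
  rw [face, face, ← himg, ← compl_compl S, hi']

/-- The centroid of the face of a simplex opposite to the vertex with number `i`. -/
def _root_.TreeApprox.TaggedSimplex.faceCenter (K : TaggedSimplex d) (i : Fin (d + 1)) : Pt d :=
  ∑ j, (if j = i then (0 : ℝ) else 1 / d) • K.vert j

omit hT₀ in
theorem lam_faceCenter {K : TaggedSimplex d} (hK : AffineIndependent ℝ K.vert)
    (i j : Fin (d + 1)) : lam hK j (K.faceCenter i) = if j = i then (0 : ℝ) else 1 / d := by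
  have hd : (d : ℝ) ≠ 0 := by have := one_le_dim K; positivity
  refine lam_combination hK _ ?_ j
  rw [Finset.sum_ite, Finset.sum_const_zero, Finset.sum_const, Finset.filter_ne' Finset.univ i,
    Finset.card_erase_of_mem (Finset.mem_univ i)]
  simp [hd]

omit hT₀ in
theorem faceCenter_mem_face {K : TaggedSimplex d} (hK : AffineIndependent ℝ K.vert)
    (i : Fin (d + 1)) : K.faceCenter i ∈ K.face i := by
  rw [mem_face_iff hK]
  refine ⟨fun j => ?_, ?_⟩
  · rw [lam_faceCenter]; split_ifs <;> positivity
  · simp [lam_faceCenter]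

omit hT₀ in
/-- The vertices of a face are determined by the face. -/
theorem image_vert_eq_of_face_eq {K K' : TaggedSimplex d} (hK : AffineIndependent ℝ K.vert)
    (hK' : AffineIndependent ℝ K'.vert) {i i' : Fin (d + 1)} (h : K.face i = K'.face i') :
    K.vert '' {i}ᶜ = K'.vert '' {i'}ᶜ := by
  have aux : ∀ {K : TaggedSimplex d} (_ : AffineIndependent ℝ K.vert) (i : Fin (d + 1)),
      (K.face i).extremePoints ℝ = K.vert '' {i}ᶜ := by
    intro K hK i
    refine Set.Subset.antisymm extremePoints_convexHull_subset ?_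
    rintro _ ⟨j, hj, rfl⟩
    rw [mem_extremePoints_iff_left]
    refine ⟨(vert_mem_face_iff hK i j).2 hj, ?_⟩
    rintro x hx y hy ⟨a, b, ha, hb, hab, hxy⟩
    have hx0 := ((mem_face_iff hK i).1 hx).1
    have hy0 := ((mem_face_iff hK i).1 hy).1
    have hzero : ∀ k ≠ j, lam hK k x = 0 := by
      intro k hk
      have h := lam_sum hK (Finset.univ : Finset (Fin 2)) ![a, b] ![x, y] (by simpa using hab) k
      simp only [Fin.sum_univ_two, Matrix.cons_val_zero, Matrix.cons_val_one] at h
      rw [hxy, lam_vert, if_neg hk] at h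
      nlinarith [mul_nonneg ha.le (hx0 k), mul_nonneg hb.le (hy0 k)]
    refine eq_of_lam_eq hK fun k => ?_
    rw [lam_vert]
    split_ifs with hk
    · have := sum_lam hK x
      rw [Finset.sum_eq_single j (fun k _ hk => hzero k hk) (by simp)] at this
      rw [hk, this]
    · exact hzero k hk
  rw [← aux hK, ← aux hK', h]

omit hT₀ in
theorem faceCenter_eq_of_face_eq {K K' : TaggedSimplex d} (hK : AffineIndependent ℝ K.vert)
    (hK' : AffineIndependent ℝ K'.vert) {i i' : Fin (d + 1)} (h : K.face i = K'.face i') :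
    K.faceCenter i = K'.faceCenter i' := by
  have hv := image_vert_eq_of_face_eq hK hK' h
  have aux : ∀ {K : TaggedSimplex d} (_ : AffineIndependent ℝ K.vert) (i : Fin (d + 1)),
      K.faceCenter i = ∑ᶠ p ∈ K.vert '' {i}ᶜ, (1 / d : ℝ) • p := by
    intro K hK i
    rw [finsum_mem_image hK.injective.injOn, finsum_mem_eq_finite_toFinset_sum _ (Set.toFinite _),
      faceCenter]
    symm
    have : (Set.toFinite ({i}ᶜ : Set (Fin (d + 1)))).toFinset = Finset.univ.erase i := by
      ext j; simp
    rw [this, ← Finset.add_sum_erase _ _ (Finset.mem_univ i)]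
    simp only [if_true, zero_smul, zero_add]
    refine Finset.sum_congr rfl fun j hj => ?_
    rw [if_neg (Finset.ne_of_mem_erase hj)]
  rw [aux hK, aux hK', hv]

omit hT₀ in
/-- A face that contains the refinement edge is not a face of any proper descendant. -/
theorem eq_of_desc_of_face_eq {J N : TaggedSimplex d} (hJ : AffineIndependent ℝ J.vert)
    {i i' : Fin (d + 1)} (h0 : i ≠ 0) (hl : i ≠ Fin.last d) (hd : Desc J N)
    (hf : N.face i' = J.face i) : N = J := by
  rcases hd.eq_or_exists_child with h | ⟨C, hC, hCN⟩
  · exact h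
  · exfalso
    have hsub : J.face i ⊆ C.carrier :=
      hf ▸ (face_subset_carrier i').trans hCN.carrier_subset
    rcases hC with rfl | rfl
    · exact vert_last_notMem_child₁ hJ (hsub ((vert_mem_face_iff hJ _ _).2 hl.symm))
    · exact vert_zero_notMem_child₂ hJ (hsub ((vert_mem_face_iff hJ _ _).2 h0.symm))

/-- If the face `E` of a node `J` contains the refinement edge of `J`, then every conforming
refinement with the face `E` has an element that contains `J` and has the face `E`. -/
theorem exists_mem_face_eq_of_isNode {J : TaggedSimplex d} (hJ : IsNode T₀ J) {i : Fin (d + 1)}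
    (h0 : i ≠ 0) (hl : i ≠ Fin.last d) {T : Finset (TaggedSimplex d)}
    (hT : T ∈ conformingRefinements T₀) (hf : IsFaceOf T (J.face i)) :
    ∃ K ∈ T, (∃ i', K.face i' = J.face i) ∧ J.carrier ⊆ K.carrier := by
  have hJi := hJ.affineIndependent hT₀
  obtain ⟨K₁, hK₁, i₁, hf₁⟩ := hf
  have hTc := hT.1
  have hK₁i := hTc.nondegenerate K₁ hK₁
  -- points of the interior of `J` that approach the centroid of the face
  set y : ℝ → Pt d := fun s => J.faceCenter i + s • (J.vert i - J.faceCenter i) with hy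
  have hd1 : (0 : ℝ) < d := by have := one_le_dim J; positivity
  have hyint : ∀ s ∈ Set.Ioo (0 : ℝ) 1, y s ∈ interior J.carrier := by
    intro s hs
    rw [mem_interior_carrier_iff hJi]
    intro j
    rw [hy, lam_lineMap, lam_faceCenter, lam_vert]
    split_ifs with h
    · linarith [hs.1]
    · have : 0 < (1 - s) * (1 / (d : ℝ)) := mul_pos (by linarith [hs.2]) (by positivity)
      linarith
  have hcov : ∀ s ∈ Set.Ioo (0 : ℝ) 1, ∃ K ∈ T, y s ∈ K.carrier := by
    intro s hs
    have h1 : y s ∈ meshUnion T := by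
      rw [meshUnion_of_mem_conformingRefinements hT₀ hT]
      obtain ⟨R, hR, hRJ⟩ := hJ
      exact Set.mem_biUnion hR (hRJ.carrier_subset (interior_subset (hyint s hs)))
    simpa [meshUnion] using h1
  have hfreq : ∃ K ∈ T, ∃ᶠ s in nhdsWithin (0 : ℝ) (Set.Ioi 0), y s ∈ K.carrier := by
    by_contra hno
    push Not at hno
    have hall : ∀ᶠ s in nhdsWithin (0 : ℝ) (Set.Ioi 0), ∀ K ∈ T, y s ∉ K.carrier := by
      rw [Finset.eventually_all]
      intro K hK
      exact hno K hK
    have hIoo : ∀ᶠ s in nhdsWithin (0 : ℝ) (Set.Ioi 0), s ∈ Set.Ioo (0 : ℝ) 1 :=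
      Ioo_mem_nhdsGT one_pos
    obtain ⟨s, hs1, hs2⟩ := (hall.and hIoo).exists
    obtain ⟨K, hK, hyK⟩ := hcov s hs2
    exact hs1 K hK hyK
  obtain ⟨K, hK, hKf⟩ := hfreq
  have hyc : Continuous y := by fun_prop
  have hcenter : J.faceCenter i ∈ K.carrier := by
    have h0 : y 0 = J.faceCenter i := by simp [hy]
    rw [← h0]
    by_contra hno
    have hopen : ∀ᶠ s in nhds (0 : ℝ), y s ∈ K.carrierᶜ :=
      hyc.continuousAt.eventually_mem (isClosed_carrier.isOpen_compl.mem_nhds hno)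
    exact hKf (hopen.filter_mono nhdsWithin_le_nhds)
  have hcc : J.faceCenter i = K₁.faceCenter i₁ := faceCenter_eq_of_face_eq hJi hK₁i hf₁.symm
  have hface : ∃ i', K.face i' = J.face i := by
    rw [← hf₁]
    refine hTc.exists_face_eq hK₁ hK i₁ (x := J.faceCenter i) ?_ hcenter ?_
    · rw [hcc]; exact face_subset_carrier _ (faceCenter_mem_face hK₁i i₁)
    · intro j hj
      rw [hcc, lam_faceCenter, if_neg hj]
      positivity
  refine ⟨K, hK, hface, ?_⟩
  have hIoo : ∀ᶠ s in nhdsWithin (0 : ℝ) (Set.Ioi 0), s ∈ Set.Ioo (0 : ℝ) 1 :=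
    Ioo_mem_nhdsGT one_pos
  obtain ⟨s, hs1, hs2⟩ := (hKf.and_eventually hIoo).exists
  have hKn := isNode_of_mem_conformingRefinements hT hK
  rcases hJ.nested_of_overlap hT₀ hKn ⟨y s, hyint s hs2, hs1⟩ with h | h
  · obtain ⟨i', hi'⟩ := hface
    rw [eq_of_desc_of_face_eq hJi h0 hl h hi']
  · exact h.carrier_subset

omit hT₀ in
theorem mem_facePair {T : Finset (TaggedSimplex d)} {F : Set (Pt d)} {x : Pt d} :
    x ∈ facePair T F ↔ ∃ K ∈ T, (∃ i, K.face i = F) ∧ x ∈ K.carrier := by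
  simp only [facePair, Set.mem_iUnion, Finset.mem_filter, exists_prop, and_assoc]

theorem carrier_subset_minimalPair {J : TaggedSimplex d} (hJ : IsNode T₀ J) {i : Fin (d + 1)}
    (h0 : i ≠ 0) (hl : i ≠ Fin.last d) : J.carrier ⊆ minimalPair T₀ (J.face i) := by
  refine Set.subset_iInter₂ fun T hT => ?_
  obtain ⟨K, hK, hf, hsub⟩ := exists_mem_face_eq_of_isNode hT₀ hJ h0 hl hT.1 hT.2
  exact fun x hx => mem_facePair.2 ⟨K, hK, hf, hsub hx⟩

/-- On the side of an element `K`, the minimal pair of the face `E` of `K` opposite to the vertex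
`i` contains the simplex `J`, which is either `K` or a child of `K`; its face `E` contains the
refinement edge of `J`. -/
theorem exists_minimal_desc (hd : 2 ≤ d) {K : TaggedSimplex d} (hK : IsNode T₀ K)
    (i : Fin (d + 1)) :
    ∃ J : TaggedSimplex d, Desc K J ∧ ∃ j, j ≠ 0 ∧ j ≠ Fin.last d ∧ J.face j = K.face i := by
  have hKi := hK.affineIndependent hT₀
  have h1 : (⟨1, by omega⟩ : Fin (d + 1)) ≠ 0 := by
    intro h; have := congrArg Fin.val h; simp at this
  have h2 : (⟨1, by omega⟩ : Fin (d + 1)) ≠ Fin.last d := by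
    intro h; have := congrArg Fin.val h; simp at this; omega
  by_cases h0 : i = 0
  · exact ⟨K.child₂, Relation.ReflTransGen.single (Or.inr rfl), _, h1, h2,
      h0 ▸ face_one_child₂ hKi (by omega)⟩
  by_cases hl : i = Fin.last d
  · exact ⟨K.child₁, Relation.ReflTransGen.single (Or.inl rfl), _, h1, h2,
      hl ▸ face_one_child₁ hKi (by omega)⟩
  exact ⟨K, Relation.ReflTransGen.refl, i, h0, hl, rfl⟩

omit hT₀ in
theorem minimalPair_subset_facePair {T : Finset (TaggedSimplex d)}
    (hT : T ∈ conformingRefinements T₀) {F : Set (Pt d)} (hF : IsFaceOf T F) :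
    minimalPair T₀ F ⊆ facePair T F :=
  Set.biInter_subset_of_mem (show T ∈ {T ∈ conformingRefinements T₀ | IsFaceOf T F} from ⟨hT, hF⟩)

end Forest

/-! ### Shape regularity of bisection -/

/-- The vertex number `k` of the tagged simplex of type `t` that is described by its first vertex
`x` and the steps `b₀, …, b_{d-1}`: the vertices `z₀, z_{t+1}, …, z_d` form a path with the steps
`b₀, …, b_{d-t-1}`, and `z_k`, `1 ≤ k ≤ t`, is the centre of the parallelotope spanned at `x` by
`b₀, …, b_{d-t+k-1}`. -/
def stepVert (d t : ℕ) (x : Pt d) (b : ℕ → Pt d) (k : ℕ) : Pt d :=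
  if k = 0 then x
  else if t < k then x + ∑ j ∈ Finset.range (k - t), b j
  else x + (1 / 2 : ℝ) • ∑ j ∈ Finset.range (d - t + k), b j

/-- The steps of the second child: the first `n` steps are reversed. -/
def revSteps (n : ℕ) (b : ℕ → Pt d) (j : ℕ) : Pt d := if j < n then -b (n - 1 - j) else b j

theorem sum_revSteps_of_le (n : ℕ) (b : ℕ → Pt d) {m : ℕ} (hm : m ≤ n) :
    ∑ j ∈ Finset.range m, revSteps n b j
      = ∑ j ∈ Finset.range (n - m), b j - ∑ j ∈ Finset.range n, b j := by
  induction m with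
  | zero => simp
  | succ m ih =>
    rw [Finset.sum_range_succ, ih (by omega), revSteps, if_pos (by omega)]
    have : n - m = (n - (m + 1)) + 1 := by omega
    rw [this, Finset.sum_range_succ]
    have : n - 1 - m = n - (m + 1) := by omega
    rw [this]
    abel

theorem sum_revSteps_of_ge (n : ℕ) (b : ℕ → Pt d) {m : ℕ} (hm : n ≤ m) :
    ∑ j ∈ Finset.range m, revSteps n b j
      = ∑ j ∈ Finset.range m, b j - (2 : ℝ) • ∑ j ∈ Finset.range n, b j := by
  induction m, hm using Nat.le_induction with
  | base =>
    rw [sum_revSteps_of_le n b le_rfl]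
    simp only [Nat.sub_self, Finset.range_zero, Finset.sum_empty]
    module
  | succ m hm ih =>
    rw [Finset.sum_range_succ, ih, revSteps, if_neg (by omega), Finset.sum_range_succ]
    abel

theorem stepVert_dim (x : Pt d) (b : ℕ → Pt d) {k : ℕ} (hk : k ≤ d) :
    stepVert d d x b k = stepVert d 0 x ((1 / 2 : ℝ) • b) k := by
  unfold stepVert
  by_cases h0 : k = 0
  · simp [h0]
  · rw [if_neg h0, if_neg h0, if_neg (by omega), if_pos (by omega)]
    simp [Finset.smul_sum]

theorem stepVert_smul (t : ℕ) (x : Pt d) (s : ℝ) (b : ℕ → Pt d) (k : ℕ) :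
    stepVert d t x (s • b) k = x + s • stepVert d t 0 b k := by
  unfold stepVert
  split_ifs
  · simp
  · simp [Finset.smul_sum]
  · simp only [Pi.smul_apply, zero_add]
    rw [← Finset.smul_sum, smul_comm]

theorem child₁_vert_eq {K : TaggedSimplex d} {x : Pt d} {b : ℕ → Pt d}
    (h : ∀ k, K.vert k = stepVert d K.tag x b k) (k : Fin (d + 1)) :
    K.child₁.vert k = stepVert d (K.tag + 1) x b k := by
  have ht := K.tag.2
  have hk := k.2
  simp only [child₁]
  by_cases h0 : k.1 = 0
  · rw [dif_pos h0, h, stepVert, stepVert, if_pos h0]; simp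
  by_cases h1 : k.1 = 1
  · have hd0 : d ≠ 0 := by omega
    rw [dif_neg h0, dif_pos h1, mid_eq, h, h]
    simp only [stepVert, Fin.val_zero, Fin.val_last, if_true, if_neg hd0, if_pos ht, h1,
      one_ne_zero, if_false]
    rw [if_neg (by omega)]
    have : d - (K.tag + 1) + 1 = d - K.tag := by omega
    rw [this]
    module
  · rw [dif_neg h0, dif_neg h1, h, stepVert, stepVert, if_neg (by simp only; omega), if_neg h0]
    simp only
    by_cases h2 : K.tag.1 < k.1 - 1
    · rw [if_pos h2, if_pos (by omega)]
      congr 3; omega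
    · rw [if_neg h2, if_neg (by omega)]
      congr 4; omega

theorem child₂_vert_eq {K : TaggedSimplex d} {x : Pt d} {b : ℕ → Pt d}
    (h : ∀ k, K.vert k = stepVert d K.tag x b k) (k : Fin (d + 1)) :
    K.child₂.vert k = stepVert d (K.tag + 1) (x + ∑ j ∈ Finset.range (d - K.tag), b j)
      (revSteps (d - K.tag) b) k := by
  have ht := K.tag.2
  have hk := k.2
  have hd0 : d ≠ 0 := by omega
  simp only [child₂]
  by_cases h0 : k.1 = 0
  · rw [dif_pos h0, h, stepVert, stepVert, if_pos h0]
    simp [hd0]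
  by_cases h1 : k.1 = 1
  · rw [dif_neg h0, dif_pos h1, mid_eq, h, h]
    simp only [stepVert, Fin.val_zero, Fin.val_last, if_true, if_neg hd0, if_pos ht, h1,
      one_ne_zero, if_false]
    rw [if_neg (by omega)]
    have : d - (K.tag + 1) + 1 = d - K.tag := by omega
    rw [this, sum_revSteps_of_le _ _ le_rfl]
    simp only [Nat.sub_self, Finset.range_zero, Finset.sum_empty]
    module
  by_cases h2 : k.1 ≤ K.tag.1 + 1
  · rw [dif_neg h0, dif_neg h1, dif_pos h2, h, stepVert, stepVert, if_neg (by simp only; omega),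
      if_neg h0]
    simp only
    rw [if_neg (by omega), if_neg (by omega), sum_revSteps_of_ge _ _ (by omega)]
    have : d - (K.tag + 1) + k.1 = d - K.tag + (k.1 - 1) := by omega
    rw [this]
    module
  · rw [dif_neg h0, dif_neg h1, dif_neg h2, h, stepVert, stepVert, if_neg (by simp only; omega),
      if_neg h0]
    simp only
    rw [if_pos (by omega), if_pos (by omega), sum_revSteps_of_le _ _ (by omega)]
    have : d + K.tag + 1 - k.1 - K.tag = d - K.tag - (k.1 - (K.tag + 1)) := by omega
    rw [this]
    abel

/-- The tagged simplex with first vertex `0` and given type and steps. -/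
def shape (t : Fin d) (b : ℕ → Pt d) : TaggedSimplex d := ⟨fun k => stepVert d t 0 b k, t⟩

/-- `K` is a translated and scaled copy of a tagged simplex with steps in `A`. -/
def HasSteps (A : Set (Pt d)) (K : TaggedSimplex d) : Prop :=
  ∃ (x : Pt d) (s : ℝ) (b : ℕ → Pt d), 0 < s ∧ (∀ j < d, b j ∈ A) ∧ (∀ j, d ≤ j → b j = 0) ∧
    ∀ k, K.vert k = stepVert d K.tag x (s • b) k

theorem revSteps_smul (n : ℕ) (s : ℝ) (b : ℕ → Pt d) : revSteps n (s • b) = s • revSteps n b := by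
  funext j
  simp only [revSteps, Pi.smul_apply]
  split_ifs <;> simp

theorem hasSteps_of_vert_eq {A : Set (Pt d)} {C : TaggedSimplex d} {t : Fin d}
    (htag : C.tag.1 = (t.1 + 1) % d) {x : Pt d} {s : ℝ} {b : ℕ → Pt d} (hs : 0 < s)
    (hA : ∀ j < d, b j ∈ A) (h0 : ∀ j, d ≤ j → b j = 0)
    (h : ∀ k : Fin (d + 1), C.vert k = stepVert d (t + 1) x (s • b) k) : HasSteps A C := by
  by_cases ht : t.1 + 1 < d
  · refine ⟨x, s, b, hs, hA, h0, fun k => ?_⟩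
    rw [h, htag, Nat.mod_eq_of_lt ht]
  · have ht' : t.1 + 1 = d := by have := t.2; omega
    refine ⟨x, 1 / 2 * s, b, by positivity, hA, h0, fun k => ?_⟩
    have hk : k.1 ≤ d := by have := k.2; omega
    rw [h, htag, ht', Nat.mod_self, stepVert_dim _ _ hk, smul_smul]

theorem HasSteps.child {A : Set (Pt d)} (hA : ∀ a ∈ A, -a ∈ A) {K C : TaggedSimplex d}
    (h : HasSteps A K) (hC : IsChild K C) : HasSteps A C := by
  obtain ⟨x, s, b, hs, hbA, hb0, hv⟩ := h
  rcases hC with rfl | rfl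
  · exact hasSteps_of_vert_eq (t := K.tag) rfl hs hbA hb0 (child₁_vert_eq hv)
  · have hv2 := child₂_vert_eq hv
    rw [revSteps_smul] at hv2
    refine hasSteps_of_vert_eq (t := K.tag) rfl hs (fun j hj => ?_) (fun j hj => ?_) hv2
    · unfold revSteps
      split_ifs
      · exact hA _ (hbA _ (by omega))
      · exact hbA j hj
    · have : ¬ j < d - K.tag := by omega
      simp only [revSteps, if_neg this]
      exact hb0 j hj

/-- The partial sums of the steps of a tagged simplex. -/
def stepSum (K : TaggedSimplex d) (n : ℕ) : Pt d :=
  if n = 0 then 0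
  else if min n d ≤ d - K.tag then K.vert ⟨min (K.tag + min n d) d, by omega⟩ - K.vert 0
  else (2 : ℝ) • (K.vert ⟨min n d - (d - K.tag), by omega⟩ - K.vert 0)

/-- The steps of a tagged simplex. -/
def steps (K : TaggedSimplex d) (j : ℕ) : Pt d := if j < d then stepSum K (j + 1) - stepSum K j else 0

theorem sum_steps (K : TaggedSimplex d) {n : ℕ} (hn : n ≤ d) :
    ∑ j ∈ Finset.range n, steps K j = stepSum K n := by
  have : ∑ j ∈ Finset.range n, steps K j
      = ∑ j ∈ Finset.range n, (stepSum K (j + 1) - stepSum K j) := by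
    refine Finset.sum_congr rfl fun j hj => ?_
    rw [steps, if_pos (by have := Finset.mem_range.1 hj; omega)]
  rw [this, Finset.sum_range_sub]
  simp [stepSum]

theorem vert_eq_stepVert (K : TaggedSimplex d) (k : Fin (d + 1)) :
    K.vert k = stepVert d K.tag (K.vert 0) (steps K) k := by
  have ht := K.tag.2
  have hk := k.2
  unfold stepVert
  by_cases h0 : k.1 = 0
  · rw [if_pos h0]; congr 1; exact Fin.ext h0
  rw [if_neg h0]
  by_cases h1 : K.tag.1 < k.1
  · rw [if_pos h1, sum_steps K (by omega), stepSum, if_neg (by omega), if_pos (by omega)]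
    have : (⟨min (K.tag + min (k.1 - K.tag) d) d, by omega⟩ : Fin (d + 1)) = k := by
      ext; simp only; omega
    rw [this]; abel
  · rw [if_neg h1, sum_steps K (by omega), stepSum, if_neg (by omega), if_neg (by omega)]
    have : (⟨min (d - K.tag + k.1) d - (d - K.tag), by omega⟩ : Fin (d + 1)) = k := by
      ext; simp only; omega
    rw [this]; module

/-- The steps of the elements of `T₀` and their negatives. -/
def stepSet (T₀ : Finset (TaggedSimplex d)) : Set (Pt d) :=
  {a | ∃ K ∈ T₀, ∃ j : Fin d, a = steps K j ∨ a = -steps K j}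

theorem finite_stepSet (T₀ : Finset (TaggedSimplex d)) : (stepSet T₀).Finite := by
  have : stepSet T₀ = ⋃ K ∈ T₀, ⋃ j : Fin d, {steps K j, -steps K j} := by
    ext a; simp [stepSet]
  rw [this]
  exact T₀.finite_toSet.biUnion fun K _ => Set.finite_iUnion fun j => Set.toFinite _

theorem IsNode.hasSteps {T₀ : Finset (TaggedSimplex d)} {N : TaggedSimplex d} (h : IsNode T₀ N) :
    HasSteps (stepSet T₀) N := by
  obtain ⟨R, hR, hd⟩ := h
  induction hd with
  | refl =>
    refine ⟨R.vert 0, 1, steps R, one_pos, fun j hj => ⟨R, hR, ⟨j, hj⟩, Or.inl rfl⟩,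
      fun j hj => by rw [steps, if_neg (by omega)], fun k => ?_⟩
    rw [one_smul]; exact vert_eq_stepVert R k
  | tail _ hc ih =>
    refine ih.child ?_ hc
    rintro _ ⟨K, hK, j, rfl | rfl⟩
    · exact ⟨K, hK, j, Or.inr rfl⟩
    · exact ⟨K, hK, j, Or.inl (neg_neg _)⟩

/-- The simplex `K` is shape regular with parameter `κ`: it contains the ball of radius `ρ` around
`c` and is contained in the ball of radius `κ ρ` around `c`. -/
structure IsRegular (κ : ℝ) (c : Pt d) (ρ : ℝ) (K : TaggedSimplex d) : Prop where
  pos : 0 < ρ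
  ball_subset : Metric.closedBall c ρ ⊆ K.carrier
  subset_ball : K.carrier ⊆ Metric.closedBall c (κ * ρ)

theorem IsRegular.mono {κ κ' : ℝ} (hκ : κ ≤ κ') {c : Pt d} {ρ : ℝ} {K : TaggedSimplex d}
    (h : IsRegular κ c ρ K) : IsRegular κ' c ρ K :=
  ⟨h.pos, h.ball_subset, h.subset_ball.trans
    (Metric.closedBall_subset_closedBall (mul_le_mul_of_nonneg_right hκ h.pos.le))⟩

theorem exists_isRegular {K : TaggedSimplex d} (hK : AffineIndependent ℝ K.vert) :
    ∃ κ c ρ, IsRegular κ c ρ K := by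
  obtain ⟨c, hc⟩ := interior_carrier_nonempty hK
  obtain ⟨ρ, hρ, hball⟩ := Metric.isOpen_iff.1 isOpen_interior c hc
  obtain ⟨R, hR⟩ := (isCompact_carrier (K := K)).isBounded.subset_closedBall c
  refine ⟨R / (ρ / 2), c, ρ / 2, by positivity, ?_, ?_⟩
  · exact ((Metric.closedBall_subset_ball (by linarith)).trans hball).trans interior_subset
  · rwa [div_mul_cancel₀ _ (by positivity)]

theorem carrier_eq_image {K S : TaggedSimplex d} {x : Pt d} {s : ℝ}
    (h : ∀ k, K.vert k = x + s • S.vert k) :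
    K.carrier = (fun p => x + s • p) '' S.carrier := by
  set f : Pt d →ᵃ[ℝ] Pt d := AffineMap.const ℝ _ x + s • AffineMap.id ℝ _ with hf
  have hfe : ∀ p, f p = x + s • p := fun p => by simp [hf]
  have : (fun p => x + s • p) = f := by funext p; rw [hfe]
  rw [this, carrier, carrier, AffineMap.image_convexHull, vertices, vertices, ← Set.range_comp]
  congr 2
  funext k
  simp [h, hfe]

theorem affineIndependent_of_vert_eq {K S : TaggedSimplex d} {x : Pt d} {s : ℝ}
    (h : ∀ k, K.vert k = x + s • S.vert k) (hK : AffineIndependent ℝ K.vert) :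
    AffineIndependent ℝ S.vert := by
  set f : Pt d →ᵃ[ℝ] Pt d := AffineMap.const ℝ _ x + s • AffineMap.id ℝ _ with hf
  have hfe : ∀ p, f p = x + s • p := fun p => by simp [hf]
  refine AffineIndependent.of_comp f ?_
  have : f ∘ S.vert = K.vert := by funext k; simp [h, hfe]
  rwa [this]

theorem IsRegular.image {κ : ℝ} {c : Pt d} {ρ : ℝ} {K S : TaggedSimplex d} {x : Pt d} {s : ℝ}
    (hs : 0 < s) (h : ∀ k, K.vert k = x + s • S.vert k) (hS : IsRegular κ c ρ S) :
    IsRegular κ (x + s • c) (s * ρ) K := by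
  have hdist : ∀ p, dist (x + s • p) (x + s • c) = s * dist p c := by
    intro p
    rw [dist_add_left, dist_smul₀, Real.norm_of_nonneg hs.le]
  refine ⟨mul_pos hs hS.pos, fun y hy => ?_, ?_⟩
  · rw [carrier_eq_image h]
    refine ⟨s⁻¹ • (y - x), hS.ball_subset ?_, ?_⟩
    · have h1 := hdist (s⁻¹ • (y - x))
      rw [smul_inv_smul₀ hs.ne', add_sub_cancel] at h1
      rw [Metric.mem_closedBall] at hy ⊢
      rw [h1] at hy
      exact le_of_mul_le_mul_left hy hs
    · simp only
      rw [smul_inv_smul₀ hs.ne', add_sub_cancel]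
  · rw [carrier_eq_image h]
    rintro _ ⟨p, hp, rfl⟩
    have := hS.subset_ball hp
    rw [Metric.mem_closedBall] at this ⊢
    rw [hdist]
    nlinarith

/-- The nodes of the forest generated by bisection are uniformly shape regular, because up to
translation and scaling there are only finitely many of them. -/
theorem exists_uniform_regularity {T₀ : Finset (TaggedSimplex d)} (hT₀ : IsConforming T₀) :
    ∃ κ : ℝ, 1 ≤ κ ∧ ∀ N, IsNode T₀ N → ∃ c ρ, IsRegular κ c ρ N := by
  set 𝓑 : Set (ℕ → Pt d) := {b | (∀ j < d, b j ∈ stepSet T₀) ∧ ∀ j, d ≤ j → b j = 0} with h𝓑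
  have hfin : 𝓑.Finite := by
    have h1 : (Set.univ.pi fun _ : Fin d => stepSet T₀).Finite :=
      Set.Finite.pi fun _ => finite_stepSet T₀
    refine (h1.image fun f : Fin d → Pt d => fun j => if h : j < d then f ⟨j, h⟩ else 0).subset ?_
    rintro b ⟨hb1, hb2⟩
    refine ⟨fun j => b j, fun j _ => hb1 j j.2, ?_⟩
    funext j
    by_cases hj : j < d
    · simp [hj]
    · simp [hj, hb2 j (not_lt.1 hj)]
  have hex : ∀ p : Fin d × (ℕ → Pt d), ∃ κ : ℝ, AffineIndependent ℝ (shape p.1 p.2).vert →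
      ∃ c ρ, IsRegular κ c ρ (shape p.1 p.2) := by
    intro p
    by_cases h : AffineIndependent ℝ (shape p.1 p.2).vert
    · obtain ⟨κ, c, ρ, hr⟩ := exists_isRegular h
      exact ⟨κ, fun _ => ⟨c, ρ, hr⟩⟩
    · exact ⟨0, fun h' => absurd h' h⟩
  choose κ hκ using hex
  obtain ⟨M, hM⟩ := ((Set.finite_univ.prod hfin).image κ).bddAbove
  refine ⟨max M 1, le_max_right _ _, fun N hN => ?_⟩
  obtain ⟨x, s, b, hs, hb1, hb2, hv⟩ := hN.hasSteps
  have hv' : ∀ k, N.vert k = x + s • (shape N.tag b).vert k := fun k => by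
    rw [hv, stepVert_smul]; rfl
  obtain ⟨c, ρ, hr⟩ := hκ (N.tag, b)
    (affineIndependent_of_vert_eq hv' (hN.affineIndependent hT₀))
  have hle : κ (N.tag, b) ≤ max M 1 :=
    le_max_of_le_left (hM ⟨(N.tag, b), ⟨Set.mem_univ _, hb1, hb2⟩, rfl⟩)
  exact ⟨_, _, (hr.mono hle).image hs hv'⟩

/-! ### Local quasi-uniformity -/

section Regular
variable {κ : ℝ} {c : Pt d} {ρ : ℝ} {K : TaggedSimplex d} (hr : IsRegular κ c ρ K)
  (hK : AffineIndependent ℝ K.vert)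
include hr

theorem IsRegular.center_mem : c ∈ K.carrier :=
  hr.ball_subset (Metric.mem_closedBall_self hr.pos.le)

theorem IsRegular.dist_le {x : Pt d} (hx : x ∈ K.carrier) : dist x c ≤ κ * ρ := hr.subset_ball hx

omit hr in
theorem lam_le_one_of_mem {x : Pt d} (hx : x ∈ K.carrier) (i : Fin (d + 1)) : lam hK i x ≤ 1 := by
  rw [← sum_lam hK x]
  exact Finset.single_le_sum (fun j _ => (mem_carrier_iff hK).1 hx j) (Finset.mem_univ i)

/-- The barycentric coordinates of a simplex containing a ball of radius `ρ` vary at most at the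
rate `1 / ρ`. -/
theorem IsRegular.abs_lam_sub_le (i : Fin (d + 1)) (x y : Pt d) :
    |lam hK i x - lam hK i y| ≤ dist x y / ρ := by
  have hρ := hr.pos
  by_cases hxy : x = y
  · simp [hxy]
  have hn : 0 < dist x y := dist_pos.2 hxy
  set v : Pt d := (ρ / dist x y) • (x - y) with hv
  have hvn : ‖v‖ = ρ := by
    rw [hv, norm_smul, ← dist_eq_norm, Real.norm_of_nonneg (by positivity),
      div_mul_cancel₀ _ hn.ne']
  have hmem : c + v ∈ K.carrier := hr.ball_subset (by simp [hvn])
  have hL : ∀ p q : Pt d, lam hK i (p + q) = (lam hK i).linear q + lam hK i p := by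
    intro p q
    have := (lam hK i).map_vadd p q
    simpa [add_comm] using this
  have h1 : lam hK i (c + v) - lam hK i c = (ρ / dist x y) * (lam hK i x - lam hK i y) := by
    have h2 : lam hK i x = (lam hK i).linear (x - y) + lam hK i y := by
      rw [← hL, add_sub_cancel]
    rw [hL, h2, hv, map_smul, smul_eq_mul]; ring
  have h2 : |lam hK i (c + v) - lam hK i c| ≤ 1 := by
    have a1 := (mem_carrier_iff hK).1 hmem i
    have a2 := lam_le_one_of_mem hK hmem i
    have a3 := (mem_carrier_iff hK).1 hr.center_mem i
    have a4 := lam_le_one_of_mem hK hr.center_mem i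
    rw [abs_le]; constructor <;> linarith
  rw [h1, abs_mul, abs_of_pos (by positivity : 0 < ρ / dist x y), div_mul_eq_mul_div,
    div_le_one hn] at h2
  rw [le_div_iff₀ hρ]
  linarith

theorem IsRegular.le_dist_vert {i j : Fin (d + 1)} (hij : i ≠ j)
    (hK : AffineIndependent ℝ K.vert) : ρ ≤ dist (K.vert i) (K.vert j) := by
  have h := hr.abs_lam_sub_le hK i (K.vert i) (K.vert j)
  rw [lam_vert, lam_vert, if_pos rfl, if_neg hij, sub_zero, abs_one, le_div_iff₀ hr.pos] at h
  linarith

theorem IsRegular.dist_le_two {x y : Pt d} (hx : x ∈ K.carrier) (hy : y ∈ K.carrier) :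
    dist x y ≤ 2 * κ * ρ := by
  have h1 := hr.dist_le hx
  have h2 := hr.dist_le hy
  have := dist_triangle_right x y c
  linarith

end Regular

/-- Two shape regular simplices with a common face are of comparable size. -/
theorem IsRegular.le_of_face_eq (hd : 2 ≤ d) {κ : ℝ} {c c' : Pt d} {ρ ρ' : ℝ}
    {K K' : TaggedSimplex d} (hK : AffineIndependent ℝ K.vert)
    (hr : IsRegular κ c ρ K) (hr' : IsRegular κ c' ρ' K') {i i' : Fin (d + 1)}
    (hf : K.face i = K'.face i') : ρ ≤ 2 * κ * ρ' := by
  have hcard : 1 < (({i}ᶜ : Finset (Fin (d + 1)))).card := by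
    rw [Finset.card_compl]; simp; omega
  obtain ⟨j, hj, k, hk, hjk⟩ := Finset.one_lt_card.1 hcard
  have hsub : ∀ j ∈ ({i}ᶜ : Finset (Fin (d + 1))), K.vert j ∈ K'.carrier := by
    intro j hj
    refine face_subset_carrier i' (hf ▸ (vert_mem_face_iff hK i j).2 ?_)
    simpa using hj
  exact (hr.le_dist_vert hjk hK).trans (hr'.dist_le_two (hsub j hj) (hsub k hk))

/-- The point `x + μ (p - x)` of a convex set is the centre of a scaled copy of a ball around
`p`. -/
theorem closedBall_subset_of_convex {C : Set (Pt d)} (hC : Convex ℝ C) {x p : Pt d} {r μ : ℝ}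
    (hx : x ∈ C) (hp : Metric.closedBall p r ⊆ C) (h0 : 0 < μ) (h1 : μ ≤ 1) :
    Metric.closedBall (x + μ • (p - x)) (μ * r) ⊆ C := by
  intro y hy
  set q : Pt d := p + μ⁻¹ • (y - (x + μ • (p - x))) with hq
  have hqC : q ∈ C := by
    apply hp
    rw [Metric.mem_closedBall, dist_eq_norm] at hy ⊢
    rw [hq, add_sub_cancel_left, norm_smul, norm_inv, Real.norm_of_nonneg h0.le]
    rw [inv_mul_le_iff₀ h0]
    exact hy
  have : y = (1 - μ) • x + μ • q := by
    rw [hq, smul_add, smul_inv_smul₀ h0.ne']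
    module
  rw [this]
  exact hC hx hqC (by linarith) h0.le (by ring)

open Classical in
/-- The number of shape regular simplices with disjoint interiors that meet at a point is bounded,
since all of them contain balls of the same size close to that point. -/
theorem card_filter_mem_carrier_le {κ : ℝ} (hκ : 1 ≤ κ) {T : Finset (TaggedSimplex d)}
    (hreg : ∀ K ∈ T, ∃ c ρ, IsRegular κ c ρ K)
    (hdis : ∀ K ∈ T, ∀ K' ∈ T, K ≠ K' → Disjoint (interior K.carrier) (interior K'.carrier))
    (z : Pt d) : ((T.filter fun K => z ∈ K.carrier).card : ℝ) ≤ (κ + 1) ^ d := by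
  set F := T.filter fun K => z ∈ K.carrier with hF
  by_cases hne : F.Nonempty
  swap
  · rw [Finset.not_nonempty_iff_eq_empty.1 hne]
    simp only [Finset.card_empty, Nat.cast_zero]
    positivity
  choose! c ρ hr using hreg
  have hFT : ∀ K ∈ F, K ∈ T ∧ z ∈ K.carrier := fun K hK => Finset.mem_filter.1 hK
  obtain ⟨K₀, hK₀, hmin⟩ := F.exists_min_image ρ hne
  set r := ρ K₀ with hrdef
  have hr0 : 0 < r := (hr K₀ (hFT K₀ hK₀).1).pos
  have hd := one_le_dim K₀
  have : Nonempty (Fin d) := ⟨⟨0, hd⟩⟩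
  set p : TaggedSimplex d → Pt d := fun K => z + (r / ρ K) • (c K - z) with hp
  have hsub : ∀ K ∈ F, Metric.ball (p K) r ⊆ interior K.carrier := by
    intro K hK
    obtain ⟨hKT, hz⟩ := hFT K hK
    have hρ := (hr K hKT).pos
    have := closedBall_subset_of_convex convex_carrier hz (hr K hKT).ball_subset
      (div_pos hr0 hρ) ((div_le_one hρ).2 (hmin K hK))
    rw [div_mul_cancel₀ _ hρ.ne'] at this
    exact interior_maximal (Metric.ball_subset_closedBall.trans this) Metric.isOpen_ball
  have hsub2 : ∀ K ∈ F, Metric.ball (p K) r ⊆ Metric.ball z ((κ + 1) * r) := by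
    intro K hK
    obtain ⟨hKT, hz⟩ := hFT K hK
    have hρ := (hr K hKT).pos
    refine Metric.ball_subset_ball' ?_
    have h1 : dist (p K) z = r / ρ K * dist z (c K) := by
      rw [hp, dist_eq_norm, add_sub_cancel_left, norm_smul, Real.norm_of_nonneg (by positivity),
        dist_comm, dist_eq_norm]
    have h2 := (hr K hKT).dist_le hz
    have h3 : r / ρ K * dist z (c K) ≤ r / ρ K * (κ * ρ K) :=
      mul_le_mul_of_nonneg_left h2 (by positivity)
    have h4 : r / ρ K * (κ * ρ K) = κ * r := by field_simp
    rw [h1]; linarith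
  have hpd : (F : Set (TaggedSimplex d)).PairwiseDisjoint fun K => Metric.ball (p K) r :=
    fun K hK K' hK' hne => (hdis K (hFT K hK).1 K' (hFT K' hK').1 hne).mono (hsub K hK) (hsub K' hK')
  have hvol : ∑ K ∈ F, MeasureTheory.volume (Metric.ball (p K) r)
      ≤ MeasureTheory.volume (Metric.ball z ((κ + 1) * r)) := by
    rw [← MeasureTheory.measure_biUnion_finset hpd fun K _ => measurableSet_ball]
    exact MeasureTheory.measure_mono (Set.iUnion₂_subset hsub2)
  have hball : ∀ (x : Pt d) (s : ℝ), 0 ≤ s → MeasureTheory.volume (Metric.ball x s)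
      = ENNReal.ofReal (s ^ d) * MeasureTheory.volume (Metric.ball (0 : Pt d) 1) := by
    intro x s hs
    rw [MeasureTheory.Measure.addHaar_ball _ _ hs]
    simp
  simp only [hball _ r hr0.le, hball _ ((κ + 1) * r) (by positivity), Finset.sum_const,
    nsmul_eq_mul, ← mul_assoc] at hvol
  have h0 : MeasureTheory.volume (Metric.ball (0 : Pt d) 1) ≠ 0 :=
    (Metric.measure_ball_pos _ _ one_pos).ne'
  have hT : MeasureTheory.volume (Metric.ball (0 : Pt d) 1) ≠ ⊤ :=
    MeasureTheory.measure_ball_lt_top.ne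
  rw [ENNReal.mul_le_mul_iff_left h0 hT, ← ENNReal.ofReal_natCast, ← ENNReal.ofReal_mul (by positivity),
    ENNReal.ofReal_le_ofReal_iff (by positivity), mul_pow] at hvol
  exact le_of_mul_le_mul_right hvol (by positivity)

/-- A ball around the centroid of the common face of two simplices on different sides of that face
is covered by the two simplices. -/
theorem closedBall_faceCenter_subset {κ : ℝ} {c c' : Pt d} {ρ ρ' : ℝ} {J J' : TaggedSimplex d}
    (hJ : AffineIndependent ℝ J.vert) (hJ' : AffineIndependent ℝ J'.vert)
    (hr : IsRegular κ c ρ J) (hr' : IsRegular κ c' ρ' J') {i i' : Fin (d + 1)}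
    (hf : J.face i = J'.face i') (hdis : Disjoint (interior J.carrier) (interior J'.carrier))
    {r : ℝ} (h1 : r ≤ ρ / (2 * d)) (h2 : r ≤ ρ' / (2 * d)) :
    Metric.closedBall (J.faceCenter i) r ⊆ J.carrier ∪ J'.carrier := by
  have hd : (0 : ℝ) < d := by have := one_le_dim J; positivity
  have hcc := faceCenter_eq_of_face_eq hJ hJ' hf
  set t := lam hJ' i' (J.vert i) with ht
  have hlam : ∀ x, lam hJ' i' x = lam hJ i x * t := by
    intro x
    conv_lhs => rw [← sum_lam_smul hJ x]
    rw [lam_sum hJ' _ _ _ (sum_lam hJ x), Finset.sum_eq_single i]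
    · intro j _ hj
      have : J.vert j ∈ J'.face i' := hf ▸ (vert_mem_face_iff hJ i j).2 hj
      rw [((mem_face_iff hJ' i').1 this).2, mul_zero]
    · simp
  -- the opposite vertex of `J` is not on the side of `J'`
  have ht0 : t ≤ 0 := by
    by_contra hpos
    push Not at hpos
    set y : ℝ → Pt d := fun s => J.faceCenter i + s • (J.vert i - J.faceCenter i) with hy
    have hyc : Continuous y := by fun_prop
    have hev : ∀ᶠ s in nhds (0 : ℝ), ∀ j ≠ i', 0 < lam hJ' j (y s) := by
      rw [Filter.eventually_all]
      intro j
      by_cases hj : j = i'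
      · exact Filter.Eventually.of_forall fun s h => absurd hj h
      · have hc : Continuous fun s => lam hJ' j (y s) := (continuous_lam hJ' j).comp hyc
        have h0 : 0 < lam hJ' j (y 0) := by
          simp only [hy, zero_smul, add_zero, hcc]
          rw [lam_faceCenter, if_neg hj]; positivity
        filter_upwards [hc.continuousAt.eventually_mem (Ioi_mem_nhds h0)] with s hs _
        exact hs
    have hIoo : ∀ᶠ s in nhdsWithin (0 : ℝ) (Set.Ioi 0), s ∈ Set.Ioo (0 : ℝ) 1 :=
      Ioo_mem_nhdsGT one_pos
    obtain ⟨s, hs1, hs2⟩ := ((hev.filter_mono nhdsWithin_le_nhds).and hIoo).exists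
    have hy1 : y s ∈ interior J.carrier := by
      rw [mem_interior_carrier_iff hJ]
      intro j
      rw [hy, lam_lineMap, lam_faceCenter, lam_vert]
      split_ifs with h
      · linarith [hs2.1]
      · have : 0 < (1 - s) * (1 / (d : ℝ)) := mul_pos (by linarith [hs2.2]) (by positivity)
        linarith
    have hy2 : y s ∈ interior J'.carrier := by
      rw [mem_interior_carrier_iff hJ']
      intro j
      by_cases hj : j = i'
      · rw [hj, hlam, hy, lam_lineMap, lam_faceCenter, lam_vert, if_pos rfl, if_pos rfl]
        have := mul_pos hs2.1 hpos
        linarith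
      · exact hs1 j hj
    exact Set.disjoint_left.1 hdis hy1 hy2
  -- the coordinates belonging to the vertices of the face are positive on the ball
  have hpos : ∀ {κ : ℝ} {c : Pt d} {ρ : ℝ} {J : TaggedSimplex d} (hJ : AffineIndependent ℝ J.vert)
      (_ : IsRegular κ c ρ J) (i : Fin (d + 1)), r ≤ ρ / (2 * d) →
      ∀ x ∈ Metric.closedBall (J.faceCenter i) r, ∀ j ≠ i, 0 ≤ lam hJ j x := by
    intro κ c ρ J hJ hr i hrρ x hx j hj
    have h := hr.abs_lam_sub_le hJ j x (J.faceCenter i)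
    rw [lam_faceCenter, if_neg hj] at h
    have hle : dist x (J.faceCenter i) / ρ ≤ 1 / d := by
      rw [div_le_iff₀ hr.pos]
      have h3 : dist x (J.faceCenter i) ≤ ρ / (2 * d) := (Metric.mem_closedBall.1 hx).trans hrρ
      have h4 : ρ / (2 * d) ≤ 1 / d * ρ := by
        rw [div_le_iff₀ (by positivity)]
        have := hr.pos
        field_simp
        linarith
      linarith
    have := (abs_le.1 (h.trans hle)).1
    linarith
  intro x hx
  rcases le_or_gt 0 (lam hJ i x) with h | h
  · left
    rw [mem_carrier_iff hJ]
    intro j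
    by_cases hj : j = i
    · rw [hj]; exact h
    · exact hpos hJ hr i h1 x hx j hj
  · right
    rw [mem_carrier_iff hJ']
    intro j
    by_cases hj : j = i'
    · rw [hj, hlam]
      exact mul_nonneg_of_nonpos_of_nonpos h.le ht0
    · exact hpos hJ' hr' i' h2 x (hcc ▸ hx) j hj

/-! ### Polynomial functions -/

/-- `f` is a polynomial function of total degree at most `m`. -/
def IsPoly (m : ℕ) (f : Pt d → ℝ) : Prop :=
  ∃ p : MvPolynomial (Fin d) ℝ, p.totalDegree ≤ m ∧ ∀ x, f x = MvPolynomial.eval (fun i => x i) p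

theorem IsPoly.mono {m n : ℕ} (h : m ≤ n) {f : Pt d → ℝ} (hf : IsPoly m f) : IsPoly n f := by
  obtain ⟨p, hp, hf⟩ := hf
  exact ⟨p, hp.trans h, hf⟩

theorem IsPoly.const (m : ℕ) (a : ℝ) : IsPoly m (fun _ : Pt d => a) :=
  ⟨MvPolynomial.C a, by simp, fun x => by simp⟩

theorem IsPoly.coord (i : Fin d) : IsPoly 1 (fun x : Pt d => x i) :=
  ⟨MvPolynomial.X i, by simp, fun x => by simp⟩

theorem IsPoly.add {m : ℕ} {f g : Pt d → ℝ} (hf : IsPoly m f) (hg : IsPoly m g) :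
    IsPoly m (fun x => f x + g x) := by
  obtain ⟨p, hp, hf⟩ := hf
  obtain ⟨q, hq, hg⟩ := hg
  exact ⟨p + q, (MvPolynomial.totalDegree_add p q).trans (max_le hp hq), fun x => by
    simp [hf, hg]⟩

theorem IsPoly.mul {m n : ℕ} {f g : Pt d → ℝ} (hf : IsPoly m f) (hg : IsPoly n g) :
    IsPoly (m + n) (fun x => f x * g x) := by
  obtain ⟨p, hp, hf⟩ := hf
  obtain ⟨q, hq, hg⟩ := hg
  exact ⟨p * q, (MvPolynomial.totalDegree_mul p q).trans (add_le_add hp hq), fun x => by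
    simp [hf, hg]⟩

theorem IsPoly.const_mul {m : ℕ} {f : Pt d → ℝ} (a : ℝ) (hf : IsPoly m f) :
    IsPoly m (fun x => a * f x) := by
  simpa using (IsPoly.const 0 a).mul hf

theorem IsPoly.sub {m : ℕ} {f g : Pt d → ℝ} (hf : IsPoly m f) (hg : IsPoly m g) :
    IsPoly m (fun x => f x - g x) := by
  simpa [sub_eq_add_neg] using hf.add (hg.const_mul (-1))

theorem IsPoly.sum {ι : Type*} {m : ℕ} (s : Finset ι) {f : ι → Pt d → ℝ}
    (hf : ∀ i ∈ s, IsPoly m (f i)) : IsPoly m (fun x => ∑ i ∈ s, f i x) := by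
  classical
  induction s using Finset.induction_on with
  | empty => simpa using IsPoly.const m 0
  | insert i s hi ih =>
    simp only [Finset.sum_insert hi]
    exact (hf i (Finset.mem_insert_self _ _)).add
      (ih fun j hj => hf j (Finset.mem_insert_of_mem hj))

theorem IsPoly.prod {ι : Type*} (s : Finset ι) {m : ι → ℕ} {f : ι → Pt d → ℝ}
    (hf : ∀ i ∈ s, IsPoly (m i) (f i)) : IsPoly (∑ i ∈ s, m i) (fun x => ∏ i ∈ s, f i x) := by
  classical
  induction s using Finset.induction_on with
  | empty => simpa using IsPoly.const 0 1
  | insert i s hi ih =>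
    simp only [Finset.sum_insert hi, Finset.prod_insert hi]
    exact (hf i (Finset.mem_insert_self _ _)).mul
      (ih fun j hj => hf j (Finset.mem_insert_of_mem hj))

theorem IsPoly.pow {m : ℕ} {f : Pt d → ℝ} (hf : IsPoly m f) (n : ℕ) :
    IsPoly (n * m) (fun x => f x ^ n) := by
  simpa using IsPoly.prod (Finset.range n) (m := fun _ => m) (f := fun _ => f) fun _ _ => hf

theorem IsPoly.comp {m : ℕ} {f : Pt d → ℝ} (hf : IsPoly m f) {φ : Pt d → Pt d}
    (hφ : ∀ i, IsPoly 1 fun x => φ x i) : IsPoly m (fun x => f (φ x)) := by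
  obtain ⟨p, hp, hf⟩ := hf
  simp only [hf, MvPolynomial.eval_eq']
  refine IsPoly.sum _ fun n hn => IsPoly.const_mul _ ?_
  have h := IsPoly.prod Finset.univ (m := fun i => n i * 1) (f := fun i x => φ x i ^ n i)
    fun i _ => (hφ i).pow (n i)
  refine h.mono ?_
  have h1 := MvPolynomial.le_totalDegree hn
  rw [Finsupp.sum_fintype _ _ (fun _ => rfl)] at h1
  simpa using h1.trans hp

theorem IsPoly.comp_homothety {m : ℕ} {f : Pt d → ℝ} (hf : IsPoly m f) (c : Pt d) (r : ℝ) :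
    IsPoly m (fun x => f (c + r • x)) := by
  refine hf.comp fun i => ?_
  simpa using (IsPoly.const 1 (c i)).add ((IsPoly.coord i).const_mul r)

theorem IsPoly.affine (f : Pt d →ᵃ[ℝ] ℝ) : IsPoly 1 f := by
  have hx : ∀ x : Pt d, f x = f 0 + ∑ i, f.linear (EuclideanSpace.single i 1) * x i := by
    intro x
    have h1 : f x = f.linear x + f 0 := by
      have := f.map_vadd 0 x
      simpa using this
    have h2 : x = ∑ i, x i • EuclideanSpace.single i (1 : ℝ) := by
      ext j; simp [Finset.sum_apply, Pi.single_apply]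
    rw [h1, add_comm]
    congr 1
    conv_lhs => rw [h2]
    simp [mul_comm]
  have : (f : Pt d → ℝ) = fun x => f 0 + ∑ i, f.linear (EuclideanSpace.single i 1) * x i :=
    funext hx
  rw [this]
  exact (IsPoly.const 1 _).add (IsPoly.sum _ fun i _ => (IsPoly.coord i).const_mul _)

theorem IsPoly.contDiff {m : ℕ} {f : Pt d → ℝ} (hf : IsPoly m f) : ContDiff ℝ ∞ f := by
  obtain ⟨p, hp, hf⟩ := hf
  have : f = fun x => MvPolynomial.eval (fun i => x i) p := funext hf
  rw [this]
  simp only [MvPolynomial.eval_eq']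
  refine ContDiff.sum fun n _ => contDiff_const.mul (contDiff_prod fun i _ => ContDiff.pow ?_ _)
  exact (EuclideanSpace.proj (𝕜 := ℝ) i).contDiff

theorem IsPoly.eq_zero_of_ball {m : ℕ} {f : Pt d → ℝ} (hf : IsPoly m f)
    (h : ∀ x ∈ Metric.closedBall (0 : Pt d) 1, f x = 0) : f = 0 := by
  obtain ⟨p, hp, hf⟩ := hf
  have hp0 : p = 0 := by
    refine MvPolynomial.funext_set (fun _ => Set.Ioo (0 : ℝ) (1 / (d + 1)))
      (fun i => Set.Ioo_infinite (by positivity)) fun x hx => ?_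
    have hx' : ∀ i, |x i| ≤ 1 / (d + 1) := fun i => by
      have := hx i (Set.mem_univ i)
      rw [abs_of_pos this.1]; exact this.2.le
    have hmem : (WithLp.toLp 2 x : Pt d) ∈ Metric.closedBall (0 : Pt d) 1 := by
      rw [mem_closedBall_zero_iff, EuclideanSpace.norm_eq, Real.sqrt_le_iff, one_pow]
      refine ⟨zero_le_one, ?_⟩
      calc ∑ i, ‖x i‖ ^ 2 ≤ ∑ i : Fin d, (1 / ((d : ℝ) + 1)) ^ 2 :=
            Finset.sum_le_sum fun i _ => by
              rw [Real.norm_eq_abs]; exact pow_le_pow_left₀ (abs_nonneg _) (hx' i) 2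
        _ ≤ 1 := by
            rw [Finset.sum_const, Finset.card_univ, Fintype.card_fin, nsmul_eq_mul, div_pow,
              one_pow, mul_one_div, div_le_one (by positivity)]
            nlinarith [(Nat.cast_nonneg d : (0 : ℝ) ≤ d)]
    have := hf (WithLp.toLp 2 x)
    rw [h _ hmem] at this
    simpa using this.symm
  funext x
  simp [hf, hp0]

theorem finite_degree_le (d m : ℕ) :
    {n : Fin d →₀ ℕ | (n.sum fun _ e => e) ≤ m}.Finite ∧
    Nat.card {n : Fin d →₀ ℕ | (n.sum fun _ e => e) ≤ m}
      ≤ (Finset.piAntidiag (Finset.univ : Finset (Fin (d + 1))) m).card := by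
  set S := {n : Fin d →₀ ℕ | (n.sum fun _ e => e) ≤ m} with hS
  set e : (Fin d →₀ ℕ) → (Fin (d + 1) → ℕ) := fun n => Fin.cons (m - ∑ i, n i) n with he
  have hinj : Function.Injective e := by
    intro n n' h
    ext i
    have := congrFun h i.succ
    simpa [he] using this
  have hmem : S.MapsTo e (Finset.piAntidiag (Finset.univ : Finset (Fin (d + 1))) m) := by
    intro n hn
    have hn' : ∑ i, n i ≤ m := by
      have : (n.sum fun _ e => e) ≤ m := hn
      rwa [Finsupp.sum_fintype _ _ (fun _ => rfl)] at this
    rw [Finset.mem_coe, Finset.mem_piAntidiag]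
    refine ⟨?_, fun i _ => Finset.mem_univ i⟩
    rw [he, Fin.sum_cons]
    omega
  have hfin : S.Finite :=
    Set.Finite.of_injOn hmem hinj.injOn (Finset.finite_toSet _)
  refine ⟨hfin, ?_⟩
  have h := Set.ncard_le_ncard_of_injOn e hmem hinj.injOn (Finset.finite_toSet _)
  rw [Set.ncard_coe_finset] at h
  exact h

/-- Evaluation of polynomials as a linear map into the functions on `ℝ^d`. -/
def evalMap (d : ℕ) : MvPolynomial (Fin d) ℝ →ₗ[ℝ] (Pt d → ℝ) where
  toFun p x := MvPolynomial.eval (fun i => x i) p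
  map_add' p q := by funext x; simp
  map_smul' a p := by funext x; simp

/-- The space of polynomial functions of degree at most `m`. -/
def polySpace (d m : ℕ) : Submodule ℝ (Pt d → ℝ) :=
  (MvPolynomial.restrictTotalDegree (Fin d) ℝ m).map (evalMap d)

theorem mem_polySpace {m : ℕ} {f : Pt d → ℝ} : f ∈ polySpace d m ↔ IsPoly m f := by
  simp only [polySpace, Submodule.mem_map, MvPolynomial.mem_restrictTotalDegree, IsPoly]
  refine exists_congr fun p => and_congr_right fun _ => ?_
  rw [funext_iff]
  exact forall_congr' fun x => eq_comm

theorem finite_restrictTotalDegree (d m : ℕ) :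
    Module.Finite ℝ (MvPolynomial.restrictTotalDegree (Fin d) ℝ m) := by
  have : Finite {n : Fin d →₀ ℕ | (n.sum fun _ e => e) ≤ m} := (finite_degree_le d m).1
  exact Module.Finite.of_basis (MvPolynomial.basisRestrictSupport ℝ
    {n : Fin d →₀ ℕ | (n.sum fun _ e => e) ≤ m})

instance (d m : ℕ) : FiniteDimensional ℝ (polySpace d m) := by
  have := finite_restrictTotalDegree d m
  unfold polySpace
  infer_instance

theorem finrank_polySpace_le (d m : ℕ) : Module.finrank ℝ (polySpace d m)
    ≤ (Finset.piAntidiag (Finset.univ : Finset (Fin (d + 1))) m).card := by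
  have := finite_restrictTotalDegree d m
  refine (Submodule.finrank_map_le (evalMap d) _).trans ?_
  refine le_of_eq_of_le ?_ (finite_degree_le d m).2
  exact Module.finrank_eq_nat_card_basis (MvPolynomial.basisRestrictSupport ℝ
    {n : Fin d →₀ ℕ | (n.sum fun _ e => e) ≤ m})

/-! ### Norm equivalences for polynomials on balls -/

theorem exists_sq_norm_le {N : ℕ} {Q : (Fin N → ℝ) → ℝ} (hc : Continuous Q)
    (hh : ∀ (t : ℝ) a, Q (t • a) = t ^ 2 * Q a) (hp : ∀ a ≠ 0, 0 < Q a) :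
    ∃ C, 0 < C ∧ ∀ a, ‖a‖ ^ 2 ≤ C * Q a := by
  by_cases hne : (Metric.sphere (0 : Fin N → ℝ) 1).Nonempty
  · obtain ⟨a₀, ha₀, hmin⟩ := (isCompact_sphere (0 : Fin N → ℝ) 1).exists_isMinOn hne
      hc.continuousOn
    have hn : a₀ ≠ 0 := by
      rintro rfl; simp at ha₀
    have hpos := hp a₀ hn
    refine ⟨(Q a₀)⁻¹, by positivity, fun a => ?_⟩
    by_cases ha : a = 0
    · have h0 : Q 0 = 0 := by simpa using hh 0 0
      simp [ha, h0]
    · have hna : 0 < ‖a‖ := norm_pos_iff.2 ha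
      have h1 : Q a₀ ≤ Q (‖a‖⁻¹ • a) := hmin (by simp [norm_smul, hna.ne'])
      rw [hh] at h1
      rw [inv_mul_eq_div, le_div_iff₀ hpos]
      calc ‖a‖ ^ 2 * Q a₀ ≤ ‖a‖ ^ 2 * (‖a‖⁻¹ ^ 2 * Q a) := by gcongr
        _ = Q a := by field_simp
  · refine ⟨1, one_pos, fun a => ?_⟩
    have ha : a = 0 := by
      by_contra ha
      exact hne ⟨‖a‖⁻¹ • a, by simp [norm_smul, norm_ne_zero_iff.2 ha]⟩
    have h0 : Q 0 = 0 := by simpa using hh 0 0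
    simp [ha, h0]

/-- A fixed smooth bump function of mass one that is supported in the closed unit ball. -/
def bump (d : ℕ) : Pt d → ℝ :=
  ContDiffBump.normed (⟨1 / 2, 1, by norm_num, by norm_num⟩ : ContDiffBump (0 : Pt d))
    MeasureTheory.volume

theorem contDiff_bump (d : ℕ) : ContDiff ℝ ∞ (bump d) := ContDiffBump.contDiff_normed _

theorem tsupport_bump (d : ℕ) : tsupport (bump d) = Metric.closedBall 0 1 :=
  ContDiffBump.tsupport_normed_eq _

theorem integral_bump (d : ℕ) : ∫ x, bump d x = 1 := ContDiffBump.integral_normed _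

theorem bump_eq_zero {x : Pt d} (hx : x ∉ Metric.closedBall (0 : Pt d) 1) : bump d x = 0 := by
  rw [← tsupport_bump] at hx
  exact image_eq_zero_of_notMem_tsupport hx

theorem continuous_gradient {f : Pt d → ℝ} (hf : ContDiff ℝ ∞ f) : Continuous (gradient f) := by
  unfold gradient
  exact (InnerProductSpace.toDual ℝ (Pt d)).symm.continuous.comp (hf.continuous_fderiv (by simp))

theorem gradient_sum_mul {N : ℕ} (a : Fin N → ℝ) {g : Fin N → Pt d → ℝ}
    (hg : ∀ k, ContDiff ℝ ∞ (g k)) (x : Pt d) :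
    gradient (fun x => ∑ k, a k * g k x) x = ∑ k, a k • gradient (g k) x := by
  have hdiff : ∀ k, DifferentiableAt ℝ (g k) x := fun k =>
    (hg k).differentiable (by simp) x
  unfold gradient
  rw [fderiv_fun_sum fun k _ => (hdiff k).const_mul (a k), map_sum]
  refine Finset.sum_congr rfl fun k _ => ?_
  rw [fderiv_const_mul (hdiff k), map_smulₛₗ]
  rfl

section NormEquivalence

theorem integrableOn_closedBall {f : Pt d → ℝ} (hf : Continuous f) (c : Pt d) (r : ℝ) :
    IntegrableOn f (Metric.closedBall c r) :=
  hf.continuousOn.integrableOn_compact (isCompact_closedBall c r)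

theorem eqOn_zero_of_setIntegral_eq_zero {f : Pt d → ℝ} (hf : Continuous f) (h0 : ∀ x, 0 ≤ f x)
    {c : Pt d} {r : ℝ} (hr : 0 < r) (h : ∫ x in Metric.closedBall c r, f x = 0) :
    ∀ x ∈ Metric.closedBall c r, f x = 0 := by
  have h1 := (setIntegral_eq_zero_iff_of_nonneg_ae (Filter.Eventually.of_forall h0)
    (integrableOn_closedBall hf c r)).1 h
  refine Measure.eqOn_of_ae_eq h1 hf.continuousOn continuousOn_const ?_
  rw [interior_closedBall _ hr.ne', closure_ball _ hr.ne']

/-- On the unit ball, the `L²` norm controls the values and gradients of polynomials, also on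
larger balls; values are also controlled by the gradient and one mean value. -/
theorem exists_poly_bound (d m : ℕ) (κ : ℝ) :
    ∃ C, 0 < C ∧ ∀ f : Pt d → ℝ, IsPoly m f → ∀ x ∈ Metric.closedBall (0 : Pt d) κ,
      f x ^ 2 ≤ C * ∫ y in Metric.closedBall (0 : Pt d) 1, f y ^ 2 ∧
      ‖gradient f x‖ ^ 2 ≤ C * ∫ y in Metric.closedBall (0 : Pt d) 1, f y ^ 2 ∧
      f x ^ 2 ≤ C * ((∫ y, bump d y * f y) ^ 2
        + ∫ y in Metric.closedBall (0 : Pt d) 1, ‖gradient f y‖ ^ 2) := by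
  set B := Metric.closedBall (0 : Pt d) 1 with hB
  set V := polySpace d m
  set b := Module.finBasis ℝ V with hb
  set N := Module.finrank ℝ V
  set g : Fin N → Pt d → ℝ := fun k => (b k : Pt d → ℝ) with hg
  have hgp : ∀ k, IsPoly m (g k) := fun k => mem_polySpace.1 (b k).2
  have hgs : ∀ k, ContDiff ℝ ∞ (g k) := fun k => (hgp k).contDiff
  have hgc : ∀ k, Continuous (g k) := fun k => (hgs k).continuous
  have hgg : ∀ k, Continuous (gradient (g k)) := fun k => continuous_gradient (hgs k)
  set P : (Fin N → ℝ) → Pt d → ℝ := fun a x => ∑ k, a k * g k x with hP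
  have hPp : ∀ a, IsPoly m (P a) := fun a => IsPoly.sum _ fun k _ => (hgp k).const_mul _
  have hPg : ∀ a x, gradient (P a) x = ∑ k, a k • gradient (g k) x :=
    fun a x => gradient_sum_mul a hgs x
  have hPcont : Continuous fun q : (Fin N → ℝ) × Pt d => P q.1 q.2 := by
    refine continuous_finsetSum _ fun k _ => ?_
    exact ((continuous_apply k).comp continuous_fst).mul ((hgc k).comp continuous_snd)
  have hPgcont : Continuous fun q : (Fin N → ℝ) × Pt d => gradient (P q.1) q.2 := by
    simp only [hPg]
    refine continuous_finsetSum _ fun k _ => ?_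
    exact ((continuous_apply k).comp continuous_fst).smul ((hgg k).comp continuous_snd)
  have hPsmul : ∀ (t : ℝ) a x, P (t • a) x = t * P a x := by
    intro t a x
    simp [hP, Finset.mul_sum, mul_assoc]
  have hPgsmul : ∀ (t : ℝ) a x, gradient (P (t • a)) x = t • gradient (P a) x := by
    intro t a x
    simp [hPg, Finset.smul_sum, smul_smul]
  have hPV : ∀ a, ((∑ k, a k • b k : V) : Pt d → ℝ) = P a := by
    intro a
    funext x
    simp [hP, hg, Finset.sum_apply]
  have hPzero : ∀ a, P a = 0 → a = 0 := by
    intro a ha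
    have h1 : ∑ k, a k • b k = 0 := Subtype.ext ((hPV a).trans ha)
    funext k
    exact Fintype.linearIndependent_iff.1 b.linearIndependent a h1 k
  have hsurj : ∀ f, IsPoly m f → ∃ a, P a = f := by
    intro f hf
    refine ⟨b.repr ⟨f, mem_polySpace.2 hf⟩, ?_⟩
    rw [← hPV, b.sum_repr]
  have hBc : IsCompact B := isCompact_closedBall _ _
  have hψ := (contDiff_bump d).continuous
  obtain ⟨C₁, hC₁, hQ₁⟩ := exists_sq_norm_le (Q := fun a => ∫ y in B, P a y ^ 2)
    (continuous_parametric_integral_of_continuous (hPcont.pow 2) hBc)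
    (fun t a => by simp only [hPsmul, mul_pow, integral_const_mul])
    (fun a ha => by
      refine lt_of_le_of_ne (integral_nonneg fun y => sq_nonneg _) fun h0 => ha (hPzero a ?_)
      refine (hPp a).eq_zero_of_ball fun x hx => ?_
      have := eqOn_zero_of_setIntegral_eq_zero ((hPp a).contDiff.continuous.pow 2)
        (fun x => sq_nonneg _) one_pos h0.symm x hx
      simpa using this)
  obtain ⟨C₂, hC₂, hQ₂⟩ := exists_sq_norm_le
    (Q := fun a => (∫ y in B, bump d y * P a y) ^ 2 + ∫ y in B, ‖gradient (P a) y‖ ^ 2)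
    (((continuous_parametric_integral_of_continuous
        (f := fun a y => bump d y * P a y) ((hψ.comp continuous_snd).mul hPcont) hBc).pow 2).add
      (continuous_parametric_integral_of_continuous
        (f := fun a y => ‖gradient (P a) y‖ ^ 2)
        (show Continuous fun q : (Fin N → ℝ) × Pt d => ‖gradient (P q.1) q.2‖ ^ 2 from
          hPgcont.norm.pow 2) hBc))
    (fun t a => by
      simp only [hPsmul, hPgsmul, norm_smul, mul_pow, mul_left_comm _ t, integral_const_mul,
        Real.norm_eq_abs, sq_abs]
      ring)
    (fun a ha => by
      refine lt_of_le_of_ne (add_nonneg (sq_nonneg _) (integral_nonneg fun y => sq_nonneg _))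
        fun h0 => ha (hPzero a ?_)
      have hi : 0 ≤ ∫ y in B, ‖gradient (P a) y‖ ^ 2 := integral_nonneg fun y => sq_nonneg _
      have hgz : ∫ y in B, ‖gradient (P a) y‖ ^ 2 = 0 := by
        nlinarith [sq_nonneg (∫ y in B, bump d y * P a y)]
      have hmz : ∫ y in B, bump d y * P a y = 0 := by
        rw [hgz] at h0
        have : (∫ y in B, bump d y * P a y) ^ 2 = 0 := by linarith
        simpa using this
      have hg0 : ∀ x ∈ B, fderiv ℝ (P a) x = 0 := by
        intro x hx
        have := eqOn_zero_of_setIntegral_eq_zero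
          ((continuous_gradient (hPp a).contDiff).norm.pow 2) (fun x => sq_nonneg _) one_pos hgz x hx
        have h2 : gradient (P a) x = 0 := by simpa using this
        simpa [gradient] using h2
      have hconst : ∀ x ∈ B, P a x = P a 0 := by
        intro x hx
        refine Convex.is_const_of_fderivWithin_eq_zero (𝕜 := ℝ) (s := B) (convex_closedBall _ _)
          ((hPp a).contDiff.differentiable (by simp)).differentiableOn (fun y hy => ?_) hx
          (Metric.mem_closedBall_self zero_le_one)
        rw [fderivWithin_eq_fderiv ?_ ((hPp a).contDiff.differentiable (by simp) y), hg0 y hy]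
        refine uniqueDiffOn_convex (convex_closedBall (0 : Pt d) 1) ?_ y hy
        rw [interior_closedBall _ one_ne_zero]
        exact Metric.nonempty_ball.2 one_pos
      have hP0 : P a 0 = 0 := by
        have h1 : ∫ y in B, bump d y * P a y = ∫ y in B, bump d y * P a 0 :=
          setIntegral_congr_fun measurableSet_closedBall fun y hy => by
            simp only [hconst y hy]
        rw [h1, integral_mul_const, setIntegral_eq_integral_of_forall_compl_eq_zero
          (fun x hx => bump_eq_zero hx), integral_bump, one_mul] at hmz
        exact hmz
      exact (hPp a).eq_zero_of_ball fun x hx => by rw [hconst x hx, hP0])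
  -- bound the basis functions and their gradients on the larger ball
  obtain ⟨M, hM⟩ := (isCompact_closedBall (0 : Pt d) κ).bddAbove_image
    (f := fun x => ∑ k, (|g k x| + ‖gradient (g k) x‖))
    (continuous_finsetSum _ fun k _ => (hgc k).abs.add (hgg k).norm).continuousOn
  have hbound : ∀ a, ∀ x ∈ Metric.closedBall (0 : Pt d) κ,
      P a x ^ 2 ≤ M ^ 2 * ‖a‖ ^ 2 ∧ ‖gradient (P a) x‖ ^ 2 ≤ M ^ 2 * ‖a‖ ^ 2 := by
    intro a x hx
    have hMx : ∑ k, (|g k x| + ‖gradient (g k) x‖) ≤ M := hM ⟨x, hx, rfl⟩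
    have h1 : |P a x| ≤ M * ‖a‖ := by
      calc |P a x| ≤ ∑ k, |a k * g k x| := Finset.abs_sum_le_sum_abs _ _
        _ ≤ ∑ k, ‖a‖ * (|g k x| + ‖gradient (g k) x‖) := Finset.sum_le_sum fun k _ => by
            rw [abs_mul]
            have := norm_le_pi_norm a k
            rw [Real.norm_eq_abs] at this
            gcongr
            linarith [norm_nonneg (gradient (g k) x)]
        _ ≤ M * ‖a‖ := by
            rw [← Finset.mul_sum, mul_comm]; gcongr
    have h2 : ‖gradient (P a) x‖ ≤ M * ‖a‖ := by
      rw [hPg]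
      calc ‖∑ k, a k • gradient (g k) x‖ ≤ ∑ k, ‖a k • gradient (g k) x‖ := norm_sum_le _ _
        _ ≤ ∑ k, ‖a‖ * (|g k x| + ‖gradient (g k) x‖) := Finset.sum_le_sum fun k _ => by
            rw [norm_smul]
            have := norm_le_pi_norm a k
            gcongr
            linarith [abs_nonneg (g k x)]
        _ ≤ M * ‖a‖ := by
            rw [← Finset.mul_sum, mul_comm]; gcongr
    rw [← mul_pow]
    exact ⟨sq_le_sq' (by linarith [(abs_le.1 h1).1]) (abs_le.1 h1).2,
      pow_le_pow_left₀ (norm_nonneg _) h2 2⟩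
  have hglob : ∀ a, ∫ y, bump d y * P a y = ∫ y in B, bump d y * P a y := fun a =>
    (setIntegral_eq_integral_of_forall_compl_eq_zero fun x hx => by
      rw [bump_eq_zero hx, zero_mul]).symm
  refine ⟨M ^ 2 * C₁ + M ^ 2 * C₂ + 1, by positivity, fun f hf x hx => ?_⟩
  obtain ⟨a, rfl⟩ := hsurj f hf
  obtain ⟨h1, h2⟩ := hbound a x hx
  have i1 : 0 ≤ ∫ y in B, P a y ^ 2 := integral_nonneg fun y => sq_nonneg _
  have i2 : 0 ≤ (∫ y in B, bump d y * P a y) ^ 2 + ∫ y in B, ‖gradient (P a) y‖ ^ 2 :=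
    add_nonneg (sq_nonneg _) (integral_nonneg fun y => sq_nonneg _)
  have k1 : M ^ 2 * ‖a‖ ^ 2 ≤ (M ^ 2 * C₁ + M ^ 2 * C₂ + 1) * ∫ y in B, P a y ^ 2 := by
    have := mul_le_mul_of_nonneg_left (hQ₁ a) (sq_nonneg M)
    nlinarith [mul_nonneg (mul_nonneg (sq_nonneg M) hC₂.le) i1]
  have k2 : M ^ 2 * ‖a‖ ^ 2 ≤ (M ^ 2 * C₁ + M ^ 2 * C₂ + 1)
      * ((∫ y in B, bump d y * P a y) ^ 2 + ∫ y in B, ‖gradient (P a) y‖ ^ 2) := by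
    have := mul_le_mul_of_nonneg_left (hQ₂ a) (sq_nonneg M)
    nlinarith [mul_nonneg (mul_nonneg (sq_nonneg M) hC₁.le) i2]
  rw [hglob]
  exact ⟨h1.trans k1, h2.trans k1, h1.trans k2⟩

theorem integral_comp_homothety (F : Pt d → ℝ) (c : Pt d) {r : ℝ} (hr : 0 < r) :
    r ^ d * ∫ y, F (c + r • y) = ∫ x, F x := by
  have h1 := Measure.integral_comp_smul volume (fun x => F (c + x)) r
  rw [h1, integral_add_left_eq_self, abs_of_nonneg (by positivity)]
  simp only [finrank_euclideanSpace, Fintype.card_fin, smul_eq_mul]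
  field_simp

theorem setIntegral_comp_homothety (F : Pt d → ℝ) (c : Pt d) {r : ℝ} (hr : 0 < r) :
    r ^ d * ∫ y in Metric.closedBall (0 : Pt d) 1, F (c + r • y)
      = ∫ x in Metric.closedBall c r, F x := by
  rw [← integral_indicator measurableSet_closedBall, ← integral_indicator measurableSet_closedBall,
    ← integral_comp_homothety ((Metric.closedBall c r).indicator F) c hr]
  congr 2
  funext y
  have hiff : y ∈ Metric.closedBall (0 : Pt d) 1 ↔ c + r • y ∈ Metric.closedBall c r := by
    simp only [Metric.mem_closedBall, dist_eq_norm, add_sub_cancel_left, sub_zero,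
      norm_smul, Real.norm_of_nonneg hr.le]
    exact ⟨fun h => by nlinarith, fun h => by nlinarith⟩
  by_cases hy : y ∈ Metric.closedBall (0 : Pt d) 1
  · rw [Set.indicator_of_mem hy, Set.indicator_of_mem (hiff.1 hy)]
  · rw [Set.indicator_of_notMem hy, Set.indicator_of_notMem (fun h => hy (hiff.2 h))]

/-- The mean value with respect to the bump function scaled to the ball of radius `r` around `c`. -/
def bumpMean (c : Pt d) (r : ℝ) (f : Pt d → ℝ) : ℝ :=
  ∫ x, (r ^ d)⁻¹ * bump d (r⁻¹ • (x - c)) * f x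

theorem bumpMean_eq {c : Pt d} {r : ℝ} (hr : 0 < r) (f : Pt d → ℝ) :
    bumpMean c r f = ∫ y, bump d y * f (c + r • y) := by
  rw [bumpMean, ← integral_comp_homothety _ c hr, ← integral_const_mul]
  congr 1
  funext y
  rw [add_sub_cancel_left, inv_smul_smul₀ hr.ne']
  field_simp

theorem gradient_comp_homothety {f : Pt d → ℝ} (hf : ContDiff ℝ ∞ f) (c : Pt d) (r : ℝ) (y : Pt d) :
    gradient (fun y => f (c + r • y)) y = r • gradient f (c + r • y) := by
  have h1 : HasFDerivAt (fun y : Pt d => c + r • y) (r • ContinuousLinearMap.id ℝ (Pt d)) y :=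
    ((hasFDerivAt_id y).const_smul r).const_add c
  have h2 := ((hf.differentiable (by simp)) (c + r • y)).hasFDerivAt.comp y h1
  have h3 : fderiv ℝ (fun y => f (c + r • y)) y = r • fderiv ℝ f (c + r • y) := by
    rw [show (fun y => f (c + r • y)) = f ∘ fun y => c + r • y from rfl, h2.fderiv]
    ext v; simp
  unfold gradient
  rw [h3, map_smulₛₗ]
  rfl

/-- The scaled form of `exists_poly_bound`. -/
theorem exists_poly_bound_scaled (d m : ℕ) (κ : ℝ) :
    ∃ C, 0 < C ∧ ∀ f : Pt d → ℝ, IsPoly m f → ∀ (c : Pt d) (r : ℝ), 0 < r →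
      ∀ x ∈ Metric.closedBall c (κ * r),
      r ^ d * f x ^ 2 ≤ C * ∫ y in Metric.closedBall c r, f y ^ 2 ∧
      r ^ d * (r ^ 2 * ‖gradient f x‖ ^ 2) ≤ C * ∫ y in Metric.closedBall c r, f y ^ 2 ∧
      r ^ d * f x ^ 2 ≤ C * (r ^ d * bumpMean c r f ^ 2
        + r ^ 2 * ∫ y in Metric.closedBall c r, ‖gradient f y‖ ^ 2) := by
  obtain ⟨C, hC, h⟩ := exists_poly_bound d m κ
  refine ⟨C, hC, fun f hf c r hr x hx => ?_⟩
  have hfs := hf.contDiff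
  have hx' : r⁻¹ • (x - c) ∈ Metric.closedBall (0 : Pt d) κ := by
    rw [mem_closedBall_zero_iff, norm_smul, norm_inv, Real.norm_of_nonneg hr.le,
      inv_mul_le_iff₀ hr, mul_comm]
    rwa [Metric.mem_closedBall, dist_eq_norm] at hx
  obtain ⟨h1, h2, h3⟩ := h _ (hf.comp_homothety c r) _ hx'
  simp only [gradient_comp_homothety hfs] at h2 h3
  simp only [smul_inv_smul₀ hr.ne', add_sub_cancel, norm_smul, Real.norm_of_nonneg hr.le, mul_pow,
    integral_const_mul] at h1 h2 h3
  rw [← setIntegral_comp_homothety _ c hr, ← setIntegral_comp_homothety _ c hr, bumpMean_eq hr]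
  have hrd : 0 < r ^ d := by positivity
  refine ⟨?_, ?_, ?_⟩
  · calc _ ≤ r ^ d * (C * _) := mul_le_mul_of_nonneg_left h1 hrd.le
      _ = _ := by ring
  · calc _ ≤ r ^ d * (C * _) := mul_le_mul_of_nonneg_left h2 hrd.le
      _ = _ := by ring
  · calc _ ≤ r ^ d * (C * _) := mul_le_mul_of_nonneg_left h3 hrd.le
      _ = _ := by ring

end NormEquivalence

/-! ### Lagrange interpolation -/

/-- The binomial coefficient `t (t-1) ⋯ (t-n+1) / n!` of a real number `t`. -/
def realChoose (t : ℝ) (n : ℕ) : ℝ := ∏ j ∈ Finset.range n, (t - j) / (j + 1)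

theorem realChoose_self (n : ℕ) : realChoose n n = 1 := by
  unfold realChoose
  have h1 : ∏ j ∈ Finset.range n, ((n : ℝ) - j) = ∏ j ∈ Finset.range n, ((j : ℝ) + 1) := by
    rw [← Finset.prod_range_reflect]
    refine Finset.prod_congr rfl fun j hj => ?_
    have := Finset.mem_range.1 hj
    have h2 : ((n - 1 - j : ℕ) : ℝ) = n - 1 - j := by
      rw [Nat.cast_sub (by omega), Nat.cast_sub (by omega)]; simp
    rw [h2]; ring
  rw [Finset.prod_div_distrib, h1]
  exact div_self (Finset.prod_ne_zero_iff.2 fun j _ => by positivity)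

theorem realChoose_eq_zero {m n : ℕ} (h : m < n) : realChoose m n = 0 :=
  Finset.prod_eq_zero (Finset.mem_range.2 h) (by simp)

theorem abs_realChoose_le {t : ℝ} {ℓ n : ℕ} (hn : n ≤ ℓ) (h0 : 0 ≤ t) (h1 : t ≤ ℓ) :
    |realChoose t n| ≤ (ℓ : ℝ) ^ n := by
  unfold realChoose
  rw [Finset.abs_prod]
  calc ∏ j ∈ Finset.range n, |(t - j) / (j + 1)| ≤ ∏ j ∈ Finset.range n, (ℓ : ℝ) := by
        refine Finset.prod_le_prod (fun _ _ => abs_nonneg _) fun j hj => ?_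
        have hj' : (j : ℝ) ≤ ℓ := by
          have := Finset.mem_range.1 hj; exact_mod_cast (by omega : j ≤ ℓ)
        have hj0 : (0 : ℝ) ≤ j := Nat.cast_nonneg j
        rw [abs_div, abs_of_pos (by positivity : (0 : ℝ) < j + 1), div_le_iff₀ (by positivity)]
        have : |t - j| ≤ ℓ := by rw [abs_le]; constructor <;> linarith
        nlinarith [abs_nonneg (t - j)]
    _ = (ℓ : ℝ) ^ n := by simp

theorem IsPoly.realChoose {f : Pt d → ℝ} (hf : IsPoly 1 f) (n : ℕ) :
    IsPoly n (fun x => realChoose (f x) n) := by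
  have h := IsPoly.prod (Finset.range n) (m := fun _ => 1)
    (f := fun (j : ℕ) x => (f x - j) / (j + 1)) fun j _ => by
      have := (hf.sub (IsPoly.const 1 (j : ℝ))).const_mul ((j : ℝ) + 1)⁻¹
      simpa only [div_eq_inv_mul] using this
  simp only [Finset.sum_const, Finset.card_range, smul_eq_mul, mul_one] at h
  exact h

theorem continuous_realChoose (n : ℕ) : Continuous fun t => realChoose t n := by
  unfold realChoose
  fun_prop

/-- A multiindex that is bounded from below by another one of the same length is equal to it;
hence the products of binomial coefficients are dual to the nodes. -/
theorem prod_realChoose_eq {ι : Type*} (s : Finset ι) {a b : ι → ℕ}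
    (hs : ∑ i ∈ s, a i = ∑ i ∈ s, b i) (hne : ∃ i ∈ s, a i ≠ b i) :
    ∏ i ∈ s, realChoose (b i) (a i) = 0 := by
  by_contra h
  have hle : ∀ i ∈ s, a i ≤ b i := fun i hi => by
    by_contra hlt
    exact h (Finset.prod_eq_zero hi (realChoose_eq_zero (not_le.1 hlt)))
  obtain ⟨i, hi, hne⟩ := hne
  exact hne ((Finset.sum_eq_sum_iff_of_le hle).1 hs i hi)

/-- The multiindices of the Lagrange nodes of degree `ℓ` in a `d`-simplex. -/
def nodeIndex (d ℓ : ℕ) : Finset (Fin (d + 1) → ℕ) := Finset.piAntidiag Finset.univ ℓ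

theorem mem_nodeIndex {ℓ : ℕ} {a : Fin (d + 1) → ℕ} : a ∈ nodeIndex d ℓ ↔ ∑ i, a i = ℓ := by
  simp [nodeIndex, Finset.mem_piAntidiag]

/-- The Lagrange node with the barycentric coordinates `a / ℓ`. -/
def node (ℓ : ℕ) (K : TaggedSimplex d) (a : Fin (d + 1) → ℕ) : Pt d :=
  ∑ i, ((a i : ℝ) / (ℓ : ℝ)) • K.vert i

section Local
variable {K : TaggedSimplex d} (hK : AffineIndependent ℝ K.vert) {ℓ : ℕ} (hℓ : 1 ≤ ℓ)
include hℓ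

theorem sum_div_eq_one {a : Fin (d + 1) → ℕ} (ha : a ∈ nodeIndex d ℓ) :
    ∑ i, (a i : ℝ) / (ℓ : ℝ) = 1 := by
  rw [← Finset.sum_div, ← Nat.cast_sum, mem_nodeIndex.1 ha]
  have : (ℓ : ℝ) ≠ 0 := by positivity
  exact div_self this

theorem lam_node {a : Fin (d + 1) → ℕ} (ha : a ∈ nodeIndex d ℓ) (i : Fin (d + 1)) :
    lam hK i (node ℓ K a) = a i / ℓ :=
  lam_combination hK _ (sum_div_eq_one hℓ ha) i

theorem node_mem_carrier {a : Fin (d + 1) → ℕ} (ha : a ∈ nodeIndex d ℓ) :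
    node ℓ K a ∈ K.carrier :=
  convex_carrier.sum_mem (fun _ _ => by positivity) (sum_div_eq_one hℓ ha)
    fun i _ => vert_mem_carrier i

/-- The Lagrange basis polynomials of a simplex. -/
def lagrangeBasis (ℓ : ℕ) (a : Fin (d + 1) → ℕ) (x : Pt d) : ℝ :=
  ∏ i, realChoose (ℓ * lam hK i x) (a i)

omit hℓ in
theorem isPoly_lagrangeBasis {a : Fin (d + 1) → ℕ} (ha : a ∈ nodeIndex d ℓ) :
    IsPoly ℓ (lagrangeBasis hK ℓ a) := by
  have h := IsPoly.prod Finset.univ (m := a) (f := fun i x => realChoose (ℓ * lam hK i x) (a i))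
    fun i _ => ((IsPoly.affine (lam hK i)).const_mul ℓ).realChoose (a i)
  rwa [mem_nodeIndex.1 ha] at h

theorem lagrangeBasis_node {a b : Fin (d + 1) → ℕ} (ha : a ∈ nodeIndex d ℓ)
    (hb : b ∈ nodeIndex d ℓ) :
    lagrangeBasis hK ℓ a (node ℓ K b) = if a = b then 1 else 0 := by
  have hℓ' : (ℓ : ℝ) ≠ 0 := by positivity
  have h : ∀ i, (ℓ : ℝ) * lam hK i (node ℓ K b) = b i := fun i => by
    rw [lam_node hK hℓ hb]; field_simp
  simp only [lagrangeBasis, h]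
  split_ifs with hab
  · subst hab
    exact Finset.prod_eq_one fun i _ => realChoose_self _
  · refine prod_realChoose_eq _ ?_ ?_
    · rw [mem_nodeIndex.1 ha, mem_nodeIndex.1 hb]
    · by_contra hall
      push Not at hall
      exact hab (funext fun i => hall i (Finset.mem_univ i))

omit hℓ in
theorem abs_lagrangeBasis_le {a : Fin (d + 1) → ℕ} (ha : a ∈ nodeIndex d ℓ) {x : Pt d}
    (hx : x ∈ K.carrier) : |lagrangeBasis hK ℓ a x| ≤ (ℓ : ℝ) ^ ℓ := by
  have hs := mem_nodeIndex.1 ha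
  rw [lagrangeBasis, Finset.abs_prod]
  calc _ ≤ ∏ i, (ℓ : ℝ) ^ a i := by
        refine Finset.prod_le_prod (fun _ _ => abs_nonneg _) fun i _ => abs_realChoose_le ?_ ?_ ?_
        · rw [← hs]; exact Finset.single_le_sum (fun _ _ => Nat.zero_le _) (Finset.mem_univ i)
        · exact mul_nonneg (Nat.cast_nonneg _) ((mem_carrier_iff hK).1 hx i)
        · exact mul_le_of_le_one_right (Nat.cast_nonneg _) (lam_le_one_of_mem hK hx i)
    _ = (ℓ : ℝ) ^ ℓ := by rw [Finset.prod_pow_eq_pow_sum, hs]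

/-- Polynomials of degree at most `ℓ` are determined by their values at the Lagrange nodes. -/
theorem IsPoly.eq_sum_lagrangeBasis {f : Pt d → ℝ} (hf : IsPoly ℓ f) (x : Pt d) :
    f x = ∑ a ∈ nodeIndex d ℓ, f (node ℓ K a) * lagrangeBasis hK ℓ a x := by
  -- evaluation at the nodes is onto, hence one-to-one by a dimension count
  set E : polySpace d ℓ →ₗ[ℝ] (nodeIndex d ℓ → ℝ) :=
    LinearMap.pi fun a => (LinearMap.proj (node ℓ K a.1)).comp (polySpace d ℓ).subtype with hE
  have hEa : ∀ g a, E g a = (g : Pt d → ℝ) (node ℓ K a.1) := fun g a => rfl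
  have hI : ∀ w : (Fin (d + 1) → ℕ) → ℝ,
      IsPoly ℓ fun x => ∑ a ∈ nodeIndex d ℓ, w a * lagrangeBasis hK ℓ a x := fun w =>
    IsPoly.sum _ fun a ha => (isPoly_lagrangeBasis hK ha).const_mul _
  have hIn : ∀ w : (Fin (d + 1) → ℕ) → ℝ, ∀ b ∈ nodeIndex d ℓ,
      ∑ a ∈ nodeIndex d ℓ, w a * lagrangeBasis hK ℓ a (node ℓ K b) = w b := by
    intro w b hb
    rw [Finset.sum_eq_single b]
    · rw [lagrangeBasis_node hK hℓ hb hb, if_pos rfl, mul_one]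
    · intro a ha hab
      rw [lagrangeBasis_node hK hℓ ha hb, if_neg hab, mul_zero]
    · exact fun h => absurd hb h
  have hsurj : Function.Surjective E := by
    classical
    intro w
    refine ⟨⟨_, mem_polySpace.2 (hI fun a => if h : a ∈ nodeIndex d ℓ then w ⟨a, h⟩ else 0)⟩, ?_⟩
    funext b
    rw [hEa]
    simp only
    rw [hIn _ b.1 b.2, dif_pos b.2]
  have hle : Module.finrank ℝ (polySpace d ℓ) ≤ Module.finrank ℝ (nodeIndex d ℓ → ℝ) := by
    rw [Module.finrank_pi, Fintype.card_coe]
    exact finrank_polySpace_le d ℓ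
  have hge : Module.finrank ℝ (nodeIndex d ℓ → ℝ) ≤ Module.finrank ℝ (polySpace d ℓ) :=
    LinearMap.finrank_le_finrank_of_surjective hsurj
  have hinj : Function.Injective E :=
    (LinearMap.injective_iff_surjective_of_finrank_eq_finrank (le_antisymm hle hge)).2 hsurj
  have := @hinj ⟨f, mem_polySpace.2 hf⟩ ⟨_, mem_polySpace.2 (hI fun a => f (node ℓ K a))⟩ (by
    funext b
    rw [hEa, hEa]
    simp only
    rw [hIn _ b.1 b.2])
  exact congrFun (congrArg Subtype.val this) x

end Local

/-! ### Continuous interpolation on conforming meshes -/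

section Global
open scoped Classical

/-- The barycentric coordinate of `x` that belongs to the point `p`; it is zero if `p` is not a
vertex of the simplex. -/
def vertCoord {K : TaggedSimplex d} (hK : AffineIndependent ℝ K.vert) (p : Pt d) :
    Pt d →ᵃ[ℝ] ℝ :=
  ∑ i, if K.vert i = p then lam hK i else 0

theorem vertCoord_apply {K : TaggedSimplex d} (hK : AffineIndependent ℝ K.vert) (p x : Pt d) :
    vertCoord hK p x = ∑ i, if K.vert i = p then lam hK i x else 0 := by
  have : ∀ s : Finset (Fin (d + 1)), (∑ i ∈ s, if K.vert i = p then lam hK i else 0) x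
      = ∑ i ∈ s, if K.vert i = p then lam hK i x else 0 := by
    intro s
    induction s using Finset.induction_on with
    | empty => simp
    | insert i s hi ih =>
      rw [Finset.sum_insert hi, Finset.sum_insert hi, AffineMap.coe_add, Pi.add_apply, ih]
      split_ifs <;> simp
  exact this _

theorem vertCoord_vert {K : TaggedSimplex d} (hK : AffineIndependent ℝ K.vert) (p : Pt d)
    {q : Pt d} (hq : q ∈ K.vertices) : vertCoord hK p q = if q = p then 1 else 0 := by
  obtain ⟨j, rfl⟩ := hq
  rw [vertCoord_apply, Finset.sum_eq_single j]
  · simp [lam_vert]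
  · intro i _ hij
    simp [lam_vert, hij]
  · simp

variable {T : Finset (TaggedSimplex d)} (hT : IsConforming T)
include hT

theorem vertCoord_eq_vertCoord {K K' : TaggedSimplex d} (hK : K ∈ T) (hK' : K' ∈ T) (p : Pt d)
    {x : Pt d} (hx : x ∈ K.carrier) (hx' : x ∈ K'.carrier) :
    vertCoord (hT.nondegenerate K hK) p x = vertCoord (hT.nondegenerate K' hK') p x := by
  have hmem : x ∈ convexHull ℝ (K.vertices ∩ K'.vertices) := by
    rw [← hT.inter K hK K' hK']; exact ⟨hx, hx'⟩
  set f := vertCoord (hT.nondegenerate K hK) p - vertCoord (hT.nondegenerate K' hK') p with hf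
  have hconv : Convex ℝ (f ⁻¹' {0}) := (convex_singleton (0 : ℝ)).affine_preimage f
  have := convexHull_min (s := K.vertices ∩ K'.vertices) (t := f ⁻¹' {0}) ?_ hconv hmem
  · have h2 : f x = 0 := this
    rw [hf, AffineMap.coe_sub, Pi.sub_apply] at h2
    linarith
  · rintro q ⟨hq, hq'⟩
    simp [hf, vertCoord_vert _ p hq, vertCoord_vert _ p hq']

/-- The hat function of the point `p` on a conforming mesh. -/
def hat (p : Pt d) (x : Pt d) : ℝ :=
  if h : ∃ K ∈ T, x ∈ K.carrier then vertCoord (hT.nondegenerate _ h.choose_spec.1) p x else 0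

theorem hat_eq {K : TaggedSimplex d} (hK : K ∈ T) (p : Pt d) {x : Pt d} (hx : x ∈ K.carrier) :
    hat hT p x = vertCoord (hT.nondegenerate K hK) p x := by
  have h : ∃ K ∈ T, x ∈ K.carrier := ⟨K, hK, hx⟩
  rw [hat, dif_pos h]
  exact vertCoord_eq_vertCoord hT h.choose_spec.1 hK p h.choose_spec.2 hx

theorem continuousOn_hat (p : Pt d) : ContinuousOn (hat hT p) (meshUnion T) := by
  have : meshUnion T = ⋃ K : T, K.1.carrier := by
    ext x; simp [meshUnion]
  rw [this]
  refine (locallyFinite_of_finite _).continuousOn_iUnion (fun K => isClosed_carrier) fun K => ?_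
  refine ContinuousOn.congr ?_ fun x hx => hat_eq hT K.2 p hx
  exact (vertCoord _ p).continuous_of_finiteDimensional.continuousOn

omit hT in
/-- The vertices of a mesh. -/
def meshVertices (T : Finset (TaggedSimplex d)) : Finset (Pt d) :=
  T.biUnion fun K => Finset.univ.image K.vert

/-- The continuous piecewise polynomial function of degree `ℓ` with the nodal values `w`. -/
def interpolant (ℓ : ℕ) (w : Pt d → ℝ) (x : Pt d) : ℝ :=
  ∑ α ∈ Finset.piAntidiag (meshVertices T) ℓ,
    w (∑ p ∈ meshVertices T, ((α p : ℝ) / ℓ) • p)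
      * ∏ p ∈ meshVertices T, realChoose (ℓ * hat hT p x) (α p)

theorem continuousOn_interpolant (ℓ : ℕ) (w : Pt d → ℝ) :
    ContinuousOn (interpolant hT ℓ w) (meshUnion T) := by
  unfold interpolant
  refine continuousOn_finsetSum _ fun α _ => continuousOn_const.mul ?_
  refine continuousOn_finsetProd _ fun p _ => ?_
  exact (continuous_realChoose (α p)).comp_continuousOn
    (continuousOn_const.mul (continuousOn_hat hT p))

theorem exists_isPoly_eq_interpolant (ℓ : ℕ) (w : Pt d → ℝ) {K : TaggedSimplex d} (hK : K ∈ T) :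
    ∃ f, IsPoly ℓ f ∧ ∀ x ∈ K.carrier, interpolant hT ℓ w x = f x := by
  refine ⟨fun x => ∑ α ∈ Finset.piAntidiag (meshVertices T) ℓ,
    w (∑ p ∈ meshVertices T, ((α p : ℝ) / ℓ) • p)
      * ∏ p ∈ meshVertices T, realChoose (ℓ * vertCoord (hT.nondegenerate K hK) p x) (α p),
    IsPoly.sum _ fun α hα => IsPoly.const_mul _ ?_, fun x hx => ?_⟩
  · have h := IsPoly.prod (meshVertices T) (m := α)
      (f := fun p x => realChoose (ℓ * vertCoord (hT.nondegenerate K hK) p x) (α p))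
      fun p _ => ((IsPoly.affine (vertCoord (hT.nondegenerate K hK) p)).const_mul ℓ).realChoose _
    rwa [(Finset.mem_piAntidiag.1 hα).1] at h
  · simp only [interpolant, hat_eq hT hK _ hx]

theorem interpolant_mem_feSpace (ℓ : ℕ) (w : Pt d → ℝ) : interpolant hT ℓ w ∈ feSpace ℓ T := by
  refine ⟨continuousOn_interpolant hT ℓ w, fun K hK => ?_⟩
  obtain ⟨f, ⟨p, hp, hf⟩, h⟩ := exists_isPoly_eq_interpolant hT ℓ w hK
  exact ⟨p, hp, fun x hx => by rw [h x hx, hf]⟩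

theorem interpolant_node {ℓ : ℕ} (hℓ : 1 ≤ ℓ) (w : Pt d → ℝ) {K : TaggedSimplex d} (hK : K ∈ T)
    {a : Fin (d + 1) → ℕ} (ha : a ∈ nodeIndex d ℓ) :
    interpolant hT ℓ w (node ℓ K a) = w (node ℓ K a) := by
  have hℓ' : (ℓ : ℝ) ≠ 0 := by positivity
  have hKn := hT.nondegenerate K hK
  have hvm : ∀ i, K.vert i ∈ meshVertices T := fun i =>
    Finset.mem_biUnion.2 ⟨K, hK, Finset.mem_image_of_mem _ (Finset.mem_univ i)⟩
  set β : Pt d → ℕ := fun p => ∑ i, if K.vert i = p then a i else 0 with hβ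
  have hhat : ∀ p, (ℓ : ℝ) * hat hT p (node ℓ K a) = β p := by
    intro p
    rw [hat_eq hT hK p (node_mem_carrier hℓ ha), vertCoord_apply]
    simp only [lam_node hKn hℓ ha, hβ, Nat.cast_sum, Finset.mul_sum]
    refine Finset.sum_congr rfl fun i _ => ?_
    split_ifs
    · field_simp
    · simp
  have hβsum : ∑ p ∈ meshVertices T, β p = ℓ := by
    rw [hβ, Finset.sum_comm, ← mem_nodeIndex.1 ha]
    refine Finset.sum_congr rfl fun i _ => ?_
    rw [Finset.sum_ite_eq, if_pos (hvm i)]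
  have hβmem : β ∈ Finset.piAntidiag (meshVertices T) ℓ := by
    refine Finset.mem_piAntidiag.2 ⟨hβsum, fun p hp => ?_⟩
    obtain ⟨i, _, hi⟩ := Finset.exists_ne_zero_of_sum_ne_zero hp
    by_cases h : K.vert i = p
    · exact h ▸ hvm i
    · simp [h] at hi
  have hnode : ∑ p ∈ meshVertices T, ((β p : ℝ) / ℓ) • p = node ℓ K a := by
    have h1 : ∀ p, ((β p : ℝ) / ℓ) • p
        = ∑ i, if K.vert i = p then ((a i : ℝ) / ℓ) • K.vert i else 0 := by
      intro p
      rw [hβ, Nat.cast_sum, Finset.sum_div, Finset.sum_smul]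
      refine Finset.sum_congr rfl fun i _ => ?_
      split_ifs with h
      · rw [h]
      · simp
    simp only [h1]
    rw [Finset.sum_comm, node]
    refine Finset.sum_congr rfl fun i _ => ?_
    rw [Finset.sum_ite_eq, if_pos (hvm i)]
  unfold interpolant
  simp only [hhat]
  rw [Finset.sum_eq_single β]
  · rw [hnode, Finset.prod_eq_one fun p _ => realChoose_self _, mul_one]
  · intro α hα hne
    rw [prod_realChoose_eq (meshVertices T), mul_zero]
    · rw [(Finset.mem_piAntidiag.1 hα).1, hβsum]
    · by_contra hall
      push Not at hall
      refine hne (funext fun p => ?_)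
      by_cases hp : p ∈ meshVertices T
      · exact hall p hp
      · have h1 : α p = 0 := by
          by_contra h; exact hp ((Finset.mem_piAntidiag.1 hα).2 p h)
        have h2 : β p = 0 := by
          by_contra h; exact hp ((Finset.mem_piAntidiag.1 hβmem).2 p h)
        rw [h1, h2]
  · exact fun h => absurd hβmem h

end Global

/-! ### Finite element functions as Sobolev functions -/

theorem ae_mem_interior_carrier (K : TaggedSimplex d) :
    ∀ᵐ x ∂(volume.restrict K.carrier), x ∈ interior K.carrier := by
  rw [ae_restrict_iff' isClosed_carrier.measurableSet]
  have h : volume (frontier K.carrier) = 0 := convex_carrier.addHaar_frontier volume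
  filter_upwards [compl_mem_ae_iff.2 h] with x hx hxK
  by_contra hno
  exact hx ⟨isClosed_carrier.closure_eq.symm ▸ hxK, hno⟩

theorem isClosed_meshUnion (T : Finset (TaggedSimplex d)) : IsClosed (meshUnion T) :=
  isClosed_biUnion_finset fun _ _ => isClosed_carrier

theorem subset_meshUnion {T : Finset (TaggedSimplex d)} {K : TaggedSimplex d} (hK : K ∈ T) :
    K.carrier ⊆ meshUnion T :=
  Set.subset_biUnion_of_mem (u := fun K => carrier K) hK

/-- A property that holds almost everywhere in each element holds almost everywhere. -/
theorem ae_restrict_meshUnion {T : Finset (TaggedSimplex d)} {p : Pt d → Prop}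
    (h : ∀ K ∈ T, ∀ᵐ x ∂(volume.restrict K.carrier), p x) :
    ∀ᵐ x ∂(volume.restrict (meshUnion T)), p x := by
  rw [meshUnion, ae_restrict_biUnion_finset_iff]
  exact h

theorem restrict_meshDomain (T : Finset (TaggedSimplex d)) :
    (volume : Measure (Pt d)).restrict (meshDomain T) = volume.restrict (meshUnion T) := by
  refine Measure.restrict_congr_set ?_
  refine Filter.EventuallyLE.antisymm (LE.le.eventuallyLE interior_subset) ?_
  have := ae_restrict_meshUnion (T := T) (p := fun x => x ∈ meshDomain T) fun K hK => by
    filter_upwards [ae_mem_interior_carrier K] with x hx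
    exact interior_mono (subset_meshUnion hK) hx
  rw [ae_restrict_iff' (isClosed_meshUnion T).measurableSet] at this
  exact this

theorem exists_isPoly_of_mem_feSpace {ℓ : ℕ} {T : Finset (TaggedSimplex d)} {v : Pt d → ℝ}
    (hv : v ∈ feSpace ℓ T) {K : TaggedSimplex d} (hK : K ∈ T) :
    ∃ f, IsPoly ℓ f ∧ Set.EqOn v f K.carrier := by
  obtain ⟨p, hp, h⟩ := hv.2 K hK
  exact ⟨_, ⟨p, hp, fun _ => rfl⟩, h⟩

theorem eventuallyEq_of_mem_interior {v f : Pt d → ℝ} {S : Set (Pt d)} (h : Set.EqOn v f S)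
    {x : Pt d} (hx : x ∈ interior S) : v =ᶠ[nhds x] f := by
  filter_upwards [mem_interior_iff_mem_nhds.1 hx] with y hy using h hy

theorem gradient_eq_of_mem_interior {v f : Pt d → ℝ} {S : Set (Pt d)} (h : Set.EqOn v f S)
    {x : Pt d} (hx : x ∈ interior S) : gradient v x = gradient f x :=
  (eventuallyEq_of_mem_interior h hx).gradient.eq_of_nhds

theorem memLp_meshUnion {F : Type*} [NormedAddCommGroup F] {T : Finset (TaggedSimplex d)}
    {v : Pt d → F} (h : ∀ K ∈ T, ∃ f : Pt d → F, Continuous f ∧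
      v =ᵐ[volume.restrict K.carrier] f) : MemLp v 2 (volume.restrict (meshUnion T)) := by
  have hK : ∀ K ∈ T, AEStronglyMeasurable v (volume.restrict K.carrier) ∧
      IntegrableOn (fun x => ‖v x‖ ^ 2) K.carrier := by
    intro K hK
    obtain ⟨f, hf, hvf⟩ := h K hK
    refine ⟨(hf.continuousOn.aestronglyMeasurable_of_isCompact isCompact_carrier
      isClosed_carrier.measurableSet).congr hvf.symm, ?_⟩
    have := (hf.norm.pow 2).continuousOn.integrableOn_compact (μ := volume) (isCompact_carrier (K := K))
    refine Integrable.congr this ?_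
    filter_upwards [hvf] with x hx
    simp [hx]
  have hmeas : AEStronglyMeasurable v (volume.restrict (meshUnion T)) := by
    have : meshUnion T = ⋃ K : T, K.1.carrier := by
      ext x; simp [meshUnion]
    rw [this, aestronglyMeasurable_iUnion_iff]
    exact fun K => (hK K.1 K.2).1
  rw [memLp_two_iff_integrable_sq_norm hmeas]
  exact integrableOn_finset_iUnion.2 fun K h => (hK K h).2

theorem memLp_of_mem_feSpace {ℓ : ℕ} {T : Finset (TaggedSimplex d)} {v : Pt d → ℝ}
    (hv : v ∈ feSpace ℓ T) : MemLp v 2 (volume.restrict (meshUnion T)) := by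
  refine memLp_meshUnion fun K hK => ?_
  obtain ⟨f, hf, h⟩ := exists_isPoly_of_mem_feSpace hv hK
  refine ⟨f, hf.contDiff.continuous, ?_⟩
  filter_upwards [ae_mem_interior_carrier K] with x hx using h (interior_subset hx)

theorem memLp_gradient_of_mem_feSpace {ℓ : ℕ} {T : Finset (TaggedSimplex d)} {v : Pt d → ℝ}
    (hv : v ∈ feSpace ℓ T) : MemLp (gradient v) 2 (volume.restrict (meshUnion T)) := by
  refine memLp_meshUnion fun K hK => ?_
  obtain ⟨f, hf, h⟩ := exists_isPoly_of_mem_feSpace hv hK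
  refine ⟨gradient f, continuous_gradient hf.contDiff, ?_⟩
  filter_upwards [ae_mem_interior_carrier K] with x hx using gradient_eq_of_mem_interior h hx

/-- A continuous function on an interval that is Lipschitz continuous on each of finitely many sets
covering the interval is Lipschitz continuous. -/
theorem abs_sub_le_of_finite_cover {ι : Type*} {T : Finset ι} {S : ι → Set ℝ} {h : ℝ → ℝ} {M : ℝ}
    (hc : ContinuousOn h (Set.Icc 0 1)) (hS : ∀ K ∈ T, IsClosed (S K))
    (hcov : ∀ t ∈ Set.Icc (0 : ℝ) 1, ∃ K ∈ T, t ∈ S K)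
    (hlip : ∀ K ∈ T, ∀ t ∈ S K ∩ Set.Icc 0 1, ∀ t' ∈ S K ∩ Set.Icc 0 1,
      |h t - h t'| ≤ M * |t - t'|) {M' : ℝ} (hM : M < M') : |h 1 - h 0| ≤ M' := by
  have key := image_norm_le_of_liminf_right_slope_norm_lt_deriv_boundary
    (f := fun t => h t - h 0) (f' := fun _ => M) (a := 0) (b := 1)
    (hc.sub continuousOn_const) ?_ (B := fun t => M' * t) (B' := fun _ => M') (by simp)
    (by fun_prop)
    (fun x _ => by simpa using ((hasDerivAt_id x).const_mul M').hasDerivWithinAt)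
    (fun x _ _ => hM) (Set.right_mem_Icc.2 zero_le_one)
  · simpa using key
  · intro x hx r hr
    have hfreq : ∃ K ∈ T, ∃ᶠ z in nhdsWithin x (Set.Ioi x), z ∈ S K := by
      by_contra hno
      push Not at hno
      have hall : ∀ᶠ z in nhdsWithin x (Set.Ioi x), ∀ K ∈ T, z ∉ S K := by
        rw [Finset.eventually_all]
        exact hno
      have hIoo : ∀ᶠ z in nhdsWithin x (Set.Ioi x), z ∈ Set.Ioo x 1 := Ioo_mem_nhdsGT hx.2
      obtain ⟨z, hz1, hz2⟩ := (hall.and hIoo).exists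
      obtain ⟨K, hK, hzK⟩ := hcov z ⟨hx.1.trans hz2.1.le, hz2.2.le⟩
      exact hz1 K hK hzK
    obtain ⟨K, hK, hKf⟩ := hfreq
    have hxK : x ∈ S K := by
      by_contra hno
      have : ∀ᶠ z in nhds x, z ∈ (S K)ᶜ := (hS K hK).isOpen_compl.mem_nhds hno
      exact hKf (this.filter_mono nhdsWithin_le_nhds)
    have hIoo : ∀ᶠ z in nhdsWithin x (Set.Ioi x), z ∈ Set.Ioo x 1 := Ioo_mem_nhdsGT hx.2
    refine (hKf.and_eventually hIoo).mono fun z hz => ?_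
    have hzx : 0 < z - x := by linarith [hz.2.1]
    have h1 := hlip K hK z ⟨hz.1, hx.1.trans hz.2.1.le, hz.2.2.le⟩ x ⟨hxK, hx.1, hx.2.le⟩
    rw [abs_of_pos hzx] at h1
    have h2 : |h z - h 0| - |h x - h 0| ≤ |h z - h x| := by
      have := abs_sub_abs_le_abs_sub (h z - h 0) (h x - h 0)
      simpa using this
    rw [slope_def_field]
    simp only [Function.comp, Real.norm_eq_abs]
    rw [div_lt_iff₀ hzx]
    nlinarith

theorem IsPoly.exists_lipschitz {m : ℕ} {f : Pt d → ℝ} (hf : IsPoly m f) (K : TaggedSimplex d) :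
    ∃ M : ℝ, 0 ≤ M ∧ ∀ x ∈ K.carrier, ∀ y ∈ K.carrier, |f x - f y| ≤ M * dist x y := by
  obtain ⟨M, hM⟩ := (isCompact_carrier (K := K)).bddAbove_image
    (f := fun x => ‖fderiv ℝ f x‖)
    (hf.contDiff.continuous_fderiv (by simp)).norm.continuousOn
  refine ⟨max M 0, le_max_right _ _, fun x hx y hy => ?_⟩
  have := convex_carrier.norm_image_sub_le_of_norm_fderiv_le (𝕜 := ℝ) (C := max M 0)
    (fun x _ => hf.contDiff.differentiable (by simp) x)
    (fun x hx => le_max_of_le_left (hM ⟨x, hx, rfl⟩)) hy hx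
  rwa [Real.norm_eq_abs, ← dist_eq_norm] at this

theorem exists_lipschitzOnWith_of_mem_feSpace {ℓ : ℕ} {T : Finset (TaggedSimplex d)} {v : Pt d → ℝ}
    (hv : v ∈ feSpace ℓ T) {U : Set (Pt d)} (hU : Convex ℝ U) (hsub : U ⊆ meshUnion T) :
    ∃ C, LipschitzOnWith C v U := by
  have hex : ∀ K ∈ T, ∃ M : ℝ, 0 ≤ M ∧ ∀ x ∈ K.carrier, ∀ y ∈ K.carrier,
      |v x - v y| ≤ M * dist x y := by
    intro K hK
    obtain ⟨f, hf, h⟩ := exists_isPoly_of_mem_feSpace hv hK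
    obtain ⟨M, hM0, hM⟩ := hf.exists_lipschitz K
    exact ⟨M, hM0, fun x hx y hy => by rw [h hx, h hy]; exact hM x hx y hy⟩
  choose! M hM0 hM using hex
  set L := ∑ K ∈ T, M K
  have hL0 : 0 ≤ L := Finset.sum_nonneg hM0
  have hL : ∀ K ∈ T, M K ≤ L := fun K hK => Finset.single_le_sum hM0 hK
  refine ⟨⟨L + 1, by positivity⟩, LipschitzOnWith.of_dist_le_mul fun x hx y hy => ?_⟩
  by_cases hxy : x = y
  · simp [hxy]
  have hpos : 0 < dist x y := dist_pos.2 hxy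
  set γ : ℝ → Pt d := fun t => y + t • (x - y) with hγ
  have hγc : Continuous γ := by fun_prop
  have hγU : ∀ t ∈ Set.Icc (0 : ℝ) 1, γ t ∈ U := fun t ht => hU.add_smul_sub_mem hy hx ht
  have hγd : ∀ t t', dist (γ t) (γ t') = |t - t'| * dist x y := by
    intro t t'
    rw [hγ, dist_add_left, dist_eq_norm, ← sub_smul, norm_smul, Real.norm_eq_abs, dist_eq_norm]
  have := abs_sub_le_of_finite_cover (T := T) (S := fun K => γ ⁻¹' K.carrier)
    (h := fun t => v (γ t)) (M := L * dist x y) (M' := (L + 1) * dist x y)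
    ((hv.1.mono hsub).comp hγc.continuousOn fun t ht => hγU t ht)
    (fun K _ => isClosed_carrier.preimage hγc)
    (fun t ht => by
      obtain ⟨K, hK, h⟩ := Set.mem_iUnion₂.1 (hsub (hγU t ht))
      exact ⟨K, hK, h⟩)
    (fun K hK t ht t' ht' => by
      refine (hM K hK _ ht.1 _ ht'.1).trans ?_
      rw [hγd]
      have := mul_le_mul_of_nonneg_right (hL K hK)
        (mul_nonneg (abs_nonneg (t - t')) hpos.le)
      linarith)
    (by nlinarith)
  rw [Real.dist_eq]
  simp only [hγ, one_smul, zero_smul, add_zero, add_sub_cancel] at this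
  exact this

theorem IsH1.mono {Ω U : Set (Pt d)} {u : Pt d → ℝ} {G : Pt d → Pt d} (h : IsH1 Ω u G)
    (hU : U ⊆ Ω) (hΩ : MeasurableSet Ω) : IsH1 U u G := by
  have hm := Measure.restrict_mono hU (le_refl (volume : Measure (Pt d)))
  refine ⟨h.memLp.mono_measure hm, h.memLp_grad.mono_measure hm, fun φ hφ hc hs y => ?_⟩
  have key := h.weak φ hφ hc (hs.trans hU) y
  have e1 : ∫ x in Ω, u x * fderiv ℝ φ x y = ∫ x in U, u x * fderiv ℝ φ x y := by
    refine setIntegral_eq_of_subset_of_forall_sdiff_eq_zero hΩ hU fun x hx => ?_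
    have : fderiv ℝ φ x = 0 := by
      by_contra hne
      exact hx.2 (hs (support_fderiv_subset ℝ hne))
    simp [this]
  have e2 : ∫ x in Ω, inner ℝ (G x) y * φ x = ∫ x in U, inner ℝ (G x) y * φ x := by
    refine setIntegral_eq_of_subset_of_forall_sdiff_eq_zero hΩ hU fun x hx => ?_
    have : φ x = 0 := by
      by_contra hne
      exact hx.2 (hs (subset_tsupport φ hne))
    simp [this]
  rw [← e1, ← e2, key]

theorem MemLp.integrable_mul_continuous {U : Set (Pt d)} {f φ : Pt d → ℝ}
    (hf : MemLp f 2 (volume.restrict U)) (hφ : Continuous φ) (hc : HasCompactSupport φ) :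
    Integrable (fun x => f x * φ x) (volume.restrict U) :=
  MemLp.integrable_mul (p := 2) (q := 2) hf ((hφ.memLp_of_hasCompactSupport hc).restrict U)

theorem continuous_fderiv_apply {φ : Pt d → ℝ} (hφ : ContDiff ℝ ∞ φ) (y : Pt d) :
    Continuous fun x => fderiv ℝ φ x y :=
  (hφ.continuous_fderiv (by simp)).clm_apply continuous_const

theorem hasCompactSupport_fderiv_apply {φ : Pt d → ℝ} (hc : HasCompactSupport φ) (y : Pt d) :
    HasCompactSupport fun x => fderiv ℝ φ x y := by
  refine (hc.fderiv (𝕜 := ℝ)).mono fun x hx => ?_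
  intro h0
  exact hx (by simp [h0])

theorem memLp_inner {U : Set (Pt d)} {G : Pt d → Pt d} (hG : MemLp G 2 (volume.restrict U))
    (y : Pt d) : MemLp (fun x => inner ℝ (G x) y) 2 (volume.restrict U) :=
  hG.inner_const y

theorem IsH1.sub {U : Set (Pt d)} {u v : Pt d → ℝ} {G H : Pt d → Pt d} (hu : IsH1 U u G)
    (hv : IsH1 U v H) : IsH1 U (fun x => u x - v x) (fun x => G x - H x) := by
  refine ⟨hu.memLp.sub hv.memLp, hu.memLp_grad.sub hv.memLp_grad, fun φ hφ hc hs y => ?_⟩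
  have hc' := hasCompactSupport_fderiv_apply hc y
  have hφ' := continuous_fderiv_apply hφ y
  have h1 := hu.weak φ hφ hc hs y
  have h2 := hv.weak φ hφ hc hs y
  simp only [sub_mul, inner_sub_left]
  rw [integral_sub (MemLp.integrable_mul_continuous hu.memLp hφ' hc')
    (MemLp.integrable_mul_continuous hv.memLp hφ' hc'),
    integral_sub (MemLp.integrable_mul_continuous (memLp_inner hu.memLp_grad y) hφ.continuous hc)
    (MemLp.integrable_mul_continuous (memLp_inner hv.memLp_grad y) hφ.continuous hc), h1, h2]
  ring

/-- On convex open sets, the piecewise gradient of a continuous piecewise polynomial function is its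
weak gradient. -/
theorem isH1_of_mem_feSpace {ℓ : ℕ} {T : Finset (TaggedSimplex d)} {v : Pt d → ℝ}
    (hv : v ∈ feSpace ℓ T) {U : Set (Pt d)} (hU : Convex ℝ U) (hUo : IsOpen U)
    (hsub : U ⊆ meshUnion T) : IsH1 U v (gradient v) := by
  have hm := Measure.restrict_mono hsub (le_refl (volume : Measure (Pt d)))
  refine ⟨(memLp_of_mem_feSpace hv).mono_measure hm,
    (memLp_gradient_of_mem_feSpace hv).mono_measure hm, fun φ hφ hc hs y => ?_⟩
  obtain ⟨C, hC⟩ := exists_lipschitzOnWith_of_mem_feSpace hv hU hsub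
  obtain ⟨w, hw, hvw⟩ := hC.extend_real
  obtain ⟨D, hD⟩ := hφ.lipschitzWith_of_hasCompactSupport hc (by simp)
  have key := hw.integral_lineDeriv_mul_eq (μ := volume) hD hc y
  have hφd : ∀ x z, lineDeriv ℝ φ x z = fderiv ℝ φ x z := fun x z =>
    (hφ.differentiable (by simp) x).lineDeriv_eq_fderiv
  have e1 : ∫ x, lineDeriv ℝ φ x (-y) * w x = - ∫ x in U, v x * fderiv ℝ φ x y := by
    rw [← integral_neg, ← setIntegral_eq_integral_of_forall_compl_eq_zero (s := U)]
    · refine setIntegral_congr_fun hUo.measurableSet fun x hx => ?_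
      simp only [hφd, map_neg, hvw hx]; ring
    · intro x hx
      have : fderiv ℝ φ x = 0 := by
        by_contra hne
        exact hx (hs (support_fderiv_subset ℝ hne))
      simp [hφd, this]
  have e2 : ∫ x, lineDeriv ℝ w x y * φ x = ∫ x in U, inner ℝ (gradient v x) y * φ x := by
    rw [← setIntegral_eq_integral_of_forall_compl_eq_zero (s := U)]
    · have hae : ∀ᵐ x ∂(volume.restrict (meshUnion T)), x ∈ U →
          lineDeriv ℝ w x y = inner ℝ (gradient v x) y := by
        refine ae_restrict_meshUnion fun K hK => ?_
        obtain ⟨f, hf, h⟩ := exists_isPoly_of_mem_feSpace hv hK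
        filter_upwards [ae_mem_interior_carrier K] with x hx hxU
        have hvf := eventuallyEq_of_mem_interior h hx
        have hwv : w =ᶠ[nhds x] v := by
          filter_upwards [hUo.mem_nhds hxU] with z hz using (hvw hz).symm
        have hdiff : DifferentiableAt ℝ v x :=
          (hf.contDiff.differentiable (by simp) x).congr_of_eventuallyEq hvf
        rw [hwv.lineDeriv_eq, hdiff.lineDeriv_eq_fderiv, gradient,
          InnerProductSpace.toDual_symm_apply]
      refine setIntegral_congr_ae hUo.measurableSet ?_
      rw [ae_restrict_iff' (isClosed_meshUnion T).measurableSet] at hae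
      filter_upwards [hae] with x hx hxU
      rw [hx (hsub hxU) hxU]
    · intro x hx
      have : φ x = 0 := by
        by_contra hne
        exact hx (hs (subset_tsupport φ hne))
      simp [this]
  rw [e1, e2] at key
  linarith

/-! ### Moving the bump mean of a Sobolev function -/

theorem sq_integral_le_of_abs_le {α : Type*} [MeasurableSpace α] {μ : Measure α} {F a b : α → ℝ}
    (hF : ∀ x, |F x| ≤ a x * b x) (ha : MemLp a 2 μ) (hb : MemLp b 2 μ) :
    (∫ x, F x ∂μ) ^ 2 ≤ (∫ x, a x ^ 2 ∂μ) * ∫ x, b x ^ 2 ∂μ := by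
  have hab : Integrable (fun x => a x * b x) μ := MemLp.integrable_mul (p := 2) (q := 2) ha hb
  have h1 : |∫ x, F x ∂μ| ≤ ∫ x, a x * b x ∂μ :=
    by
    rw [← Real.norm_eq_abs]
    exact norm_integral_le_of_norm_le hab (Filter.Eventually.of_forall hF)
  have h2 : (∫ x, F x ∂μ) ^ 2 ≤ (∫ x, a x * b x ∂μ) ^ 2 := by
    rw [← sq_abs]
    exact pow_le_pow_left₀ (abs_nonneg _) h1 2
  refine h2.trans ?_
  have key : ∀ t : ℝ, 0 ≤ (∫ x, a x ^ 2 ∂μ) * (t * t) + (2 * ∫ x, a x * b x ∂μ) * t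
      + ∫ x, b x ^ 2 ∂μ := by
    intro t
    have h0 : 0 ≤ ∫ x, (t * t) * a x ^ 2 + ((2 * t) * (a x * b x) + b x ^ 2) ∂μ :=
      integral_nonneg fun x => by
        have := sq_nonneg (t * a x + b x)
        simp only [Pi.zero_apply]
        nlinarith
    have i2 := hab.const_mul (2 * t)
    have i3 : Integrable (fun x => (2 * t) * (a x * b x) + b x ^ 2) μ := i2.add hb.integrable_sq
    rw [integral_add (ha.integrable_sq.const_mul _) i3,
      integral_add (hab.const_mul _) hb.integrable_sq, integral_const_mul, integral_const_mul] at h0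
    linarith
  have := discrim_le_zero key
  rw [discrim] at this
  nlinarith

/-- Integration by parts against a smooth compactly supported vector field. -/
theorem IsH1.integral_mul_divergence {U : Set (Pt d)} {f : Pt d → ℝ} {g : Pt d → Pt d}
    (h : IsH1 U f g) {Φ : Pt d → Pt d} (hΦ : ContDiff ℝ ∞ Φ) (hc : HasCompactSupport Φ)
    (hs : tsupport Φ ⊆ U) :
    ∫ x in U, f x * ∑ i, fderiv ℝ Φ x (EuclideanSpace.single i 1) i
      = - ∫ x in U, inner ℝ (g x) (Φ x) := by
  have hΦi : ∀ i, ContDiff ℝ ∞ fun x => Φ x i := fun i => contDiff_euclidean.1 hΦ i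
  have hsupp : ∀ i, Function.support (fun x => Φ x i) ⊆ Function.support Φ := by
    intro i x hx h0
    exact hx (by simp [h0])
  have hci : ∀ i, HasCompactSupport fun x => Φ x i := fun i => hc.mono (hsupp i)
  have hsi : ∀ i, tsupport (fun x => Φ x i) ⊆ U := fun i => (closure_mono (hsupp i)).trans hs
  have hder : ∀ i x y, fderiv ℝ (fun x => Φ x i) x y = fderiv ℝ Φ x y i := by
    intro i x y
    have h1 := (hΦ.differentiable (by simp) x).hasFDerivAt
    have h2 := (EuclideanSpace.proj i : Pt d →L[ℝ] ℝ).hasFDerivAt.comp x h1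
    rw [show (fun x => Φ x i) = (EuclideanSpace.proj i : Pt d →L[ℝ] ℝ) ∘ Φ from
      rfl, h2.fderiv]
    rfl
  have hinner : ∀ i x, inner ℝ (g x) (EuclideanSpace.single i (1 : ℝ)) = g x i := by
    intro i x
    rw [real_inner_comm]
    simp [EuclideanSpace.inner_single_left]
  have hweak := fun i => h.weak _ (hΦi i) (hci i) (hsi i) (EuclideanSpace.single i 1)
  simp only [hder, hinner] at hweak
  have hg : ∀ x, inner ℝ (g x) (Φ x) = ∑ i, g x i * Φ x i := by
    intro x
    simp [PiLp.inner_apply, mul_comm]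
  simp only [hg, Finset.mul_sum]
  rw [integral_finsetSum, integral_finsetSum, ← Finset.sum_neg_distrib]
  · exact Finset.sum_congr rfl fun i _ => hweak i
  · intro i _
    have := memLp_inner h.memLp_grad (EuclideanSpace.single i 1)
    simp only [hinner] at this
    exact MemLp.integrable_mul_continuous this (hΦi i).continuous (hci i)
  · intro i _
    have := MemLp.integrable_mul_continuous h.memLp
      (continuous_fderiv_apply (hΦi i) (EuclideanSpace.single i 1))
      (hasCompactSupport_fderiv_apply (hci i) _)
    simpa only [hder] using this

/-- The bump function of mass one scaled to the ball of radius `r` around `c`. -/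
def scaledBump (c : Pt d) (r : ℝ) (x : Pt d) : ℝ := (r ^ d)⁻¹ * bump d (r⁻¹ • (x - c))

theorem contDiff_scaledBump (c : Pt d) (r : ℝ) : ContDiff ℝ ∞ (scaledBump c r) :=
  contDiff_const.mul ((contDiff_bump d).comp (by fun_prop))

theorem scaledBump_eq_zero {c : Pt d} {r : ℝ} (hr : 0 < r) {x : Pt d}
    (hx : x ∉ Metric.closedBall c r) : scaledBump c r x = 0 := by
  rw [scaledBump, bump_eq_zero, mul_zero]
  rw [mem_closedBall_zero_iff, norm_smul, norm_inv, Real.norm_of_nonneg hr.le, inv_mul_le_iff₀ hr,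
    mul_one, ← dist_eq_norm]
  exact hx

theorem tsupport_scaledBump_subset {c : Pt d} {r : ℝ} (hr : 0 < r) :
    tsupport (scaledBump c r) ⊆ Metric.closedBall c r := by
  refine closure_minimal (fun x hx => ?_) Metric.isClosed_closedBall
  by_contra hno
  exact hx (scaledBump_eq_zero hr hno)

theorem hasCompactSupport_scaledBump {c : Pt d} {r : ℝ} (hr : 0 < r) :
    HasCompactSupport (scaledBump c r) :=
  HasCompactSupport.of_support_subset_isCompact (isCompact_closedBall c r)
    ((subset_tsupport _).trans (tsupport_scaledBump_subset hr))

theorem bumpMean_eq_setIntegral {c : Pt d} {r : ℝ} (hr : 0 < r) {U : Set (Pt d)}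
    (hU : Metric.closedBall c r ⊆ U) (f : Pt d → ℝ) :
    bumpMean c r f = ∫ x in U, f x * scaledBump c r x := by
  rw [setIntegral_eq_integral_of_forall_compl_eq_zero, bumpMean]
  · simp only [scaledBump, mul_comm]
  · intro x hx
    rw [scaledBump_eq_zero hr fun h => hx (hU h), mul_zero]

/-- The vector field transporting the scaled bump functions along the family of balls with centre
velocity `τ` and radius velocity `σ`. -/
def transportField (τ : Pt d) (σ : ℝ) (c : Pt d) (r : ℝ) (x : Pt d) : Pt d :=
  scaledBump c r x • (τ + σ • r⁻¹ • (x - c))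

theorem contDiff_transportField (τ : Pt d) (σ : ℝ) (c : Pt d) (r : ℝ) :
    ContDiff ℝ ∞ (transportField τ σ c r) :=
  (contDiff_scaledBump c r).smul (by fun_prop)

theorem support_transportField_subset (τ : Pt d) (σ : ℝ) (c : Pt d) (r : ℝ) :
    Function.support (transportField τ σ c r) ⊆ Function.support (scaledBump c r) := by
  intro x hx h0
  exact hx (by simp [transportField, h0])

theorem norm_transportField_le {c : Pt d} {r : ℝ} (hr : 0 < r) (τ : Pt d) (σ : ℝ) (x : Pt d) :
    ‖transportField τ σ c r x‖ ≤ |scaledBump c r x| * (‖τ‖ + |σ|) := by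
  by_cases hx : x ∈ Metric.closedBall c r
  · rw [transportField, norm_smul, Real.norm_eq_abs]
    refine mul_le_mul_of_nonneg_left ((norm_add_le _ _).trans ?_) (abs_nonneg _)
    rw [norm_smul, norm_smul, Real.norm_eq_abs, norm_inv, Real.norm_of_nonneg hr.le]
    rw [Metric.mem_closedBall, dist_eq_norm] at hx
    have : r⁻¹ * ‖x - c‖ ≤ 1 := by rwa [inv_mul_le_iff₀ hr, mul_one]
    have := mul_le_mul_of_nonneg_left this (abs_nonneg σ)
    linarith
  · simp [transportField, scaledBump_eq_zero hr hx]

theorem fderiv_scaledBump (c : Pt d) (r : ℝ) (x y : Pt d) :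
    fderiv ℝ (scaledBump c r) x y
      = (r ^ d)⁻¹ * (r⁻¹ * fderiv ℝ (bump d) (r⁻¹ • (x - c)) y) := by
  have h1 : HasFDerivAt (fun x : Pt d => r⁻¹ • (x - c)) (r⁻¹ • ContinuousLinearMap.id ℝ (Pt d)) x :=
    ((hasFDerivAt_id x).sub_const c).const_smul r⁻¹
  have h2 := (((contDiff_bump d).differentiable (by simp) (r⁻¹ • (x - c))).hasFDerivAt.comp x
    h1).const_mul (r ^ d)⁻¹
  rw [show scaledBump c r = fun x => (r ^ d)⁻¹ * (bump d ∘ fun x => r⁻¹ • (x - c)) x from rfl,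
    h2.fderiv]
  simp

theorem divergence_transportField (τ : Pt d) (σ : ℝ) (c : Pt d) (r : ℝ) (x : Pt d) :
    ∑ i, fderiv ℝ (transportField τ σ c r) x (EuclideanSpace.single i 1) i
      = d * σ * r⁻¹ * scaledBump c r x
        + fderiv ℝ (scaledBump c r) x (τ + σ • r⁻¹ • (x - c)) := by
  have h1 : HasFDerivAt (fun x : Pt d => τ + σ • r⁻¹ • (x - c))
      (σ • r⁻¹ • ContinuousLinearMap.id ℝ (Pt d)) x :=
    ((((hasFDerivAt_id x).sub_const c).const_smul r⁻¹).const_smul σ).const_add τ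
  have h2 := ((contDiff_scaledBump c r).differentiable (by simp) x).hasFDerivAt.smul h1
  rw [show transportField τ σ c r = scaledBump c r • fun x => τ + σ • r⁻¹ • (x - c) from rfl,
    h2.fderiv]
  set V := τ + σ • r⁻¹ • (x - c) with hV
  have hVs : V = ∑ i, V i • EuclideanSpace.single i (1 : ℝ) := by
    ext j
    simp [Finset.sum_apply, Pi.single_apply]
  conv_rhs => rw [hVs, map_sum]
  simp only [add_apply, smul_apply,
    ContinuousLinearMap.smulRight_apply, ContinuousLinearMap.id_apply, PiLp.add_apply,
    PiLp.smul_apply, smul_eq_mul, PiLp.single_apply, if_true, map_smul,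
    Finset.sum_add_distrib, Finset.sum_const, Finset.card_univ, Fintype.card_fin, nsmul_eq_mul]
  congr 1
  · ring
  · exact Finset.sum_congr rfl fun i _ => by ring

theorem hasDerivAt_scaledBump (c τ : Pt d) {r σ s : ℝ} (hr : r + s * σ ≠ 0) (x : Pt d) :
    HasDerivAt (fun s => scaledBump (c + s • τ) (r + s * σ) x)
      (-∑ i, fderiv ℝ (transportField τ σ (c + s • τ) (r + s * σ)) x
        (EuclideanSpace.single i 1) i) s := by
  rw [divergence_transportField, fderiv_scaledBump]
  set R := r + s * σ with hR
  set y := R⁻¹ • (x - (c + s • τ)) with hy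
  have hRd : HasDerivAt (fun s : ℝ => r + s * σ) σ s := by
    simpa using ((hasDerivAt_id s).mul_const σ).const_add r
  have hcd : HasDerivAt (fun s : ℝ => x - (c + s • τ)) (-τ) s := by
    simpa using (((hasDerivAt_id s).smul_const τ).const_add c).const_sub x
  have hyd : HasDerivAt (fun s : ℝ => (r + s * σ)⁻¹ • (x - (c + s • τ)))
      (-(R⁻¹ • (τ + σ • y))) s := by
    refine ((hRd.inv hr).smul hcd).congr_deriv ?_
    simp only [hy, ← hR, Pi.inv_apply]
    simp only [smul_neg, smul_add, smul_smul, neg_div, neg_smul, neg_add]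
    congr 3
    field_simp
  have hb : HasDerivAt (fun s : ℝ => bump d ((r + s * σ)⁻¹ • (x - (c + s • τ))))
      (fderiv ℝ (bump d) y (-(R⁻¹ • (τ + σ • y)))) s :=
    ((contDiff_bump d).differentiable (by simp) y).hasFDerivAt.comp_hasDerivAt s hyd
  have hp := ((hRd.pow d).inv (pow_ne_zero d hr)).mul hb
  refine hp.congr_deriv ?_
  rw [scaledBump]
  simp only [map_neg, map_smul, smul_eq_mul, ← hy, Pi.pow_apply, Pi.inv_apply, ← hR]
  have hRn : R ≠ 0 := hr
  rcases Nat.eq_zero_or_pos d with h0 | h0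
  · subst h0; simp
  · obtain ⟨k, rfl⟩ : ∃ k, d = k + 1 := ⟨d - 1, by omega⟩
    simp only [Nat.add_sub_cancel]
    field_simp
    push_cast
    ring

theorem integral_scaledBump_sq (c : Pt d) {r : ℝ} (hr : 0 < r) :
    ∫ x, scaledBump c r x ^ 2 = (r ^ d)⁻¹ * ∫ x, bump d x ^ 2 := by
  rw [← integral_comp_homothety _ c hr, ← integral_const_mul, ← integral_const_mul]
  refine integral_congr_ae (Filter.Eventually.of_forall fun y => ?_)
  simp only [scaledBump, add_sub_cancel_left, inv_smul_smul₀ hr.ne']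
  have : r ^ d ≠ 0 := by positivity
  field_simp

theorem sq_setIntegral_inner_transportField_le {U : Set (Pt d)} {g : Pt d → Pt d}
    (hg : MemLp g 2 (volume.restrict U)) (τ : Pt d) (σ : ℝ) (c : Pt d) {r : ℝ} (hr : 0 < r) :
    (∫ x in U, inner ℝ (g x) (transportField τ σ c r x)) ^ 2
      ≤ (∫ x in U, ‖g x‖ ^ 2) * ((‖τ‖ + |σ|) ^ 2 * ((r ^ d)⁻¹ * ∫ x, bump d x ^ 2)) := by
  have hb : MemLp (fun x => |scaledBump c r x| * (‖τ‖ + |σ|)) 2 (volume : Measure (Pt d)) :=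
    ((contDiff_scaledBump c r).continuous.abs.mul continuous_const).memLp_of_hasCompactSupport
      ((hasCompactSupport_scaledBump hr).norm.mul_right)
  have h1 := sq_integral_le_of_abs_le (μ := volume.restrict U)
    (F := fun x => inner ℝ (g x) (transportField τ σ c r x)) (a := fun x => ‖g x‖)
    (b := fun x => |scaledBump c r x| * (‖τ‖ + |σ|))
    (fun x => (abs_real_inner_le_norm _ _).trans
      (mul_le_mul_of_nonneg_left (norm_transportField_le hr τ σ x) (norm_nonneg _)))
    hg.norm (hb.restrict U)
  refine h1.trans (mul_le_mul_of_nonneg_left ?_ (integral_nonneg fun x => sq_nonneg _))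
  refine (setIntegral_le_integral hb.integrable_sq
    (Filter.Eventually.of_forall fun x => sq_nonneg _)).trans ?_
  rw [← integral_scaledBump_sq c hr, ← integral_const_mul]
  refine le_of_eq (integral_congr_ae (Filter.Eventually.of_forall fun y => ?_))
  simp only [mul_pow, sq_abs]
  ring

theorem continuous_divergence {Φ : Pt d → Pt d} (hΦ : ContDiff ℝ ∞ Φ) :
    Continuous fun x => ∑ i, fderiv ℝ Φ x (EuclideanSpace.single i 1) i := by
  refine continuous_finsetSum _ fun i _ => ?_
  exact (EuclideanSpace.proj i : Pt d →L[ℝ] ℝ).continuous.comp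
    ((hΦ.continuous_fderiv (by simp)).clm_apply continuous_const)

theorem continuousOn_divergence_transportField (c τ : Pt d) (r σ : ℝ) :
    ContinuousOn (fun p : ℝ × Pt d => ∑ i,
      fderiv ℝ (transportField τ σ (c + p.1 • τ) (r + p.1 * σ)) p.2 (EuclideanSpace.single i 1) i)
      {p | r + p.1 * σ ≠ 0} := by
  simp only [divergence_transportField, fderiv_scaledBump, scaledBump]
  have hinv : ContinuousOn (fun p : ℝ × Pt d => (r + p.1 * σ)⁻¹) {p | r + p.1 * σ ≠ 0} :=
    ContinuousOn.inv₀ (by fun_prop) fun p hp => hp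
  have hinv' : ContinuousOn (fun p : ℝ × Pt d => ((r + p.1 * σ) ^ d)⁻¹) {p | r + p.1 * σ ≠ 0} :=
    ContinuousOn.inv₀ (by fun_prop) fun p hp => pow_ne_zero d hp
  have hy : ContinuousOn (fun p : ℝ × Pt d => (r + p.1 * σ)⁻¹ • (p.2 - (c + p.1 • τ)))
      {p | r + p.1 * σ ≠ 0} := hinv.smul (by fun_prop)
  have hV : ContinuousOn (fun p : ℝ × Pt d => τ + σ • (r + p.1 * σ)⁻¹ • (p.2 - (c + p.1 • τ)))
      {p | r + p.1 * σ ≠ 0} := continuousOn_const.add (hy.const_smul σ)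
  have hb := (contDiff_bump d).continuous.comp_continuousOn hy
  have hb' := ((contDiff_bump d).continuous_fderiv (by simp)).comp_continuousOn hy
  exact ((continuousOn_const.mul hinv).mul (hinv'.mul hb)).add
    (hinv'.mul (hinv.mul (hb'.clm_apply hV)))

theorem hasDerivAt_setIntegral_scaledBump {U : Set (Pt d)} (hUo : IsOpen U)
    (hUb : Bornology.IsBounded U) {f : Pt d → ℝ} (hf : MemLp f 2 (volume.restrict U))
    (c τ : Pt d) {r σ s : ℝ} (hr : 0 < r + s * σ) :
    HasDerivAt (fun s => ∫ x in U, f x * scaledBump (c + s • τ) (r + s * σ) x)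
      (∫ x in U, f x * -∑ i, fderiv ℝ (transportField τ σ (c + s • τ) (r + s * σ)) x
        (EuclideanSpace.single i 1) i) s := by
  obtain ⟨δ, hδ, hpos⟩ : ∃ δ > 0, ∀ t ∈ Metric.closedBall s δ, 0 < r + t * σ := by
    have hc : Continuous fun t : ℝ => r + t * σ := by fun_prop
    have := (isOpen_Ioi.preimage hc).mem_nhds (show s ∈ (fun t : ℝ => r + t * σ) ⁻¹' Set.Ioi 0 from hr)
    obtain ⟨δ, hδ, h⟩ := Metric.nhds_basis_closedBall.mem_iff.1 this
    exact ⟨δ, hδ, h⟩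
  obtain ⟨B, hB⟩ := ((isCompact_closedBall s δ).prod hUb.isCompact_closure).exists_bound_of_continuousOn
    ((continuousOn_divergence_transportField c τ r σ).mono fun p hp => (hpos p.1 hp.1).ne')
  refine (hasDerivAt_integral_of_dominated_loc_of_deriv_le (μ := volume.restrict U)
    (F := fun s x => f x * scaledBump (c + s • τ) (r + s * σ) x)
    (F' := fun s x => f x * -∑ i, fderiv ℝ (transportField τ σ (c + s • τ) (r + s * σ)) x
        (EuclideanSpace.single i 1) i)
    (bound := fun x => ‖f x‖ * B) (Metric.closedBall_mem_nhds s hδ) ?_ ?_ ?_ ?_ ?_ ?_).2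
  · exact Filter.Eventually.of_forall fun t =>
      hf.aestronglyMeasurable.mul (contDiff_scaledBump _ _).continuous.aestronglyMeasurable
  · exact MemLp.integrable_mul_continuous hf (contDiff_scaledBump _ _).continuous
      (hasCompactSupport_scaledBump hr)
  · exact hf.aestronglyMeasurable.mul
      (continuous_divergence (contDiff_transportField _ _ _ _)).neg.aestronglyMeasurable
  · refine ae_restrict_of_forall_mem hUo.measurableSet fun x hx t ht => ?_
    rw [norm_mul, norm_neg]
    exact mul_le_mul_of_nonneg_left (hB (t, x) ⟨ht, subset_closure hx⟩) (norm_nonneg _)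
  · have : IsFiniteMeasure (volume.restrict U) := isFiniteMeasure_restrict.2 hUb.measure_lt_top.ne
    exact (hf.integrable one_le_two).norm.mul_const B
  · exact Filter.Eventually.of_forall fun x t ht =>
      (hasDerivAt_scaledBump c τ (hpos t ht).ne' x).const_mul (f x)

theorem closedBall_lineMap_subset {U : Set (Pt d)} (hU : Convex ℝ U) {c₀ c₁ : Pt d} {r₀ r₁ : ℝ}
    (h₀ : Metric.closedBall c₀ r₀ ⊆ U) (h₁ : Metric.closedBall c₁ r₁ ⊆ U) (hr₀ : 0 < r₀)
    (hr₁ : 0 < r₁) {s : ℝ} (hs : s ∈ Set.Icc (0 : ℝ) 1) :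
    Metric.closedBall (c₀ + s • (c₁ - c₀)) (r₀ + s * (r₁ - r₀)) ⊆ U := by
  intro x hx
  have hR : 0 < r₀ + s * (r₁ - r₀) := by
    have hm : 0 < min r₀ r₁ := lt_min hr₀ hr₁
    nlinarith [mul_nonneg (sub_nonneg.2 hs.2) (sub_nonneg.2 (min_le_left r₀ r₁)),
      mul_nonneg hs.1 (sub_nonneg.2 (min_le_right r₀ r₁))]
  set R := r₀ + s * (r₁ - r₀) with hRdef
  set w := R⁻¹ • (x - (c₀ + s • (c₁ - c₀))) with hw
  have hw1 : ‖w‖ ≤ 1 := by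
    rw [hw, norm_smul, norm_inv, Real.norm_of_nonneg hR.le, inv_mul_le_iff₀ hR, mul_one,
      ← dist_eq_norm]
    exact hx
  have hmem : ∀ c r, 0 < r → c + r • w ∈ Metric.closedBall c r := by
    intro c r hr
    rw [Metric.mem_closedBall, dist_eq_norm, add_sub_cancel_left, norm_smul,
      Real.norm_of_nonneg hr.le]
    nlinarith
  have hxw : x - (c₀ + s • (c₁ - c₀)) = R • w := by rw [hw, smul_inv_smul₀ hR.ne']
  have := hU.add_smul_sub_mem (h₀ (hmem c₀ r₀ hr₀)) (h₁ (hmem c₁ r₁ hr₁)) hs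
  rw [sub_eq_iff_eq_add.1 hxw, hRdef]
  convert this using 1
  module

/-- The bump means of a Sobolev function over two balls in a convex set differ by at most the
distance of the balls times the norm of the gradient, suitably scaled. -/
theorem exists_bumpMean_sub_le (d : ℕ) : ∃ C, 0 < C ∧ ∀ U : Set (Pt d), Convex ℝ U → IsOpen U →
    Bornology.IsBounded U → ∀ f g, IsH1 U f g → ∀ (c₀ c₁ : Pt d) (r₀ r₁ ρ : ℝ), 0 < ρ → ρ ≤ r₀ →
    ρ ≤ r₁ → Metric.closedBall c₀ r₀ ⊆ U → Metric.closedBall c₁ r₁ ⊆ U →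
    ρ ^ d * (bumpMean c₁ r₁ f - bumpMean c₀ r₀ f) ^ 2
      ≤ C * (dist c₁ c₀ + |r₁ - r₀|) ^ 2 * ∫ x in U, ‖g x‖ ^ 2 := by
  set H := ∫ x, bump d x ^ 2 with hH
  have hH0 : 0 ≤ H := integral_nonneg fun x => sq_nonneg _
  refine ⟨H + 1, by linarith, fun U hU hUo hUb f g h c₀ c₁ r₀ r₁ ρ hρ hρ₀ hρ₁ h₀ h₁ => ?_⟩
  set τ := c₁ - c₀ with hτ
  set σ := r₁ - r₀ with hσ
  have hR : ∀ s ∈ Set.Icc (0 : ℝ) 1, ρ ≤ r₀ + s * σ := by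
    intro s hs
    rw [hσ]
    nlinarith [hs.1, hs.2]
  set E := ∫ x in U, ‖g x‖ ^ 2 with hE
  have hE0 : 0 ≤ E := integral_nonneg fun x => sq_nonneg _
  set B := Real.sqrt (E * ((‖τ‖ + |σ|) ^ 2 * ((ρ ^ d)⁻¹ * H))) with hB
  have hballs : ∀ s ∈ Set.Icc (0 : ℝ) 1, Metric.closedBall (c₀ + s • τ) (r₀ + s * σ) ⊆ U :=
    fun s hs => closedBall_lineMap_subset hU h₀ h₁ (hρ.trans_le hρ₀) (hρ.trans_le hρ₁) hs
  have key := norm_image_sub_le_of_norm_deriv_le_segment_01'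
    (f := fun s : ℝ => ∫ x in U, f x * scaledBump (c₀ + s • τ) (r₀ + s * σ) x)
    (fun s hs => (hasDerivAt_setIntegral_scaledBump hUo hUb h.memLp c₀ τ
      (hρ.trans_le (hR s hs))).hasDerivWithinAt) (C := B) (fun s hs => by
        have hs' : s ∈ Set.Icc (0 : ℝ) 1 := ⟨hs.1, hs.2.le⟩
        have hRs := hρ.trans_le (hR s hs')
        simp only [mul_neg, integral_neg, norm_neg]
        rw [h.integral_mul_divergence (contDiff_transportField _ _ _ _)
          ((hasCompactSupport_scaledBump hRs).mono (support_transportField_subset _ _ _ _))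
          (((closure_mono (support_transportField_subset _ _ _ _)).trans
            (tsupport_scaledBump_subset hRs)).trans (hballs s hs')), norm_neg, Real.norm_eq_abs]
        refine Real.abs_le_sqrt ((sq_setIntegral_inner_transportField_le h.memLp_grad τ σ _
          hRs).trans ?_)
        have := hR s hs'
        gcongr)
  simp only [one_smul, one_mul, zero_smul, zero_mul, add_zero] at key
  rw [show c₀ + τ = c₁ by rw [hτ]; abel, show r₀ + σ = r₁ by rw [hσ]; ring,
    ← bumpMean_eq_setIntegral (hρ.trans_le hρ₀) h₀, ← bumpMean_eq_setIntegral (hρ.trans_le hρ₁) h₁,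
    Real.norm_eq_abs] at key
  have h2 : (bumpMean c₁ r₁ f - bumpMean c₀ r₀ f) ^ 2
      ≤ E * ((‖τ‖ + |σ|) ^ 2 * ((ρ ^ d)⁻¹ * H)) := by
    rw [← Real.sq_sqrt (show 0 ≤ E * ((‖τ‖ + |σ|) ^ 2 * ((ρ ^ d)⁻¹ * H)) by positivity), ← sq_abs]
    exact pow_le_pow_left₀ (abs_nonneg _) key 2
  rw [dist_eq_norm]
  calc _ ≤ ρ ^ d * (E * ((‖τ‖ + |σ|) ^ 2 * ((ρ ^ d)⁻¹ * H))) := by gcongr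
    _ = H * (‖τ‖ + |σ|) ^ 2 * E := by
      have : ρ ^ d ≠ 0 := by positivity
      field_simp
    _ ≤ _ := by gcongr; linarith

/-! ### Comparing polynomial approximations on a simplex and on a pair of simplices -/

theorem IsRegular.half {κ : ℝ} {c : Pt d} {ρ : ℝ} {K : TaggedSimplex d}
    (h : IsRegular κ c ρ K) :
    IsRegular (2 * κ) c (ρ / 2) K ∧ Metric.closedBall c (ρ / 2) ⊆ interior K.carrier := by
  have hlt : ρ / 2 < ρ := by linarith [h.pos]
  have hsub : Metric.closedBall c (ρ / 2) ⊆ interior K.carrier :=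
    (Metric.closedBall_subset_ball hlt).trans
      ((Metric.isOpen_ball.subset_interior_iff).2 (Metric.ball_subset_closedBall.trans h.ball_subset))
  refine ⟨⟨by linarith [h.pos], hsub.trans interior_subset, ?_⟩, hsub⟩
  rw [show 2 * κ * (ρ / 2) = κ * ρ by ring]
  exact h.subset_ball

/-- Uniform shape regularity of all nodes, with inscribed balls in the interior. -/
theorem exists_uniform_interior_regularity {T₀ : Finset (TaggedSimplex d)} (hT₀ : IsConforming T₀) :
    ∃ κ, 1 ≤ κ ∧ ∀ N, IsNode T₀ N →
      ∃ c ρ, IsRegular κ c ρ N ∧ Metric.closedBall c ρ ⊆ interior N.carrier := by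
  obtain ⟨κ, hκ, h⟩ := exists_uniform_regularity hT₀
  refine ⟨2 * κ, by linarith, fun N hN => ?_⟩
  obtain ⟨c, ρ, hr⟩ := h N hN
  exact ⟨c, ρ / 2, hr.half⟩

theorem gradient_fun_sub {f g : Pt d → ℝ} {x : Pt d} (hf : DifferentiableAt ℝ f x)
    (hg : DifferentiableAt ℝ g x) :
    gradient (fun x => f x - g x) x = gradient f x - gradient g x := by
  rw [gradient, fderiv_fun_sub hf hg, map_sub]
  rfl

theorem gradient_fun_sub_const (f : Pt d → ℝ) (a : ℝ) (x : Pt d) :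
    gradient (fun x => f x - a) x = gradient f x := by
  rw [gradient, fderiv_sub_const]
  rfl

theorem IsPoly.differentiableAt {m : ℕ} {f : Pt d → ℝ} (hf : IsPoly m f) {x : Pt d} :
    DifferentiableAt ℝ f x :=
  hf.contDiff.differentiable (by simp) x

theorem bumpMean_sub {c : Pt d} {r : ℝ} (hr : 0 < r) {U : Set (Pt d)}
    (hU : Metric.closedBall c r ⊆ U) {f g : Pt d → ℝ} (hf : MemLp f 2 (volume.restrict U))
    (hg : MemLp g 2 (volume.restrict U)) :
    bumpMean c r (fun x => f x - g x) = bumpMean c r f - bumpMean c r g := by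
  have hb := (contDiff_scaledBump c r).continuous
  have hc := hasCompactSupport_scaledBump (c := c) hr
  simp only [bumpMean_eq_setIntegral hr hU, sub_mul]
  exact integral_sub (MemLp.integrable_mul_continuous hf hb hc)
    (MemLp.integrable_mul_continuous hg hb hc)

theorem bumpMean_const (c : Pt d) {r : ℝ} (hr : 0 < r) (a : ℝ) :
    bumpMean c r (fun _ => a) = a := by
  rw [bumpMean_eq hr, integral_mul_const, integral_bump, one_mul]

theorem bumpMean_congr {c : Pt d} {r : ℝ} (hr : 0 < r) {f g : Pt d → ℝ}
    (h : Set.EqOn f g (Metric.closedBall c r)) : bumpMean c r f = bumpMean c r g := by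
  rw [bumpMean_eq_setIntegral hr subset_rfl, bumpMean_eq_setIntegral hr subset_rfl]
  exact setIntegral_congr_fun measurableSet_closedBall fun x hx => by simp only [h hx]

theorem bumpMean_sq_le {c : Pt d} {r : ℝ} (hr : 0 < r) {U : Set (Pt d)}
    (hU : Metric.closedBall c r ⊆ U) {f : Pt d → ℝ} (hf : MemLp f 2 (volume.restrict U)) :
    r ^ d * bumpMean c r f ^ 2 ≤ (∫ x, bump d x ^ 2) * ∫ x in U, f x ^ 2 := by
  have hb : MemLp (scaledBump c r) 2 (volume : Measure (Pt d)) :=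
    (contDiff_scaledBump c r).continuous.memLp_of_hasCompactSupport
      (hasCompactSupport_scaledBump hr)
  rw [bumpMean_eq_setIntegral hr hU]
  have h1 := sq_integral_le_of_abs_le (μ := volume.restrict U)
    (F := fun x => f x * scaledBump c r x) (a := fun x => |f x|) (b := fun x => |scaledBump c r x|)
    (fun x => (abs_mul _ _).le) hf.norm (hb.restrict U).norm
  simp only [sq_abs] at h1
  have h2 : ∫ x in U, scaledBump c r x ^ 2 ≤ (r ^ d)⁻¹ * ∫ x, bump d x ^ 2 := by
    rw [← integral_scaledBump_sq c hr]
    exact setIntegral_le_integral hb.integrable_sq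
      (Filter.Eventually.of_forall fun x => sq_nonneg _)
  have h3 : 0 ≤ ∫ x in U, f x ^ 2 := integral_nonneg fun x => sq_nonneg _
  have hrd : r ^ d ≠ 0 := by positivity
  calc _ ≤ r ^ d * ((∫ x in U, f x ^ 2) * ((r ^ d)⁻¹ * ∫ x, bump d x ^ 2)) := by
        have := h1.trans (mul_le_mul_of_nonneg_left h2 h3)
        gcongr
    _ = _ := by field_simp

/-- The bump means over two balls of sizes and distance comparable to `ρ`. -/
theorem exists_bumpMean_sub_le_scaled (d : ℕ) {l : ℝ} (hl : 0 < l) : ∃ C, 0 < C ∧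
    ∀ U : Set (Pt d), Convex ℝ U → IsOpen U →
    Bornology.IsBounded U → ∀ f g, IsH1 U f g → ∀ (c₀ c₁ : Pt d) (r₀ r₁ ρ : ℝ), 0 < ρ →
    l * ρ ≤ r₀ → l * ρ ≤ r₁ → dist c₁ c₀ + |r₁ - r₀| ≤ l⁻¹ * ρ →
    Metric.closedBall c₀ r₀ ⊆ U → Metric.closedBall c₁ r₁ ⊆ U →
    ρ ^ d * (bumpMean c₁ r₁ f - bumpMean c₀ r₀ f) ^ 2 ≤ C * (ρ ^ 2 * ∫ x in U, ‖g x‖ ^ 2) := by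
  obtain ⟨C, hC, h⟩ := exists_bumpMean_sub_le d
  refine ⟨(l ^ d)⁻¹ * (C * l⁻¹ ^ 2), by positivity, fun U hU hUo hUb f g hfg c₀ c₁ r₀ r₁ ρ hρ hr₀ hr₁
    hdist h₀ h₁ => ?_⟩
  have key := h U hU hUo hUb f g hfg c₀ c₁ r₀ r₁ (l * ρ) (by positivity) hr₀ hr₁ h₀ h₁
  have hE : 0 ≤ ∫ x in U, ‖g x‖ ^ 2 := integral_nonneg fun x => sq_nonneg _
  have h2 : (dist c₁ c₀ + |r₁ - r₀|) ^ 2 ≤ (l⁻¹ * ρ) ^ 2 := by gcongr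
  have h3 : C * (dist c₁ c₀ + |r₁ - r₀|) ^ 2 * ∫ x in U, ‖g x‖ ^ 2
      ≤ C * (l⁻¹ * ρ) ^ 2 * ∫ x in U, ‖g x‖ ^ 2 := by gcongr
  have hld : l ^ d ≠ 0 := by positivity
  calc _ = (l ^ d)⁻¹ * ((l * ρ) ^ d * (bumpMean c₁ r₁ f - bumpMean c₀ r₀ f) ^ 2) := by
        rw [mul_pow]; field_simp
    _ ≤ (l ^ d)⁻¹ * (C * (l⁻¹ * ρ) ^ 2 * ∫ x in U, ‖g x‖ ^ 2) :=
        mul_le_mul_of_nonneg_left (key.trans h3) (by positivity)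
    _ = _ := by ring

theorem isBounded_interior_carrier (K : TaggedSimplex d) :
    Bornology.IsBounded (interior K.carrier) :=
  isCompact_carrier.isBounded.subset interior_subset

/-- `L²` control of the values of `p - P`, where `p` and `P` approximate `u` on `J`. -/
theorem exists_sq_sub_le (d m : ℕ) (κ : ℝ) : ∃ C, 0 < C ∧ ∀ (J : TaggedSimplex d) (c : Pt d) (ρ : ℝ),
    IsRegular κ c ρ J → ∀ u p P q : Pt d → ℝ, IsPoly m p → IsPoly m q → Set.EqOn P q J.carrier →
    IntegrableOn (fun x => (u x - p x) ^ 2) J.carrier →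
    IntegrableOn (fun x => (u x - P x) ^ 2) J.carrier → ∀ z ∈ J.carrier,
    ρ ^ d * (p z - P z) ^ 2
      ≤ C * ((∫ x in J.carrier, (u x - p x) ^ 2) + ∫ x in J.carrier, (u x - P x) ^ 2) := by
  obtain ⟨C, hC, h⟩ := exists_poly_bound_scaled d m κ
  refine ⟨C * 2, by positivity, fun J c ρ hr u p P q hp hq hPq hup huP z hz => ?_⟩
  have h1 := (h _ (hp.sub hq) c ρ hr.pos z (hr.subset_ball hz)).1
  rw [hPq hz]
  refine h1.trans ?_
  rw [mul_assoc]
  refine mul_le_mul_of_nonneg_left ?_ hC.le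
  have hint : IntegrableOn (fun x => 2 * ((u x - p x) ^ 2 + (u x - P x) ^ 2)) J.carrier :=
    (hup.add huP).const_mul 2
  calc _ ≤ ∫ x in Metric.closedBall c ρ, 2 * ((u x - p x) ^ 2 + (u x - P x) ^ 2) := by
        refine setIntegral_mono_on (integrableOn_closedBall
          ((hp.sub hq).contDiff.continuous.pow 2) c ρ) (hint.mono_set hr.ball_subset)
          measurableSet_closedBall fun x hx => ?_
        rw [hPq (hr.ball_subset hx)]
        nlinarith [sq_nonneg ((u x - p x) + (u x - q x))]
    _ ≤ ∫ x in J.carrier, 2 * ((u x - p x) ^ 2 + (u x - P x) ^ 2) :=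
        setIntegral_mono_set hint (Filter.Eventually.of_forall fun x => by positivity)
          hr.ball_subset.eventuallyLE
    _ = _ := by rw [integral_const_mul, integral_add hup huP]

/-- Moving the bump mean from the inscribed ball of a simplex to a ball around one of its points
`e`, through a small ball in the intersection of the simplex and the ball around `e`. -/
theorem exists_bumpMean_sub_le_of_mem (d : ℕ) (hd : 1 ≤ d) {κ : ℝ} (hκ : 1 ≤ κ) : ∃ C, 0 < C ∧
    ∀ (J : TaggedSimplex d) (c e : Pt d) (ρ r : ℝ),
    IsRegular κ c ρ J → Metric.closedBall c ρ ⊆ interior J.carrier → e ∈ J.carrier → r ≤ ρ →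
    ρ ≤ 4 * κ * d * r → ∀ (f : Pt d → ℝ) (g : Pt d → Pt d), IsH1 (interior J.carrier) f g →
    IsH1 (Metric.ball e r) f g →
    ρ ^ d * (bumpMean e (r / 2) f - bumpMean c ρ f) ^ 2
      ≤ C * (ρ ^ 2 * ((∫ x in interior J.carrier, ‖g x‖ ^ 2)
        + ∫ x in Metric.ball e r, ‖g x‖ ^ 2)) := by
  have hd' : (1 : ℝ) ≤ d := by exact_mod_cast hd
  have hκκ : 0 < κ := by linarith
  -- with this `l` the ball of radius `l ρ` around `e + 2 l (c - e)` lies in the simplex, by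
  -- convexity, as well as in the ball of radius `r` around `e`
  set l : ℝ := (16 * κ * d * (κ + 1))⁻¹ with hl
  have hl0 : 0 < l := by positivity
  have hlinv : l⁻¹ = 16 * κ * d * (κ + 1) := by rw [hl, inv_inv]
  have hl5 : l * (16 * κ * d * (κ + 1)) = 1 := by rw [hl]; exact inv_mul_cancel₀ (by positivity)
  have hl4 : 16 * κ * κ + 16 * κ ≤ l⁻¹ := by
    rw [hlinv]
    have : 16 * κ * (κ + 1) * 1 ≤ 16 * κ * (κ + 1) * d := by gcongr
    linarith
  have hl1 : 16 * l ≤ 1 := by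
    have : l * 16 ≤ l * (16 * κ * d * (κ + 1)) := by
      have : (1 : ℝ) ≤ κ * d * (κ + 1) := by
        have h1 : (1 : ℝ) ≤ κ * d := by nlinarith
        nlinarith
      refine mul_le_mul_of_nonneg_left ?_ hl0.le
      linarith
    linarith
  obtain ⟨C₂, hC₂, hmove⟩ := exists_bumpMean_sub_le_scaled d hl0
  refine ⟨2 * C₂, by positivity, ?_⟩
  intro J c e ρ r hJ hJi he hrρ hρr f g hfJ hfD
  have hρ := hJ.pos
  have hlρ : 0 < l * ρ := by positivity
  have hr : 0 < r := by
    by_contra hno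
    have : 4 * κ * d * r ≤ 0 := mul_nonpos_of_nonneg_of_nonpos (by positivity) (not_lt.1 hno)
    linarith
  set y := e + (2 * l) • (c - e) with hy
  have hlr : 4 * (l * ρ) * (κ + 1) ≤ r := by
    calc _ ≤ 4 * (l * (4 * κ * d * r)) * (κ + 1) := by gcongr
      _ = l * (16 * κ * d * (κ + 1)) * r := by ring
      _ = r := by rw [hl5, one_mul]
  have hκlρ : l * ρ ≤ κ * (l * ρ) := le_mul_of_one_le_left hlρ.le hκ
  have hlr' : 8 * (l * ρ) ≤ r := by linarith
  have hyJ : Metric.closedBall y (l * ρ) ⊆ interior J.carrier := by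
    have h1 := closedBall_subset_of_convex convex_carrier he hJ.ball_subset (μ := 2 * l)
      (by positivity) (by linarith)
    refine (Metric.closedBall_subset_ball ?_).trans
      ((Metric.isOpen_ball.subset_interior_iff).2 (Metric.ball_subset_closedBall.trans h1))
    linarith
  have hec : dist c e ≤ κ * ρ := by rw [dist_comm]; exact hJ.dist_le he
  have hye : dist y e ≤ 2 * (κ * (l * ρ)) := by
    rw [hy, dist_eq_norm, add_sub_cancel_left, norm_smul, Real.norm_of_nonneg (by positivity),
      ← dist_eq_norm]
    calc _ ≤ 2 * l * (κ * ρ) := by gcongr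
      _ = _ := by ring
  have hyD : Metric.closedBall y (l * ρ) ⊆ Metric.ball e r := by
    refine fun x hx => ?_
    have h1 := dist_triangle x y e
    rw [Metric.mem_closedBall] at hx
    rw [Metric.mem_ball]
    linarith
  have hyc : dist y c ≤ 2 * κ * ρ := hJ.dist_le_two
    (interior_subset (hyJ (Metric.mem_closedBall_self (by positivity)))) hJ.center_mem
  have hl3 : l * ρ ≤ ρ := by nlinarith
  have hκρ : ρ ≤ κ * ρ := le_mul_of_one_le_left hρ.le hκ
  have hbig : 16 * (κ * ρ) ≤ l⁻¹ * ρ := by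
    have : (16 * κ * κ + 16 * κ) * ρ ≤ l⁻¹ * ρ := by gcongr
    have h0 : 0 ≤ κ * κ * ρ := by positivity
    linarith
  have move₁ := hmove (interior J.carrier) convex_carrier.interior isOpen_interior
    (isBounded_interior_carrier J) _ _ hfJ c y ρ (l * ρ) ρ hρ hl3 le_rfl (by
      rw [abs_of_nonpos (by linarith)]
      linarith) hJi hyJ
  have move₂ := hmove (Metric.ball e r) (convex_ball e r) Metric.isOpen_ball Metric.isBounded_ball
    _ _ hfD y e (l * ρ) (r / 2) ρ hρ le_rfl (by linarith) (by
      have h1 : |r / 2 - l * ρ| ≤ ρ := by rw [abs_le]; constructor <;> linarith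
      rw [dist_comm]
      linarith) hyD (Metric.closedBall_subset_ball (by linarith))
  set A := bumpMean e (r / 2) f
  set B := bumpMean y (l * ρ) f
  set D := bumpMean c ρ f
  have h3 : (A - D) ^ 2 ≤ 2 * (B - D) ^ 2 + 2 * (A - B) ^ 2 := by
    nlinarith [sq_nonneg ((A - B) - (B - D))]
  calc _ ≤ ρ ^ d * (2 * (B - D) ^ 2 + 2 * (A - B) ^ 2) := by gcongr
    _ = 2 * (ρ ^ d * (B - D) ^ 2) + 2 * (ρ ^ d * (A - B) ^ 2) := by ring
    _ ≤ _ := by linarith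

/-- Moving the bump mean between the inscribed balls of nested simplices of comparable size. -/
theorem exists_bumpMean_sub_le_of_subset (d : ℕ) {κ : ℝ} (hκ : 1 ≤ κ) : ∃ C, 0 < C ∧
    ∀ (J K : TaggedSimplex d) (c c' : Pt d) (ρ ρ' : ℝ),
    IsRegular κ c ρ J → Metric.closedBall c ρ ⊆ interior J.carrier →
    IsRegular κ c' ρ' K → Metric.closedBall c' ρ' ⊆ interior K.carrier →
    J.carrier ⊆ K.carrier → ρ ≤ 2 * κ * ρ' → ρ' ≤ 2 * κ * ρ →
    ∀ (f : Pt d → ℝ) (g : Pt d → Pt d), IsH1 (interior K.carrier) f g →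
    ρ ^ d * (bumpMean c ρ f - bumpMean c' ρ' f) ^ 2
      ≤ C * (ρ ^ 2 * ∫ x in interior K.carrier, ‖g x‖ ^ 2) := by
  have hκκ : 0 < κ := by linarith
  obtain ⟨C, hC, hmove⟩ := exists_bumpMean_sub_le_scaled d (l := (6 * κ * κ)⁻¹) (by positivity)
  refine ⟨C, hC, fun J K c c' ρ ρ' hJ hJi hK hKi hJK h1 h2 f g hf => ?_⟩
  have hρ := hJ.pos
  have hρ' := hK.pos
  refine hmove _ convex_carrier.interior isOpen_interior (isBounded_interior_carrier K) f g hf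
    c' c ρ' ρ ρ hρ ?_ ?_ ?_ hKi (hJi.trans (interior_mono hJK))
  · rw [inv_mul_le_iff₀ (by positivity)]
    nlinarith [mul_pos hκκ hρ', mul_nonneg (mul_pos hκκ hρ').le (sub_nonneg.2 hκ)]
  · rw [inv_mul_le_iff₀ (by positivity)]
    have : 1 ≤ κ * κ := by nlinarith
    nlinarith
  · rw [inv_inv]
    have hκρ : ρ ≤ κ * ρ := le_mul_of_one_le_left hρ.le hκ
    have hκρ2 : κ * ρ ≤ κ * (κ * ρ) := le_mul_of_one_le_left (by positivity) hκ
    have h3 : |ρ - ρ'| ≤ 2 * (κ * ρ) := by rw [abs_le]; constructor <;> linarith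
    have h4 : dist c c' ≤ 2 * κ * ρ' := hK.dist_le_two (hJK hJ.center_mem) hK.center_mem
    have h5 : 2 * κ * ρ' ≤ 2 * κ * (2 * κ * ρ) := by gcongr
    linarith

/-- Gradient control of the values of `p - P` up to the mean of `u - P` over a ball around a
point `e` of `J`. -/
theorem exists_sq_sub_bumpMean_le (d m : ℕ) (hd : 1 ≤ d) {κ : ℝ} (hκ : 1 ≤ κ) : ∃ C, 0 < C ∧
    ∀ (J K : TaggedSimplex d) (c c' e : Pt d) (ρ ρ' r : ℝ),
    IsRegular κ c ρ J → Metric.closedBall c ρ ⊆ interior J.carrier →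
    IsRegular κ c' ρ' K → Metric.closedBall c' ρ' ⊆ interior K.carrier →
    J.carrier ⊆ K.carrier → ρ ≤ 2 * κ * ρ' → ρ' ≤ 2 * κ * ρ → e ∈ J.carrier → r ≤ ρ →
    ρ ≤ 4 * κ * d * r →
    ∀ (u p P q : Pt d → ℝ) (G : Pt d → Pt d), IsPoly m p → IsPoly m q →
    Set.EqOn P q J.carrier →
    IsH1 (interior K.carrier) (fun x => u x - p x) (fun x => G x - gradient p x) →
    IsH1 (interior J.carrier) (fun x => u x - P x) (fun x => G x - gradient P x) →
    IsH1 (Metric.ball e r) (fun x => u x - P x) (fun x => G x - gradient P x) →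
    bumpMean c' ρ' (fun x => u x - p x) = 0 → ∀ z ∈ J.carrier,
    ρ ^ d * (p z - P z - bumpMean e (r / 2) (fun x => u x - P x)) ^ 2
      ≤ C * (ρ ^ 2 * ((∫ x in interior K.carrier, ‖G x - gradient p x‖ ^ 2)
        + (∫ x in interior J.carrier, ‖G x - gradient P x‖ ^ 2)
        + ∫ x in Metric.ball e r, ‖G x - gradient P x‖ ^ 2)) := by
  obtain ⟨C₁, hC₁, hpoly⟩ := exists_poly_bound_scaled d m κ
  obtain ⟨C₂, hC₂, hmove₁⟩ := exists_bumpMean_sub_le_of_mem d hd hκ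
  obtain ⟨C₃, hC₃, hmove₂⟩ := exists_bumpMean_sub_le_of_subset d hκ
  refine ⟨C₁ * (2 * C₂ + 2 * C₃ + 2), by positivity, ?_⟩
  intro J K c c' e ρ ρ' r hJ hJi hK hKi hJK hρρ' hρ'ρ he hrρ hρr u p P q G hp hq hPq hup huP huD
    hmean z hz
  have hρ := hJ.pos
  have m₁ := hmove₁ J c e ρ r hJ hJi he hrρ hρr _ _ huP huD
  have m₂ := hmove₂ J K c c' ρ ρ' hJ hJi hK hKi hJK hρρ' hρ'ρ _ _ hup
  rw [hmean, sub_zero] at m₂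
  set A := ∫ x in interior K.carrier, ‖G x - gradient p x‖ ^ 2 with hA
  set B := ∫ x in interior J.carrier, ‖G x - gradient P x‖ ^ 2 with hB
  set D := ∫ x in Metric.ball e r, ‖G x - gradient P x‖ ^ 2 with hD
  have hA0 : 0 ≤ A := integral_nonneg fun x => sq_nonneg _
  have hB0 : 0 ≤ B := integral_nonneg fun x => sq_nonneg _
  have hD0 : 0 ≤ D := integral_nonneg fun x => sq_nonneg _
  set β := bumpMean e (r / 2) (fun x => u x - P x) with hβ
  have hJU := interior_mono hJK
  have hup' : IsH1 (interior J.carrier) (fun x => u x - p x) (fun x => G x - gradient p x) :=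
    hup.mono hJU isOpen_interior.measurableSet
  -- `p - q` is a difference of errors on `J`, so that its mean is controlled by moving the mean of
  -- `u - P` to the ball around `e` and the mean of `u - p` to the ball where it vanishes
  have hpq := hp.sub hq
  have hq' := hpq.sub (IsPoly.const m β)
  have hmq : bumpMean c ρ (fun x => p x - q x - β)
      = bumpMean c ρ (fun x => u x - P x) - bumpMean c ρ (fun x => u x - p x) - β := by
    rw [← bumpMean_sub hρ hJi huP.memLp hup'.memLp]
    nth_rewrite 2 [← bumpMean_const c hρ β]
    have : IsFiniteMeasure (volume.restrict (interior J.carrier)) :=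
      isFiniteMeasure_restrict.2 (isBounded_interior_carrier J).measure_lt_top.ne
    rw [← bumpMean_sub hρ hJi (huP.sub hup').memLp (memLp_const β)]
    refine bumpMean_congr hρ fun x hx => ?_
    simp only [hPq (hJ.ball_subset hx)]
    ring
  have hthird := (hpoly _ hq' c ρ hρ z (hJ.subset_ball hz)).2.2
  rw [hmq, ← hPq hz] at hthird
  have hgrad : ∫ x in Metric.closedBall c ρ, ‖gradient (fun x => p x - q x - β) x‖ ^ 2
      ≤ 2 * (A + B) := by
    have i₁ := hup'.memLp_grad.norm.integrable_sq
    have i₂ := huP.memLp_grad.norm.integrable_sq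
    have hint : IntegrableOn (fun x => 2 * (‖G x - gradient p x‖ ^ 2 + ‖G x - gradient P x‖ ^ 2))
        (interior J.carrier) := (i₁.add i₂).const_mul 2
    calc _ ≤ ∫ x in Metric.closedBall c ρ,
            2 * (‖G x - gradient p x‖ ^ 2 + ‖G x - gradient P x‖ ^ 2) := by
          refine setIntegral_mono_on (integrableOn_closedBall
            ((continuous_gradient hq'.contDiff).norm.pow 2) c ρ) (hint.mono_set hJi)
            measurableSet_closedBall fun x hx => ?_
          rw [gradient_eq_of_mem_interior hPq (hJi hx)]
          have h1 : gradient (fun x => p x - q x - β) x = gradient p x - gradient q x := by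
            rw [gradient_fun_sub_const, gradient_fun_sub hp.differentiableAt hq.differentiableAt]
          rw [h1]
          have h2 : ‖gradient p x - gradient q x‖
              ≤ ‖G x - gradient p x‖ + ‖G x - gradient q x‖ := by
            rw [show gradient p x - gradient q x
              = (G x - gradient q x) - (G x - gradient p x) by abel, add_comm]
            exact norm_sub_le _ _
          have := pow_le_pow_left₀ (norm_nonneg _) h2 2
          nlinarith [sq_nonneg (‖G x - gradient p x‖ - ‖G x - gradient q x‖)]
      _ ≤ ∫ x in interior J.carrier,
            2 * (‖G x - gradient p x‖ ^ 2 + ‖G x - gradient P x‖ ^ 2) :=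
          setIntegral_mono_set hint (Filter.Eventually.of_forall fun x => by positivity)
            hJi.eventuallyLE
      _ = 2 * ((∫ x in interior J.carrier, ‖G x - gradient p x‖ ^ 2) + B) := by
          rw [integral_const_mul, integral_add i₁ i₂]
      _ ≤ _ := by
          have : ∫ x in interior J.carrier, ‖G x - gradient p x‖ ^ 2 ≤ A :=
            setIntegral_mono_set hup.memLp_grad.norm.integrable_sq
              (Filter.Eventually.of_forall fun x => by positivity) hJU.eventuallyLE
          linarith
  set a := bumpMean c ρ (fun x => u x - P x)
  set b := bumpMean c ρ (fun x => u x - p x)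
  have h3 : (a - b - β) ^ 2 ≤ 2 * (β - a) ^ 2 + 2 * b ^ 2 := by
    nlinarith [sq_nonneg ((β - a) - b)]
  refine hthird.trans ?_
  rw [mul_assoc]
  refine mul_le_mul_of_nonneg_left ?_ hC₁.le
  calc _ ≤ ρ ^ d * (2 * (β - a) ^ 2 + 2 * b ^ 2) + ρ ^ 2 * (2 * (A + B)) := by gcongr
    _ = 2 * (ρ ^ d * (β - a) ^ 2) + 2 * (ρ ^ d * b ^ 2) + 2 * (ρ ^ 2 * (A + B)) := by ring
    _ ≤ 2 * (C₂ * (ρ ^ 2 * (B + D))) + 2 * (C₃ * (ρ ^ 2 * A)) + 2 * (ρ ^ 2 * (A + B)) := by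
        gcongr
    _ ≤ _ := by
        have e1 : 0 ≤ C₂ * (ρ ^ 2 * A) := by positivity
        have e2 : 0 ≤ C₃ * (ρ ^ 2 * B) := by positivity
        have e3 : 0 ≤ C₃ * (ρ ^ 2 * D) := by positivity
        have e4 : 0 ≤ ρ ^ 2 * D := by positivity
        linarith

/-! ### The jump of the local approximations across a face -/

/-- A shape regularity parameter `κ` together with inscribed balls for all nodes of the master
forest. -/
structure RegularFamily (T₀ : Finset (TaggedSimplex d)) (κ : ℝ) (cen : TaggedSimplex d → Pt d)
    (rad : TaggedSimplex d → ℝ) : Prop where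
  one_le : 1 ≤ κ
  isRegular : ∀ N, IsNode T₀ N → IsRegular κ (cen N) (rad N) N
  subset_interior : ∀ N, IsNode T₀ N → Metric.closedBall (cen N) (rad N) ⊆ interior N.carrier

theorem exists_regularFamily {T₀ : Finset (TaggedSimplex d)} (hT₀ : IsConforming T₀) :
    ∃ κ cen rad, RegularFamily T₀ κ cen rad := by
  obtain ⟨κ, hκ, h⟩ := exists_uniform_interior_regularity hT₀
  choose! cen rad h1 h2 using h
  exact ⟨κ, cen, rad, hκ, h1, h2⟩

section FE

variable {T₀ : Finset (TaggedSimplex d)} (hT₀ : IsConforming T₀) {ℓ : ℕ} {u : Pt d → ℝ}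
  {G : Pt d → Pt d} (hu : IsH1 (meshDomain T₀) u G)

/-- A function belonging to a finite element space over some conforming refinement. -/
def IsFE (ℓ : ℕ) (T₀ : Finset (TaggedSimplex d)) (P : Pt d → ℝ) : Prop :=
  ∃ T ∈ conformingRefinements T₀, P ∈ feSpace ℓ T

theorem isFE_of_mem_localSpace {F : Set (Pt d)} {P : Pt d → ℝ} (h : P ∈ localSpace ℓ T₀ F) :
    IsFE ℓ T₀ P := by
  obtain ⟨T, hT, -, hP⟩ := h
  exact ⟨T, hT, hP⟩

include hT₀ hu in
theorem IsFE.integrableOn_sq {P : Pt d → ℝ} (hP : IsFE ℓ T₀ P) :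
    IntegrableOn (fun x => (u x - P x) ^ 2) (meshUnion T₀) := by
  obtain ⟨T, hT, hP⟩ := hP
  have h1 := hu.memLp
  have h2 := memLp_of_mem_feSpace hP
  rw [restrict_meshDomain] at h1
  rw [meshUnion_of_mem_conformingRefinements hT₀ hT] at h2
  exact (h1.sub h2).integrable_sq

include hT₀ hu in
theorem IsFE.integrableOn_norm_sq {P : Pt d → ℝ} (hP : IsFE ℓ T₀ P) :
    IntegrableOn (fun x => ‖G x - gradient P x‖ ^ 2) (meshUnion T₀) := by
  obtain ⟨T, hT, hP⟩ := hP
  have h1 := hu.memLp_grad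
  have h2 := memLp_gradient_of_mem_feSpace hP
  rw [restrict_meshDomain] at h1
  rw [meshUnion_of_mem_conformingRefinements hT₀ hT] at h2
  exact (h1.sub h2).norm.integrable_sq

include hT₀ hu in
theorem IsFE.isH1_sub {P : Pt d → ℝ} (hP : IsFE ℓ T₀ P) {U : Set (Pt d)} (hU : Convex ℝ U)
    (hUo : IsOpen U) (hsub : U ⊆ meshUnion T₀) :
    IsH1 U (fun x => u x - P x) (fun x => G x - gradient P x) := by
  obtain ⟨T, hT, hP⟩ := hP
  refine (hu.mono (hUo.subset_interior_iff.2 hsub) isOpen_interior.measurableSet).sub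
    (isH1_of_mem_feSpace hP hU hUo ?_)
  rwa [meshUnion_of_mem_conformingRefinements hT₀ hT]

include hT₀ in
theorem minimalPair_subset_meshUnion {F : Set (Pt d)} {P : Pt d → ℝ}
    (hP : P ∈ localSpace ℓ T₀ F) : minimalPair T₀ F ⊆ meshUnion T₀ := by
  obtain ⟨T, hT, hF, -⟩ := hP
  rw [← meshUnion_of_mem_conformingRefinements hT₀ hT]
  intro x hx
  obtain ⟨K, hK, -, hxK⟩ := mem_facePair.1 (minimalPair_subset_facePair hT hF hx)
  exact subset_meshUnion hK hxK

include hT₀ in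
theorem exists_isPoly_of_mem_localSpace {J : TaggedSimplex d} (hJ : IsNode T₀ J)
    {i : Fin (d + 1)} (h0 : i ≠ 0) (hl : i ≠ Fin.last d) {P : Pt d → ℝ}
    (hP : P ∈ localSpace ℓ T₀ (J.face i)) : ∃ q, IsPoly ℓ q ∧ Set.EqOn P q J.carrier := by
  obtain ⟨T, hT, hF, hP⟩ := hP
  obtain ⟨K, hK, -, hJK⟩ := exists_mem_face_eq_of_isNode hT₀ hJ h0 hl hT hF
  obtain ⟨q, hq, hPq⟩ := exists_isPoly_of_mem_feSpace hP hK
  exact ⟨q, hq, hPq.mono hJK⟩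

/-- `p` is a polynomial approximation of `u` on `K` with vanishing mean error. -/
structure IsLocalApprox (ℓ : ℕ) (u : Pt d → ℝ) (G : Pt d → Pt d) (c : Pt d) (ρ : ℝ)
    (K : TaggedSimplex d) (p : Pt d → ℝ) : Prop where
  isPoly : IsPoly ℓ p
  isH1 : IsH1 (interior K.carrier) (fun x => u x - p x) (fun x => G x - gradient p x)
  mean : bumpMean c ρ (fun x => u x - p x) = 0

theorem restrict_interior_carrier (K : TaggedSimplex d) :
    (volume : Measure (Pt d)).restrict (interior K.carrier) = volume.restrict K.carrier := by
  refine Measure.restrict_congr_set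
    (Filter.EventuallyLE.antisymm (LE.le.eventuallyLE interior_subset) ?_)
  have := ae_mem_interior_carrier K
  rwa [ae_restrict_iff' isClosed_carrier.measurableSet] at this

theorem IsLocalApprox.integrableOn_sq {c : Pt d} {ρ : ℝ} {K : TaggedSimplex d} {p : Pt d → ℝ}
    (h : IsLocalApprox ℓ u G c ρ K p) : IntegrableOn (fun x => (u x - p x) ^ 2) K.carrier := by
  rw [IntegrableOn, ← restrict_interior_carrier]
  exact h.isH1.memLp.integrable_sq

theorem IsLocalApprox.integrableOn_norm_sq {c : Pt d} {ρ : ℝ} {K : TaggedSimplex d} {p : Pt d → ℝ}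
    (h : IsLocalApprox ℓ u G c ρ K p) :
    IntegrableOn (fun x => ‖G x - gradient p x‖ ^ 2) K.carrier := by
  rw [IntegrableOn, ← restrict_interior_carrier]
  exact h.isH1.memLp_grad.norm.integrable_sq

theorem one_ne_last (hd : 2 ≤ d) : (1 : Fin (d + 1)) ≠ Fin.last d := by
  obtain ⟨k, rfl⟩ : ∃ k, d = k + 2 := ⟨d - 2, by omega⟩
  simp [Fin.ext_iff]

theorem one_ne_zero_fin (hd : 2 ≤ d) : (1 : Fin (d + 1)) ≠ 0 := by
  obtain ⟨k, rfl⟩ : ∃ k, d = k + 2 := ⟨d - 2, by omega⟩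
  simp

theorem volume_real_carrier_le {κ : ℝ} (hκ : 0 ≤ κ) {c : Pt d} {ρ : ℝ} {K : TaggedSimplex d}
    (h : IsRegular κ c ρ K) :
    volume.real K.carrier ≤ (κ * ρ) ^ d * volume.real (Metric.closedBall (0 : Pt d) 1) := by
  have h1 : volume.real (Metric.closedBall c (κ * ρ))
      = (κ * ρ) ^ d * volume.real (Metric.closedBall (0 : Pt d) 1) := by
    rw [Measure.real, Measure.addHaar_closedBall' _ _ (mul_nonneg hκ h.pos.le), Measure.real,
      ENNReal.toReal_mul, ENNReal.toReal_ofReal (by have := h.pos; positivity)]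
    simp
  rw [← h1]
  exact measureReal_mono h.subset_ball (isCompact_closedBall _ _).measure_lt_top.ne

theorem IsPoly.isH1 {m : ℕ} {p : Pt d → ℝ} (hp : IsPoly m p) (K : TaggedSimplex d) :
    IsH1 (interior K.carrier) p (gradient p) := by
  have hun : meshUnion {K} = K.carrier := by simp [meshUnion]
  refine isH1_of_mem_feSpace (ℓ := m) (T := {K}) ⟨hp.contDiff.continuous.continuousOn, ?_⟩
    convex_carrier.interior isOpen_interior (hun ▸ interior_subset)
  intro K' hK'
  obtain ⟨P, hP, h⟩ := hp
  exact ⟨P, hP, fun x _ => h x⟩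

/-- Adding the mean error to a polynomial approximation normalizes it at the expense of a constant
factor in the `L²` error and without changing the gradient error. -/
theorem exists_isLocalApprox (d : ℕ) {κ : ℝ} (hκ : 0 ≤ κ) : ∃ C, 0 < C ∧
    ∀ (ℓ : ℕ) (u : Pt d → ℝ) (G : Pt d → Pt d) (K : TaggedSimplex d) (c : Pt d) (ρ : ℝ),
    IsRegular κ c ρ K → Metric.closedBall c ρ ⊆ interior K.carrier →
    IsH1 (interior K.carrier) u G → ∀ q, IsPoly ℓ q →
    ∃ p, IsLocalApprox ℓ u G c ρ K p ∧
      ∫ x in K.carrier, (u x - p x) ^ 2 ≤ C * ∫ x in K.carrier, (u x - q x) ^ 2 ∧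
      ∫ x in K.carrier, ‖G x - gradient p x‖ ^ 2
        = ∫ x in K.carrier, ‖G x - gradient q x‖ ^ 2 := by
  set H := ∫ x, bump d x ^ 2 with hH
  have hH0 : 0 ≤ H := integral_nonneg fun x => sq_nonneg _
  set V := volume.real (Metric.closedBall (0 : Pt d) 1)
  refine ⟨2 + 2 * (κ ^ d * V * H), by positivity, ?_⟩
  intro ℓ u G K c ρ hr hri hu q hq
  have hρ := hr.pos
  have hH1 := hu.sub (hq.isH1 K)
  set α := bumpMean c ρ (fun x => u x - q x) with hα
  have hgrad : ∀ x, gradient (fun x => q x + α) x = gradient q x := by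
    intro x
    have := gradient_fun_sub_const q (-α) x
    simpa only [sub_neg_eq_add] using this
  have hfin : IsFiniteMeasure (volume.restrict (interior K.carrier)) :=
    isFiniteMeasure_restrict.2 (isBounded_interior_carrier K).measure_lt_top.ne
  have hfin' : IsFiniteMeasure (volume.restrict K.carrier) :=
    isFiniteMeasure_restrict.2 isCompact_carrier.measure_lt_top.ne
  have hp : IsPoly ℓ fun x => q x + α := hq.add (IsPoly.const _ _)
  refine ⟨fun x => q x + α, ⟨hp, hu.sub (hp.isH1 K), ?_⟩, ?_, ?_⟩
  · have : bumpMean c ρ (fun x => u x - (q x + α))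
        = bumpMean c ρ (fun x => (u x - q x) - (fun _ => α) x) := by
      simp only [sub_sub]
    rw [this, bumpMean_sub hρ hri hH1.memLp (memLp_const α), bumpMean_const c hρ, sub_self]
  · have h1 := bumpMean_sq_le hρ hri hH1.memLp
    rw [restrict_interior_carrier, ← hα, ← hH] at h1
    have hint : IntegrableOn (fun x => (u x - q x) ^ 2) K.carrier := by
      rw [IntegrableOn, ← restrict_interior_carrier]
      exact hH1.memLp.integrable_sq
    set I := ∫ x in K.carrier, (u x - q x) ^ 2
    have hint2 : IntegrableOn (fun x => 2 * (u x - q x) ^ 2 + 2 * α ^ 2) K.carrier :=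
      (hint.const_mul 2).add (integrable_const _)
    have hint3 : IntegrableOn (fun x => (u x - (q x + α)) ^ 2) K.carrier := by
      rw [IntegrableOn, ← restrict_interior_carrier]
      exact (hu.sub (hp.isH1 K)).memLp.integrable_sq
    calc _ ≤ ∫ x in K.carrier, (2 * (u x - q x) ^ 2 + 2 * α ^ 2) :=
          setIntegral_mono hint3 hint2 fun x => by
            simp only
            nlinarith [sq_nonneg ((u x - q x) + α)]
      _ = 2 * I + volume.real K.carrier * (2 * α ^ 2) := by
          rw [integral_add (hint.const_mul 2) (integrable_const _), integral_const_mul,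
            setIntegral_const, smul_eq_mul]
      _ ≤ 2 * I + (κ * ρ) ^ d * V * (2 * α ^ 2) := by
          gcongr
          exact volume_real_carrier_le hκ hr
      _ = 2 * I + 2 * (κ ^ d * V) * (ρ ^ d * α ^ 2) := by rw [mul_pow]; ring
      _ ≤ 2 * I + 2 * (κ ^ d * V) * (H * I) := by gcongr
      _ = _ := by ring
  · simp only [hgrad]

/-- The elementary estimate that combines the bounds on both sides of a face. -/
theorem combine_grad_bounds {M C κ R W a b β A₁ A₂ B X₁ X₂ Y ρ₁ ρ₂ w₁ w₂ : ℝ} (hM : 0 < M)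
    (hC : 0 < C) (hW : 0 ≤ W) (s₁ : W * (a - β) ^ 2 ≤ M * (w₁ * (a - β) ^ 2))
    (s₂ : W * (b - β) ^ 2 ≤ M * (w₂ * (b - β) ^ 2))
    (e₁ : w₁ * (a - β) ^ 2 ≤ C * (ρ₁ ^ 2 * (A₁ + X₁ + Y)))
    (e₂ : w₂ * (b - β) ^ 2 ≤ C * (ρ₂ ^ 2 * (A₂ + X₂ + Y))) (b₁ : X₁ ≤ B) (b₂ : X₂ ≤ B)
    (b₃ : Y ≤ B) (hA₁ : 0 ≤ A₁) (hA₂ : 0 ≤ A₂) (hB : 0 ≤ B) (hρ₁ : 0 < ρ₁) (hρ₂ : 0 < ρ₂)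
    (h₁ : ρ₁ ≤ 2 * κ * R) (h₂ : ρ₂ ≤ 2 * κ * R) :
    W * (a - b) ^ 2 ≤ M * (8 * C * (2 * κ) ^ 2) * (R ^ 2 * (A₁ + A₂ + B)) := by
  have hsq : (a - b) ^ 2 ≤ 2 * (a - β) ^ 2 + 2 * (b - β) ^ 2 := by
    nlinarith [sq_nonneg ((a - β) + (b - β))]
  have bound : ∀ ρ A X w : ℝ, 0 < ρ → ρ ≤ 2 * κ * R → 0 ≤ A → X ≤ B →
      w ≤ C * (ρ ^ 2 * (A + X + Y)) → M * w ≤ M * (C * ((2 * κ * R) ^ 2 * (A + 2 * B))) := by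
    intro ρ A X w hρ h1 hA hX hw
    refine mul_le_mul_of_nonneg_left (hw.trans ?_) hM.le
    refine mul_le_mul_of_nonneg_left ?_ hC.le
    calc _ ≤ ρ ^ 2 * (A + 2 * B) := mul_le_mul_of_nonneg_left (by linarith) (sq_nonneg ρ)
      _ ≤ _ := by gcongr
  have t₁ := s₁.trans (bound _ _ _ _ hρ₁ h₁ hA₁ b₁ e₁)
  have t₂ := s₂.trans (bound _ _ _ _ hρ₂ h₂ hA₂ b₂ e₂)
  calc _ ≤ W * (2 * (a - β) ^ 2 + 2 * (b - β) ^ 2) := by gcongr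
    _ = 2 * (W * (a - β) ^ 2) + 2 * (W * (b - β) ^ 2) := by ring
    _ ≤ 2 * (M * (C * ((2 * κ * R) ^ 2 * (A₁ + 2 * B))))
        + 2 * (M * (C * ((2 * κ * R) ^ 2 * (A₂ + 2 * B)))) := by gcongr
    _ = M * (C * (2 * κ * R) ^ 2) * (2 * A₁ + 2 * A₂ + 8 * B) := by ring
    _ ≤ M * (C * (2 * κ * R) ^ 2) * (8 * (A₁ + A₂ + B)) := by gcongr; linarith
    _ = _ := by ring

/-- The jump between normalized approximations on two elements at a point of their common face is
controlled by the errors on both elements and by the error of any function of the local space of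
the face on its minimal pair. -/
theorem exists_jump_le (hd : 2 ≤ d) (hT₀ : IsConforming T₀) {κ : ℝ} {cen : TaggedSimplex d → Pt d}
    {rad : TaggedSimplex d → ℝ} (hreg : RegularFamily T₀ κ cen rad) (ℓ : ℕ) : ∃ C, 0 < C ∧
    ∀ (u : Pt d → ℝ) (G : Pt d → Pt d), IsH1 (meshDomain T₀) u G →
    ∀ K₁ K₂, IsNode T₀ K₁ → IsNode T₀ K₂ → Disjoint (interior K₁.carrier) (interior K₂.carrier) →
    ∀ i₁ i₂, K₁.face i₁ = K₂.face i₂ → ∀ P ∈ localSpace ℓ T₀ (K₁.face i₁), ∀ p₁ p₂,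
    IsLocalApprox ℓ u G (cen K₁) (rad K₁) K₁ p₁ → IsLocalApprox ℓ u G (cen K₂) (rad K₂) K₂ p₂ →
    ∀ z ∈ K₁.face i₁,
    rad K₁ ^ d * (p₁ z - p₂ z) ^ 2 ≤ C * ((∫ x in K₁.carrier, (u x - p₁ x) ^ 2)
        + (∫ x in K₂.carrier, (u x - p₂ x) ^ 2)
        + ∫ x in minimalPair T₀ (K₁.face i₁), (u x - P x) ^ 2) ∧
    rad K₁ ^ d * (p₁ z - p₂ z) ^ 2 ≤ C * (rad K₁ ^ 2 *
        ((∫ x in K₁.carrier, ‖G x - gradient p₁ x‖ ^ 2)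
        + (∫ x in K₂.carrier, ‖G x - gradient p₂ x‖ ^ 2)
        + ∫ x in minimalPair T₀ (K₁.face i₁), ‖G x - gradient P x‖ ^ 2)) := by
  have hκ := hreg.one_le
  have hκ0 : 0 < κ := by linarith
  have hdR : (1 : ℝ) ≤ d := by exact_mod_cast (by omega : 1 ≤ d)
  obtain ⟨C₁, hC₁, hL2⟩ := exists_sq_sub_le d ℓ κ
  obtain ⟨C₂, hC₂, hH1⟩ := exists_sq_sub_bumpMean_le d ℓ (by omega) hκ
  set M := (2 * κ) ^ d with hM
  have hM0 : 0 < M := by positivity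
  refine ⟨M * (4 * C₁) + M * (8 * C₂ * (2 * κ) ^ 2), by positivity, ?_⟩
  intro u G hu K₁ K₂ hK₁ hK₂ hdis i₁ i₂ hface P hP p₁ p₂ hp₁ hp₂ z hz
  obtain ⟨J₁, hJK₁, j₁, hj₁, hj₁', hf₁⟩ := exists_minimal_desc hT₀ hd hK₁ i₁
  obtain ⟨J₂, hJK₂, j₂, hj₂, hj₂', hf₂⟩ := exists_minimal_desc hT₀ hd hK₂ i₂
  have hJ₁ := hK₁.desc hJK₁
  have hJ₂ := hK₂.desc hJK₂
  have hJ₁a := hJ₁.affineIndependent hT₀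
  have hJ₂a := hJ₂.affineIndependent hT₀
  have hK₁a := hK₁.affineIndependent hT₀
  have hK₂a := hK₂.affineIndependent hT₀
  have hff₁ : J₁.face j₁ = K₁.face i₁ := hf₁
  have hff₂ : J₂.face j₂ = K₁.face i₁ := hf₂.trans hface.symm
  have hsub₁ := hJK₁.carrier_subset
  have hsub₂ := hJK₂.carrier_subset
  have hω₁ : J₁.carrier ⊆ minimalPair T₀ (K₁.face i₁) :=
    hff₁ ▸ carrier_subset_minimalPair hT₀ hJ₁ hj₁ hj₁'
  have hω₂ : J₂.carrier ⊆ minimalPair T₀ (K₁.face i₁) :=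
    hff₂ ▸ carrier_subset_minimalPair hT₀ hJ₂ hj₂ hj₂'
  have hωU := minimalPair_subset_meshUnion hT₀ hP
  have hFE := isFE_of_mem_localSpace hP
  obtain ⟨q₁, hq₁, hPq₁⟩ := exists_isPoly_of_mem_localSpace hT₀ hJ₁ hj₁ hj₁' (hff₁ ▸ hP)
  obtain ⟨q₂, hq₂, hPq₂⟩ := exists_isPoly_of_mem_localSpace hT₀ hJ₂ hj₂ hj₂' (hff₂ ▸ hP)
  have hz₁ : z ∈ J₁.carrier := face_subset_carrier j₁ (hff₁ ▸ hz)
  have hz₂ : z ∈ J₂.carrier := face_subset_carrier j₂ (hff₂ ▸ hz)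
  have rK₁ := hreg.isRegular K₁ hK₁
  have rK₂ := hreg.isRegular K₂ hK₂
  have rJ₁ := hreg.isRegular J₁ hJ₁
  have rJ₂ := hreg.isRegular J₂ hJ₂
  have sK₁ := hreg.subset_interior K₁ hK₁
  have sK₂ := hreg.subset_interior K₂ hK₂
  have sJ₁ := hreg.subset_interior J₁ hJ₁
  have sJ₂ := hreg.subset_interior J₂ hJ₂
  have c₁ : rad K₁ ≤ 2 * κ * rad J₁ := rK₁.le_of_face_eq hd hK₁a rJ₁ hff₁.symm
  have c₂ : rad K₁ ≤ 2 * κ * rad J₂ := rK₁.le_of_face_eq hd hK₁a rJ₂ hff₂.symm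
  have pK₁ := rK₁.pos
  have pJ₁ := rJ₁.pos
  have pJ₂ := rJ₂.pos
  have iP := hFE.integrableOn_sq hT₀ hu
  have iP' := hFE.integrableOn_norm_sq hT₀ hu
  have scale : ∀ ρ X, rad K₁ ≤ 2 * κ * ρ → 0 ≤ X → rad K₁ ^ d * X ≤ M * (ρ ^ d * X) := by
    intro ρ X h hX
    have h1 := pow_le_pow_left₀ pK₁.le h d
    rw [mul_pow] at h1
    calc _ ≤ (2 * κ) ^ d * ρ ^ d * X := by gcongr
      _ = _ := by ring
  constructor
  · have e₁ := hL2 J₁ _ _ rJ₁ u p₁ P q₁ hp₁.isPoly hq₁ hPq₁ (hp₁.integrableOn_sq.mono_set hsub₁)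
      (iP.mono_set (hω₁.trans hωU)) z hz₁
    have e₂ := hL2 J₂ _ _ rJ₂ u p₂ P q₂ hp₂.isPoly hq₂ hPq₂ (hp₂.integrableOn_sq.mono_set hsub₂)
      (iP.mono_set (hω₂.trans hωU)) z hz₂
    have a₁ : ∫ x in J₁.carrier, (u x - p₁ x) ^ 2 ≤ ∫ x in K₁.carrier, (u x - p₁ x) ^ 2 :=
      setIntegral_mono_set hp₁.integrableOn_sq (Filter.Eventually.of_forall fun x => sq_nonneg _)
        hsub₁.eventuallyLE
    have a₂ : ∫ x in J₂.carrier, (u x - p₂ x) ^ 2 ≤ ∫ x in K₂.carrier, (u x - p₂ x) ^ 2 :=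
      setIntegral_mono_set hp₂.integrableOn_sq (Filter.Eventually.of_forall fun x => sq_nonneg _)
        hsub₂.eventuallyLE
    have b₁ : ∫ x in J₁.carrier, (u x - P x) ^ 2
        ≤ ∫ x in minimalPair T₀ (K₁.face i₁), (u x - P x) ^ 2 :=
      setIntegral_mono_set (iP.mono_set hωU) (Filter.Eventually.of_forall fun x => sq_nonneg _)
        hω₁.eventuallyLE
    have b₂ : ∫ x in J₂.carrier, (u x - P x) ^ 2
        ≤ ∫ x in minimalPair T₀ (K₁.face i₁), (u x - P x) ^ 2 :=
      setIntegral_mono_set (iP.mono_set hωU) (Filter.Eventually.of_forall fun x => sq_nonneg _)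
        hω₂.eventuallyLE
    set A₁ := ∫ x in K₁.carrier, (u x - p₁ x) ^ 2
    set A₂ := ∫ x in K₂.carrier, (u x - p₂ x) ^ 2
    set B := ∫ x in minimalPair T₀ (K₁.face i₁), (u x - P x) ^ 2
    have hA₁ : 0 ≤ A₁ := integral_nonneg fun x => sq_nonneg _
    have hA₂ : 0 ≤ A₂ := integral_nonneg fun x => sq_nonneg _
    have hB : 0 ≤ B := integral_nonneg fun x => sq_nonneg _
    have s₁ := scale _ _ c₁ (sq_nonneg (p₁ z - P z))
    have s₂ := scale _ _ c₂ (sq_nonneg (p₂ z - P z))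
    have hsq : (p₁ z - p₂ z) ^ 2 ≤ 2 * (p₁ z - P z) ^ 2 + 2 * (p₂ z - P z) ^ 2 := by
      nlinarith [sq_nonneg ((p₁ z - P z) + (p₂ z - P z))]
    calc _ ≤ rad K₁ ^ d * (2 * (p₁ z - P z) ^ 2 + 2 * (p₂ z - P z) ^ 2) := by gcongr
      _ = 2 * (rad K₁ ^ d * (p₁ z - P z) ^ 2) + 2 * (rad K₁ ^ d * (p₂ z - P z) ^ 2) := by ring
      _ ≤ 2 * (M * (C₁ * (A₁ + B))) + 2 * (M * (C₁ * (A₂ + B))) := by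
          have t₁ : M * (rad J₁ ^ d * (p₁ z - P z) ^ 2) ≤ M * (C₁ * (A₁ + B)) := by
            refine mul_le_mul_of_nonneg_left (e₁.trans ?_) hM0.le
            gcongr
          have t₂ : M * (rad J₂ ^ d * (p₂ z - P z) ^ 2) ≤ M * (C₁ * (A₂ + B)) := by
            refine mul_le_mul_of_nonneg_left (e₂.trans ?_) hM0.le
            gcongr
          linarith
      _ = M * (4 * C₁) * (A₁ / 2 + A₂ / 2 + B) := by ring
      _ ≤ M * (4 * C₁) * (A₁ + A₂ + B) := by gcongr <;> linarith
      _ ≤ _ := by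
          have : 0 ≤ M * (8 * C₂ * (2 * κ) ^ 2) := by positivity
          gcongr
          linarith
  -- the ball of radius `r` around the barycentre of the face stays inside `J₁ ∪ J₂`; subtracting the
  -- mean `β` of `u - P` over it from both `p₁ z - P z` and `p₂ z - P z` does not change the jump
  · set r := min (rad J₁ / (2 * d)) (rad J₂ / (2 * d)) with hr
    have hr₁ : r ≤ rad J₁ / (2 * d) := min_le_left _ _
    have hr₂ : r ≤ rad J₂ / (2 * d) := min_le_right _ _
    have hle : ∀ x : ℝ, 0 < x → x / (2 * d) ≤ x := fun x hx => div_le_self hx.le (by linarith)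
    have hrr : ∀ ρ : ℝ, ρ ≤ 2 * κ * rad J₁ → ρ ≤ 2 * κ * rad J₂ → ρ ≤ 4 * κ * d * r := by
      intro ρ h1 h2
      rw [hr, mul_min_of_nonneg _ _ (by positivity), le_min_iff]
      constructor
      · rw [show 4 * κ * d * (rad J₁ / (2 * d)) = 2 * κ * rad J₁ by field_simp; ring]
        exact h1
      · rw [show 4 * κ * d * (rad J₂ / (2 * d)) = 2 * κ * rad J₂ by field_simp; ring]
        exact h2
    have hself : ∀ x : ℝ, 0 < x → x ≤ 2 * κ * x := fun x hx =>
      le_mul_of_one_le_left hx.le (by linarith)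
    have c₁₁ : rad J₁ ≤ 2 * κ * rad K₁ := rJ₁.le_of_face_eq hd hJ₁a rK₁ hff₁
    have c₂₂ : rad J₂ ≤ 2 * κ * rad K₂ := rJ₂.le_of_face_eq hd hJ₂a rK₂ hf₂
    have c₂₂' : rad K₂ ≤ 2 * κ * rad J₂ := rK₂.le_of_face_eq hd hK₂a rJ₂ hf₂.symm
    have c₂₁ : rad J₂ ≤ 2 * κ * rad K₁ := rJ₂.le_of_face_eq hd hJ₂a rK₁ hff₂
    have c₃ : rad J₁ ≤ 2 * κ * rad J₂ := rJ₁.le_of_face_eq hd hJ₁a rJ₂ (hff₁.trans hff₂.symm)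
    have c₄ : rad J₂ ≤ 2 * κ * rad J₁ := rJ₂.le_of_face_eq hd hJ₂a rJ₁ (hff₂.trans hff₁.symm)
    set e := J₁.faceCenter j₁ with he
    have heF : e ∈ J₁.face j₁ := faceCenter_mem_face hJ₁a j₁
    have he₁ : e ∈ J₁.carrier := face_subset_carrier j₁ heF
    have he₂ : e ∈ J₂.carrier := face_subset_carrier j₂ (hff₂.trans hff₁.symm ▸ heF)
    have hball : Metric.ball e r ⊆ minimalPair T₀ (K₁.face i₁) :=
      Metric.ball_subset_closedBall.trans
        ((closedBall_faceCenter_subset hJ₁a hJ₂a rJ₁ rJ₂ (hff₁.trans hff₂.symm)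
          (hdis.mono (interior_mono hsub₁) (interior_mono hsub₂)) hr₁ hr₂).trans
          (Set.union_subset hω₁ hω₂))
    have hD := hFE.isH1_sub hT₀ hu (convex_ball e r) Metric.isOpen_ball (hball.trans hωU)
    have hI₁ := hFE.isH1_sub hT₀ hu convex_carrier.interior isOpen_interior
      (interior_subset.trans (hω₁.trans hωU))
    have hI₂ := hFE.isH1_sub hT₀ hu convex_carrier.interior isOpen_interior
      (interior_subset.trans (hω₂.trans hωU))
    have e₁ := hH1 J₁ K₁ _ _ e _ _ r rJ₁ sJ₁ rK₁ sK₁ hsub₁ c₁₁ c₁ he₁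
      (hr₁.trans (hle _ pJ₁)) (hrr _ (hself _ pJ₁) c₃) u p₁ P q₁ G hp₁.isPoly hq₁ hPq₁ hp₁.isH1
      hI₁ hD hp₁.mean z hz₁
    have e₂ := hH1 J₂ K₂ _ _ e _ _ r rJ₂ sJ₂ rK₂ sK₂ hsub₂ c₂₂ c₂₂' he₂
      (hr₂.trans (hle _ pJ₂)) (hrr _ c₄ (hself _ pJ₂)) u p₂ P q₂ G hp₂.isPoly hq₂ hPq₂ hp₂.isH1
      hI₂ hD hp₂.mean z hz₂
    rw [restrict_interior_carrier K₁] at e₁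
    rw [restrict_interior_carrier K₂] at e₂
    have mono : ∀ S ⊆ minimalPair T₀ (K₁.face i₁), ∫ x in S, ‖G x - gradient P x‖ ^ 2
        ≤ ∫ x in minimalPair T₀ (K₁.face i₁), ‖G x - gradient P x‖ ^ 2 := fun S hS =>
      setIntegral_mono_set (iP'.mono_set hωU) (Filter.Eventually.of_forall fun x => sq_nonneg _)
        hS.eventuallyLE
    have b₁ := mono _ (interior_subset.trans hω₁)
    have b₂ := mono _ (interior_subset.trans hω₂)
    have b₃ := mono _ hball
    set A₁ := ∫ x in K₁.carrier, ‖G x - gradient p₁ x‖ ^ 2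
    set A₂ := ∫ x in K₂.carrier, ‖G x - gradient p₂ x‖ ^ 2
    set B := ∫ x in minimalPair T₀ (K₁.face i₁), ‖G x - gradient P x‖ ^ 2
    set β := bumpMean e (r / 2) fun x => u x - P x
    have hA₁ : 0 ≤ A₁ := integral_nonneg fun x => sq_nonneg _
    have hA₂ : 0 ≤ A₂ := integral_nonneg fun x => sq_nonneg _
    have hB : 0 ≤ B := integral_nonneg fun x => sq_nonneg _
    have s₁ := scale _ _ c₁ (sq_nonneg (p₁ z - P z - β))
    have s₂ := scale _ _ c₂ (sq_nonneg (p₂ z - P z - β))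
    have key := combine_grad_bounds hM0 hC₂ (by positivity) s₁ s₂ e₁ e₂ b₁ b₂ b₃ hA₁ hA₂ hB
      pJ₁ pJ₂ c₁₁ c₂₁
    rw [sub_sub_sub_cancel_right] at key
    refine key.trans (mul_le_mul_of_nonneg_right (le_add_of_nonneg_left ?_) (by positivity))
    positivity

end FE

/-! ### Nodal values along chains of elements -/

/-- A telescoping estimate along a chain with comparable weights. -/
theorem chain_estimate {n N : ℕ} (hn : n ≤ N) {f W X : Fin (n + 1) → ℝ} {M : ℝ} (hM : 1 ≤ M)
    (hW : ∀ j, 0 ≤ W j) (hX : ∀ j, 0 ≤ X j)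
    (hWM : ∀ j : Fin n, W j.castSucc ≤ M * W j.succ)
    (hjump : ∀ j : Fin n,
      W j.castSucc * (f j.castSucc - f j.succ) ^ 2 ≤ X j.castSucc + X j.succ) :
    W 0 * (f 0 - f (Fin.last n)) ^ 2 ≤ 2 * N * M ^ N * ∑ j, X j := by
  have htel : f 0 - f (Fin.last n) = ∑ j : Fin n, (f j.castSucc - f j.succ) := by
    have h1 := Fin.sum_univ_succ f
    have h2 := Fin.sum_univ_castSucc f
    rw [Finset.sum_sub_distrib]
    linarith
  have hW0 : ∀ j : Fin (n + 1), W 0 ≤ M ^ (j : ℕ) * W j := by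
    intro j
    induction j using Fin.induction with
    | zero => simp
    | succ j ih =>
      calc W 0 ≤ M ^ (j : ℕ) * W j.castSucc := ih
        _ ≤ M ^ (j : ℕ) * (M * W j.succ) := by gcongr; exact hWM j
        _ = _ := by rw [Fin.val_succ, pow_succ]; ring
  have hMN : ∀ j : Fin (n + 1), W 0 ≤ M ^ N * W j := fun j =>
    (hW0 j).trans (mul_le_mul_of_nonneg_right
      (pow_le_pow_right₀ hM ((Nat.lt_succ_iff.1 j.2).trans hn)) (hW j))
  have hcs := sq_sum_le_card_mul_sum_sq (s := (Finset.univ : Finset (Fin n)))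
    (f := fun j => f j.castSucc - f j.succ)
  rw [← htel, Finset.card_univ, Fintype.card_fin] at hcs
  have hterm : ∀ j : Fin n,
      W 0 * (f j.castSucc - f j.succ) ^ 2 ≤ M ^ N * (X j.castSucc + X j.succ) := by
    intro j
    calc _ ≤ M ^ N * W j.castSucc * (f j.castSucc - f j.succ) ^ 2 :=
          mul_le_mul_of_nonneg_right (hMN _) (sq_nonneg _)
      _ = M ^ N * (W j.castSucc * (f j.castSucc - f j.succ) ^ 2) := by ring
      _ ≤ _ := mul_le_mul_of_nonneg_left (hjump j) (by positivity)
  have hS : 0 ≤ ∑ j, X j := Finset.sum_nonneg fun j _ => hX j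
  have hsum : ∑ j : Fin n, (X j.castSucc + X j.succ) ≤ 2 * ∑ j, X j := by
    have h1 := Fin.sum_univ_succ X
    have h2 := Fin.sum_univ_castSucc X
    have h3 := hX 0
    have h4 := hX (Fin.last n)
    rw [Finset.sum_add_distrib]
    linarith
  calc _ ≤ W 0 * (n * ∑ j : Fin n, (f j.castSucc - f j.succ) ^ 2) :=
        mul_le_mul_of_nonneg_left hcs (hW 0)
    _ = n * ∑ j : Fin n, W 0 * (f j.castSucc - f j.succ) ^ 2 := by
        rw [← Finset.mul_sum]; ring
    _ ≤ n * ∑ j : Fin n, M ^ N * (X j.castSucc + X j.succ) :=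
        mul_le_mul_of_nonneg_left (Finset.sum_le_sum fun j _ => hterm j) n.cast_nonneg
    _ = n * (M ^ N * ∑ j : Fin n, (X j.castSucc + X j.succ)) := by rw [← Finset.mul_sum]
    _ ≤ N * (M ^ N * (2 * ∑ j, X j)) := by
        refine mul_le_mul (by exact_mod_cast hn) (mul_le_mul_of_nonneg_left hsum (by positivity))
          (mul_nonneg (by positivity) (Finset.sum_nonneg fun j _ => add_nonneg (hX _) (hX _)))
          N.cast_nonneg
    _ = _ := by ring

section Sums

open scoped Classical

variable {T₀ : Finset (TaggedSimplex d)} {κ : ℝ}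
  {cen : TaggedSimplex d → Pt d} {rad : TaggedSimplex d → ℝ}
  (hreg : RegularFamily T₀ κ cen rad) {T : Finset (TaggedSimplex d)}
  (hT : T ∈ conformingRefinements T₀)

include hreg hT

theorem card_filter_mem_le (z : Pt d) :
    ((T.filter fun K => z ∈ K.carrier).card : ℝ) ≤ (κ + 1) ^ d :=
  card_filter_mem_carrier_le hreg.one_le
    (fun K hK => ⟨_, _, hreg.isRegular K (isNode_of_mem_conformingRefinements hT hK)⟩)
    (fun _ hK _ hK' hne => hT.1.disjoint_interior hK hK' hne) z

/-- Finite overlap: summing over all elements the contributions of the elements having a vertex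
in common with them counts each element boundedly often. -/
theorem sum_sum_touching_le {X : TaggedSimplex d → ℝ} (hX : ∀ K ∈ T, 0 ≤ X K) :
    ∑ K ∈ T, ∑ K' ∈ T.filter (fun K' => ∃ j, K'.vert j ∈ K.carrier), X K'
      ≤ (d + 1) * (κ + 1) ^ d * ∑ K ∈ T, X K := by
  simp only [Finset.sum_filter]
  rw [Finset.sum_comm, Finset.mul_sum]
  refine Finset.sum_le_sum fun K' hK' => ?_
  rw [← Finset.sum_filter, Finset.sum_const, nsmul_eq_mul]
  refine mul_le_mul_of_nonneg_right ?_ (hX K' hK')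
  have hsub : (T.filter fun K => ∃ j, K'.vert j ∈ K.carrier)
      ⊆ Finset.univ.biUnion fun j => T.filter fun K => K'.vert j ∈ K.carrier := by
    intro K hK
    obtain ⟨hK, j, hj⟩ := Finset.mem_filter.1 hK
    exact Finset.mem_biUnion.2 ⟨j, Finset.mem_univ j, Finset.mem_filter.2 ⟨hK, hj⟩⟩
  calc _ ≤ ((Finset.univ.biUnion fun j => T.filter fun K => K'.vert j ∈ K.carrier).card : ℝ) := by
        exact_mod_cast Finset.card_le_card hsub
    _ ≤ ∑ j : Fin (d + 1), ((T.filter fun K => K'.vert j ∈ K.carrier).card : ℝ) := by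
        exact_mod_cast Finset.card_biUnion_le
    _ ≤ ∑ j : Fin (d + 1), (κ + 1) ^ d :=
        Finset.sum_le_sum fun j _ => card_filter_mem_le hreg hT _
    _ = _ := by simp

omit hreg in
/-- Elements with a common point have a common vertex. -/
theorem exists_vert_mem_of_mem {K K' : TaggedSimplex d} (hK : K ∈ T) (hK' : K' ∈ T) {z : Pt d}
    (hz : z ∈ K.carrier) (hz' : z ∈ K'.carrier) : ∃ j, K'.vert j ∈ K.carrier := by
  have hmem : z ∈ convexHull ℝ (K.vertices ∩ K'.vertices) := by
    rw [← hT.1.inter K hK K' hK']; exact ⟨hz, hz'⟩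
  obtain ⟨x, hx, j, rfl⟩ := convexHull_nonempty_iff.1 ⟨z, hmem⟩
  exact ⟨j, subset_convexHull ℝ _ hx⟩

/-- The nodal values of the interpolant that takes at each node the value of one of the local
approximations differ from those of all other ones by the jumps across faces. -/
theorem sum_nodal_le {ℓ : ℕ} (hℓ : 1 ≤ ℓ) (hfc : FaceConnected ℓ T)
    {p : TaggedSimplex d → Pt d → ℝ} {sel : Pt d → TaggedSimplex d}
    (hsel : ∀ K ∈ T, ∀ z ∈ K.carrier, sel z ∈ T ∧ z ∈ (sel z).carrier)
    {W X : TaggedSimplex d → ℝ} {M : ℝ} (hM : 1 ≤ M) (hW : ∀ K ∈ T, 0 ≤ W K)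
    (hX : ∀ K ∈ T, 0 ≤ X K)
    (hjump : ∀ K ∈ T, ∀ K' ∈ T, K ≠ K' → ∀ i i', K.face i = K'.face i' → W K ≤ M * W K' ∧
      ∀ z ∈ K.face i, W K * (p K z - p K' z) ^ 2 ≤ X K + X K')
    {N : ℕ} (hN : (κ + 1) ^ d ≤ N) :
    ∑ K ∈ T, W K * ∑ a ∈ nodeIndex d ℓ, (p (sel (node ℓ K a)) (node ℓ K a) - p K (node ℓ K a)) ^ 2
      ≤ (2 * N * M ^ N * (nodeIndex d ℓ).card * ((d + 1) * (κ + 1) ^ d)) * ∑ K ∈ T, X K := by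
  have hnode : ∀ K ∈ T, ∀ a ∈ nodeIndex d ℓ,
      W K * (p (sel (node ℓ K a)) (node ℓ K a) - p K (node ℓ K a)) ^ 2
        ≤ 2 * N * M ^ N * ∑ K' ∈ T.filter (fun K' => ∃ j, K'.vert j ∈ K.carrier), X K' := by
    intro K hK a ha
    set z := node ℓ K a with hz
    have hzK : z ∈ K.carrier := node_mem_carrier hℓ ha
    obtain ⟨hs, hzs⟩ := hsel K hK z hzK
    obtain ⟨n, path, hinj, hpT, h0, hl, hstep⟩ := hfc z ⟨K, hK, a, mem_nodeIndex.1 ha, rfl⟩ K hK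
      (sel z) hs hzK hzs
    have hzp : ∀ j, z ∈ (path j).carrier := by
      intro j
      induction j using Fin.lastCases with
      | last => rw [hl]; exact hzs
      | cast j =>
        obtain ⟨i, i', -, -, h⟩ := hstep j
        exact face_subset_carrier i h
    have hsubset : Finset.univ.image path ⊆ T.filter fun K => z ∈ K.carrier := by
      intro K' hK'
      obtain ⟨j, -, rfl⟩ := Finset.mem_image.1 hK'
      exact Finset.mem_filter.2 ⟨hpT j, hzp j⟩
    have hcard : n ≤ N := by
      have h1 := Finset.card_le_card hsubset
      rw [Finset.card_image_of_injective _ hinj, Finset.card_univ, Fintype.card_fin] at h1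
      have h2 := (card_filter_mem_le hreg hT z).trans hN
      have h3 := Nat.cast_le.1 h2
      omega
    have key := chain_estimate hcard (f := fun j => p (path j) z) (W := fun j => W (path j))
      (X := fun j => X (path j)) hM (fun j => hW _ (hpT j)) (fun j => hX _ (hpT j)) (fun j => by
        obtain ⟨i, i', -, hf, -⟩ := hstep j
        exact (hjump _ (hpT _) _ (hpT _) (fun h => Fin.castSucc_lt_succ.ne (hinj h)) i i' hf).1)
      (fun j => by
        obtain ⟨i, i', -, hf, hzf⟩ := hstep j
        exact (hjump _ (hpT _) _ (hpT _) (fun h => Fin.castSucc_lt_succ.ne (hinj h)) i i' hf).2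
          z hzf)
    simp only [h0, hl] at key
    have hsum : ∑ j, X (path j)
        ≤ ∑ K' ∈ T.filter (fun K' => ∃ j, K'.vert j ∈ K.carrier), X K' := by
      rw [← Finset.sum_image (f := X) (fun x _ y _ h => hinj h)]
      refine Finset.sum_le_sum_of_subset_of_nonneg (fun K' hK' => ?_)
        fun K' hK' _ => hX K' (Finset.mem_filter.1 hK').1
      obtain ⟨hK', hzK'⟩ := Finset.mem_filter.1 (hsubset hK')
      exact Finset.mem_filter.2 ⟨hK', exists_vert_mem_of_mem hT hK hK' hzK hzK'⟩
    rw [sub_sq_comm]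
    exact key.trans (mul_le_mul_of_nonneg_left hsum (by positivity))
  calc _ ≤ ∑ K ∈ T, (nodeIndex d ℓ).card * (2 * N * M ^ N *
          ∑ K' ∈ T.filter (fun K' => ∃ j, K'.vert j ∈ K.carrier), X K') := by
        refine Finset.sum_le_sum fun K hK => ?_
        rw [Finset.mul_sum, ← nsmul_eq_mul]
        exact Finset.sum_le_card_nsmul _ _ _ (hnode K hK)
    _ = 2 * N * M ^ N * (nodeIndex d ℓ).card * ∑ K ∈ T,
          ∑ K' ∈ T.filter (fun K' => ∃ j, K'.vert j ∈ K.carrier), X K' := by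
        rw [Finset.mul_sum]
        exact Finset.sum_congr rfl fun K _ => by ring
    _ ≤ 2 * N * M ^ N * (nodeIndex d ℓ).card * ((d + 1) * (κ + 1) ^ d * ∑ K ∈ T, X K) :=
        mul_le_mul_of_nonneg_left (sum_sum_touching_le hreg hT hX) (by positivity)
    _ = _ := by ring

end Sums

/-- A polynomial and its gradient are controlled by the values at the Lagrange nodes. -/
theorem exists_integral_le_nodal (d ℓ : ℕ) (hℓ : 1 ≤ ℓ) {κ : ℝ} (hκ : 0 ≤ κ) : ∃ C, 0 < C ∧
    ∀ (K : TaggedSimplex d) (c : Pt d) (ρ : ℝ), AffineIndependent ℝ K.vert → IsRegular κ c ρ K →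
    ∀ q, IsPoly ℓ q →
    ∫ x in K.carrier, q x ^ 2 ≤ C * (ρ ^ d * ∑ a ∈ nodeIndex d ℓ, q (node ℓ K a) ^ 2) ∧
    ∫ x in K.carrier, ‖gradient q x‖ ^ 2
      ≤ C * (ρ ^ d / ρ ^ 2 * ∑ a ∈ nodeIndex d ℓ, q (node ℓ K a) ^ 2) := by
  obtain ⟨C₁, hC₁, hpoly⟩ := exists_poly_bound_scaled d ℓ κ
  set V := volume.real (Metric.closedBall (0 : Pt d) 1) with hV
  set n : ℝ := ((nodeIndex d ℓ).card : ℝ) with hn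
  set L : ℝ := n * ((ℓ : ℝ) ^ ℓ) ^ 2 with hL
  have hV0 : 0 ≤ V := measureReal_nonneg
  have hL0 : 0 ≤ L := by positivity
  refine ⟨1 + κ ^ d * V * L + κ ^ d * V * (C₁ * (κ ^ d * V * L)), by positivity, ?_⟩
  intro K c ρ hK hr q hq
  have hρ := hr.pos
  set S := ∑ a ∈ nodeIndex d ℓ, q (node ℓ K a) ^ 2 with hS
  have hS0 : 0 ≤ S := Finset.sum_nonneg fun _ _ => sq_nonneg _
  have hvol := volume_real_carrier_le hκ hr
  rw [← hV, mul_pow] at hvol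
  have hpt : ∀ x ∈ K.carrier, q x ^ 2 ≤ L * S := by
    intro x hx
    rw [hq.eq_sum_lagrangeBasis hK hℓ x]
    refine (sq_sum_le_card_mul_sum_sq (s := nodeIndex d ℓ)
      (f := fun a => q (node ℓ K a) * lagrangeBasis hK ℓ a x)).trans ?_
    rw [hL, mul_assoc]
    refine mul_le_mul_of_nonneg_left ?_ (Nat.cast_nonneg _)
    rw [hS, Finset.mul_sum]
    refine Finset.sum_le_sum fun a ha => ?_
    rw [mul_pow, mul_comm]
    refine mul_le_mul_of_nonneg_right ?_ (sq_nonneg _)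
    rw [← sq_abs]
    exact pow_le_pow_left₀ (abs_nonneg _) (abs_lagrangeBasis_le hK ha hx) 2
  have hint : ∀ f : Pt d → ℝ, Continuous f → ∀ B : ℝ, (∀ x ∈ K.carrier, f x ≤ B) →
      0 ≤ B → ∫ x in K.carrier, f x ≤ κ ^ d * ρ ^ d * V * B := by
    intro f hf B hB hB0
    have : IsFiniteMeasure (volume.restrict K.carrier) :=
      isFiniteMeasure_restrict.2 isCompact_carrier.measure_lt_top.ne
    calc _ ≤ ∫ x in K.carrier, B :=
          setIntegral_mono_on (hf.continuousOn.integrableOn_compact isCompact_carrier)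
            (integrable_const _) isClosed_carrier.measurableSet hB
      _ = volume.real K.carrier * B := by rw [setIntegral_const, smul_eq_mul]
      _ ≤ _ := mul_le_mul_of_nonneg_right hvol hB0
  have h1 := hint _ (hq.contDiff.continuous.pow 2) (L * S) hpt (by positivity)
  have hball : ∫ x in Metric.closedBall c ρ, q x ^ 2 ≤ κ ^ d * ρ ^ d * V * (L * S) :=
    (setIntegral_mono_set ((hq.contDiff.continuous.pow 2).continuousOn.integrableOn_compact
      isCompact_carrier) (Filter.Eventually.of_forall fun x => sq_nonneg _)
      hr.ball_subset.eventuallyLE).trans h1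
  have hgrad : ∀ x ∈ K.carrier, ‖gradient q x‖ ^ 2 ≤ C₁ * (κ ^ d * V * (L * S)) / ρ ^ 2 := by
    intro x hx
    have h2 := (hpoly q hq c ρ hρ x (hr.subset_ball hx)).2.1
    rw [le_div_iff₀ (by positivity)]
    have h3 : ρ ^ d * (ρ ^ 2 * ‖gradient q x‖ ^ 2) ≤ ρ ^ d * (C₁ * (κ ^ d * V * (L * S))) := by
      calc _ ≤ _ := h2
        _ ≤ C₁ * (κ ^ d * ρ ^ d * V * (L * S)) := by gcongr
        _ = _ := by ring
    have := le_of_mul_le_mul_left h3 (by positivity)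
    linarith
  have h2 := hint _ ((continuous_gradient hq.contDiff).norm.pow 2) _ hgrad (by positivity)
  constructor
  · calc _ ≤ _ := h1
      _ = κ ^ d * V * L * (ρ ^ d * S) := by ring
      _ ≤ _ := by
        refine mul_le_mul_of_nonneg_right ?_ (by positivity)
        have : 0 ≤ κ ^ d * V * (C₁ * (κ ^ d * V * L)) := by positivity
        linarith
  · calc _ ≤ _ := h2
      _ = κ ^ d * V * (C₁ * (κ ^ d * V * L)) * (ρ ^ d / ρ ^ 2 * S) := by ring
      _ ≤ _ := by
        refine mul_le_mul_of_nonneg_right ?_ (by positivity)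
        have : 0 ≤ κ ^ d * V * L := by positivity
        linarith

theorem setIntegral_meshUnion {T : Finset (TaggedSimplex d)} (hT : IsConforming T) {f : Pt d → ℝ}
    (hf : IntegrableOn f (meshUnion T)) :
    ∫ x in meshUnion T, f x = ∑ K ∈ T, ∫ x in K.carrier, f x := by
  have hsub : (⋃ K ∈ T, interior K.carrier) ⊆ meshUnion T :=
    Set.iUnion₂_mono fun K _ => interior_subset
  have hres : (volume : Measure (Pt d)).restrict (meshUnion T)
      = volume.restrict (⋃ K ∈ T, interior K.carrier) := by
    refine Measure.restrict_congr_set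
      (Filter.EventuallyLE.antisymm ?_ (LE.le.eventuallyLE hsub))
    have := ae_restrict_meshUnion (T := T) (p := fun x => x ∈ ⋃ K ∈ T, interior K.carrier)
      fun K hK => by
        filter_upwards [ae_mem_interior_carrier K] with x hx
        exact Set.mem_biUnion hK hx
    rwa [ae_restrict_iff' (isClosed_meshUnion T).measurableSet] at this
  rw [hres, integral_biUnion_finset T (fun K _ => isOpen_interior.measurableSet)
    (fun K hK K' hK' hne => hT.disjoint_interior hK hK' hne)
    (fun K hK => hf.mono_set (interior_subset.trans (subset_meshUnion hK)))]
  exact Finset.sum_congr rfl fun K _ => by rw [restrict_interior_carrier]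

/-! ### The upper bound -/

theorem setIntegral_norm_sub_sq_le {F : Type*} [NormedAddCommGroup F] {S : Set (Pt d)}
    {A B D : Pt d → F} (hAB : IntegrableOn (fun x => ‖A x - B x‖ ^ 2) S)
    (hAD : IntegrableOn (fun x => ‖A x - D x‖ ^ 2) S)
    (hBD : IntegrableOn (fun x => ‖B x - D x‖ ^ 2) S) :
    ∫ x in S, ‖A x - B x‖ ^ 2
      ≤ 2 * (∫ x in S, ‖A x - D x‖ ^ 2) + 2 * ∫ x in S, ‖B x - D x‖ ^ 2 := by
  rw [← integral_const_mul, ← integral_const_mul,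
    ← integral_add (hAD.const_mul 2) (hBD.const_mul 2)]
  refine setIntegral_mono hAB ((hAD.const_mul 2).add (hBD.const_mul 2)) fun x => ?_
  have h1 : ‖A x - B x‖ ≤ ‖A x - D x‖ + ‖B x - D x‖ := by
    rw [← sub_sub_sub_cancel_right (A x) (B x) (D x)]
    exact norm_sub_le _ _
  have h2 := pow_le_pow_left₀ (norm_nonneg _) h1 2
  simp only
  nlinarith [sq_nonneg (‖A x - D x‖ - ‖B x - D x‖)]

theorem carrier_subset_minimalPair_one (hd : 2 ≤ d) {T₀ : Finset (TaggedSimplex d)}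
    (hT₀ : IsConforming T₀) {K : TaggedSimplex d} (hK : IsNode T₀ K) :
    K.carrier ⊆ minimalPair T₀ (K.face 1) :=
  carrier_subset_minimalPair hT₀ hK (one_ne_zero_fin hd) (one_ne_last hd)

/-- A choice of one element containing `z` for each point `z` of the mesh. -/
theorem exists_selection (hd : 2 ≤ d) (T : Finset (TaggedSimplex d)) :
    ∃ sel : Pt d → TaggedSimplex d, ∀ K ∈ T, ∀ z ∈ K.carrier, sel z ∈ T ∧ z ∈ (sel z).carrier := by
  classical
  refine ⟨fun z => if h : ∃ K ∈ T, z ∈ K.carrier then h.choose else ⟨fun _ => 0, ⟨0, by omega⟩⟩,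
    fun K hK z hz => ?_⟩
  have h : ∃ K ∈ T, z ∈ K.carrier := ⟨K, hK, hz⟩
  simp only [dif_pos h]
  exact h.choose_spec

/-- The quasi-interpolant assembled from given approximations in the local spaces of all faces:
its error is bounded by their errors, for the function and the gradient separately. -/
theorem exists_quasiInterpolant (hd : 2 ≤ d) {ℓ : ℕ} (hℓ : 1 ≤ ℓ) {T₀ : Finset (TaggedSimplex d)}
    (hT₀ : IsConforming T₀) : ∃ C, 0 < C ∧
    ∀ (u : Pt d → ℝ) (G : Pt d → Pt d), IsH1 (meshDomain T₀) u G →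
    ∀ T ∈ conformingRefinements T₀, FaceConnected ℓ T → ∀ P : Set (Pt d) → Pt d → ℝ,
    (∀ K ∈ T, ∀ i, P (K.face i) ∈ localSpace ℓ T₀ (K.face i)) →
    ∃ v ∈ feSpace ℓ T,
      ∫ x in meshUnion T₀, (u x - v x) ^ 2
        ≤ C * ∑ K ∈ T, ∑ i, ∫ x in minimalPair T₀ (K.face i), (u x - P (K.face i) x) ^ 2 ∧
      ∫ x in meshUnion T₀, ‖G x - gradient v x‖ ^ 2
        ≤ C * ∑ K ∈ T, ∑ i, ∫ x in minimalPair T₀ (K.face i),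
          ‖G x - gradient (P (K.face i)) x‖ ^ 2 := by
  obtain ⟨κ, cen, rad, hreg⟩ := exists_regularFamily hT₀
  have hκ := hreg.one_le
  have hκ0 : 0 ≤ κ := by linarith
  obtain ⟨C₁, hC₁, hnorm⟩ := exists_isLocalApprox d hκ0
  obtain ⟨C₂, hC₂, hjump⟩ := exists_jump_le hd hT₀ hreg ℓ
  obtain ⟨C₃, hC₃, hnodal⟩ := exists_integral_le_nodal d ℓ hℓ hκ0
  obtain ⟨N, hN⟩ := exists_nat_ge ((κ + 1) ^ d)
  -- the nodal weights `ρ ^ d` and `ρ ^ (d - 2)` of adjacent elements differ at most by the factor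
  -- `M`; the second one is written as a quotient
  set M := (2 * κ) ^ (d + 2) with hM
  have hM1 : 1 ≤ M := one_le_pow₀ (by linarith)
  set C₄ := 2 * N * M ^ N * (nodeIndex d ℓ).card * ((d + 1) * (κ + 1) ^ d) with hC₄
  have hC₄0 : 0 ≤ C₄ := by positivity
  -- the `L²` normalization constant `C₁` may be below the factor `1` of the gradient part
  set C₅ := C₁ + 1 with hC₅
  refine ⟨2 * C₅ + 2 * (C₃ * (C₄ * (C₂ * (C₅ + 1)))), by positivity, ?_⟩
  intro u G hu T hT hfc P hP
  have hnode := fun K (hK : K ∈ T) => isNode_of_mem_conformingRefinements hT hK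
  have hKU : ∀ K ∈ T, K.carrier ⊆ meshUnion T₀ := fun K hK => by
    rw [← meshUnion_of_mem_conformingRefinements hT₀ hT]
    exact subset_meshUnion hK
  set a : TaggedSimplex d → ℝ := fun K =>
    ∑ i, ∫ x in minimalPair T₀ (K.face i), (u x - P (K.face i) x) ^ 2 with ha
  set b : TaggedSimplex d → ℝ := fun K =>
    ∑ i, ∫ x in minimalPair T₀ (K.face i), ‖G x - gradient (P (K.face i)) x‖ ^ 2 with hb
  have hai : ∀ K i, ∫ x in minimalPair T₀ (K.face i), (u x - P (K.face i) x) ^ 2 ≤ a K :=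
    fun K i => Finset.single_le_sum
      (f := fun i => ∫ x in minimalPair T₀ (K.face i), (u x - P (K.face i) x) ^ 2)
      (fun i _ => integral_nonneg fun x => sq_nonneg _) (Finset.mem_univ i)
  have hbi : ∀ K i, ∫ x in minimalPair T₀ (K.face i), ‖G x - gradient (P (K.face i)) x‖ ^ 2
      ≤ b K := fun K i => Finset.single_le_sum
      (f := fun i => ∫ x in minimalPair T₀ (K.face i), ‖G x - gradient (P (K.face i)) x‖ ^ 2)
      (fun i _ => integral_nonneg fun x => sq_nonneg _) (Finset.mem_univ i)
  have ha0 : ∀ K, 0 ≤ a K := fun K => (integral_nonneg fun x => sq_nonneg _).trans (hai K 0)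
  have hb0 : ∀ K, 0 ≤ b K := fun K => (integral_nonneg fun x => sq_nonneg _).trans (hbi K 0)
  -- the face opposite to the vertex `1` contains the refinement edge of `K`, so its minimal pair
  -- contains `K`
  have hloc : ∀ K ∈ T, ∃ p, IsLocalApprox ℓ u G (cen K) (rad K) K p ∧
      ∫ x in K.carrier, (u x - p x) ^ 2 ≤ C₅ * a K ∧
      ∫ x in K.carrier, ‖G x - gradient p x‖ ^ 2 ≤ C₅ * b K := by
    intro K hK
    have hN := hnode K hK
    have hPK := hP K hK 1
    have hFE := isFE_of_mem_localSpace hPK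
    have hω := carrier_subset_minimalPair_one hd hT₀ hN
    have hωU := minimalPair_subset_meshUnion hT₀ hPK
    obtain ⟨q, hq, hPq⟩ := exists_isPoly_of_mem_localSpace hT₀ hN (one_ne_zero_fin hd)
      (one_ne_last hd) hPK
    obtain ⟨p, hp, h1, h2⟩ := hnorm ℓ u G K (cen K) (rad K) (hreg.isRegular K hN)
      (hreg.subset_interior K hN)
      (hu.mono (interior_mono (hKU K hK)) isOpen_interior.measurableSet) q hq
    have e1 : ∫ x in K.carrier, (u x - q x) ^ 2 ≤ a K := by
      refine le_trans ?_ (hai K 1)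
      rw [setIntegral_congr_fun (g := fun x => (u x - P (K.face 1) x) ^ 2)
        isClosed_carrier.measurableSet fun x hx => by simp only [hPq hx]]
      exact setIntegral_mono_set ((hFE.integrableOn_sq hT₀ hu).mono_set hωU)
        (Filter.Eventually.of_forall fun x => sq_nonneg _) hω.eventuallyLE
    have e2 : ∫ x in K.carrier, ‖G x - gradient q x‖ ^ 2 ≤ b K := by
      refine le_trans ?_ (hbi K 1)
      rw [← restrict_interior_carrier,
        setIntegral_congr_fun (g := fun x => ‖G x - gradient (P (K.face 1)) x‖ ^ 2)
        isOpen_interior.measurableSet fun x hx => by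
          simp only [gradient_eq_of_mem_interior hPq hx]]
      exact setIntegral_mono_set ((hFE.integrableOn_norm_sq hT₀ hu).mono_set hωU)
        (Filter.Eventually.of_forall fun x => sq_nonneg _)
        (interior_subset.trans hω).eventuallyLE
    refine ⟨p, hp, h1.trans ?_, h2.le.trans (e2.trans ?_)⟩
    · exact mul_le_mul (by linarith) e1 (integral_nonneg fun x => sq_nonneg _) (by positivity)
    · exact le_mul_of_one_le_left (hb0 K) (by linarith)
  choose! p hp hpa hpb using hloc
  obtain ⟨sel, hsel⟩ := exists_selection hd T
  set w : Pt d → ℝ := fun z => p (sel z) z with hw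
  have hJ : ∀ K ∈ T, ∀ K' ∈ T, K ≠ K' → ∀ i i', K.face i = K'.face i' →
      rad K ≤ 2 * κ * rad K' ∧ rad K' ≤ 2 * κ * rad K ∧ ∀ z ∈ K.face i,
      rad K ^ d * (p K z - p K' z) ^ 2 ≤ C₂ * (C₅ + 1) * a K + C₂ * (C₅ + 1) * a K' ∧
      rad K ^ d / rad K ^ 2 * (p K z - p K' z) ^ 2
        ≤ C₂ * (C₅ + 1) * b K + C₂ * (C₅ + 1) * b K' := by
    intro K hK K' hK' hne i i' hf
    have rK := hreg.isRegular K (hnode K hK)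
    have rK' := hreg.isRegular K' (hnode K' hK')
    have hρ := rK.pos
    refine ⟨rK.le_of_face_eq hd (hT.1.nondegenerate K hK) rK' hf,
      rK'.le_of_face_eq hd (hT.1.nondegenerate K' hK') rK hf.symm, fun z hz => ?_⟩
    obtain ⟨j1, j2⟩ := hjump u G hu K K' (hnode K hK) (hnode K' hK')
      (hT.1.disjoint_interior hK hK' hne) i i' hf _ (hP K hK i) (p K) (p K') (hp K hK) (hp K' hK')
      z hz
    have c1 := ha0 K'
    have c2 := hb0 K'
    constructor
    · calc _ ≤ C₂ * (C₅ * a K + C₅ * a K' + a K) :=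
            j1.trans (mul_le_mul_of_nonneg_left
              (add_le_add (add_le_add (hpa K hK) (hpa K' hK')) (hai K i)) hC₂.le)
        _ ≤ C₂ * (C₅ * a K + C₅ * a K' + a K) + C₂ * a K' := by
            have := mul_nonneg hC₂.le c1
            linarith
        _ = _ := by ring
    · have h1 : rad K ^ d * (p K z - p K' z) ^ 2
          ≤ rad K ^ 2 * (C₂ * (C₅ * b K + C₅ * b K' + b K)) := by
        refine j2.trans ?_
        rw [mul_left_comm]
        exact mul_le_mul_of_nonneg_left (mul_le_mul_of_nonneg_left
              (add_le_add (add_le_add (hpb K hK) (hpb K' hK')) (hbi K i)) hC₂.le) (sq_nonneg _)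
      rw [div_mul_eq_mul_div, div_le_iff₀ (by positivity), mul_comm _ (rad K ^ 2)]
      refine h1.trans (mul_le_mul_of_nonneg_left ?_ (sq_nonneg _))
      have := mul_nonneg hC₂.le c2
      linarith
  have hradpos : ∀ K ∈ T, 0 < rad K := fun K hK => (hreg.isRegular K (hnode K hK)).pos
  have hWle : ∀ K ∈ T, ∀ K' ∈ T, rad K ≤ 2 * κ * rad K' → rad K' ≤ 2 * κ * rad K →
      rad K ^ d ≤ M * rad K' ^ d ∧ rad K ^ d / rad K ^ 2 ≤ M * (rad K' ^ d / rad K' ^ 2) := by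
    intro K hK K' hK' h1 h2
    have hρ := hradpos K hK
    have hρ' := hradpos K' hK'
    have h3 := pow_le_pow_left₀ hρ.le h1 d
    have h4 := pow_le_pow_left₀ hρ'.le h2 2
    rw [mul_pow] at h3 h4
    have hk : 1 ≤ (2 * κ) ^ 2 := one_le_pow₀ (by linarith)
    constructor
    · refine h3.trans (mul_le_mul_of_nonneg_right ?_ (by positivity))
      exact pow_le_pow_right₀ (by linarith) (by omega)
    · rw [div_le_iff₀ (by positivity), hM, pow_add]
      calc _ ≤ _ := h3
        _ = (2 * κ) ^ d * (rad K' ^ d / rad K' ^ 2) * rad K' ^ 2 := by field_simp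
        _ ≤ (2 * κ) ^ d * (rad K' ^ d / rad K' ^ 2) * ((2 * κ) ^ 2 * rad K ^ 2) := by gcongr
        _ = _ := by ring
  have hc0 : 0 ≤ C₂ * (C₅ + 1) := by positivity
  have sum1 := sum_nodal_le hreg hT hℓ hfc (p := p) hsel (W := fun K => rad K ^ d)
    (X := fun K => C₂ * (C₅ + 1) * a K) hM1 (fun K hK => by have := hradpos K hK; positivity)
    (fun K _ => mul_nonneg hc0 (ha0 K)) (fun K hK K' hK' hne i i' hf => by
      obtain ⟨h1, h2, h3⟩ := hJ K hK K' hK' hne i i' hf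
      exact ⟨(hWle K hK K' hK' h1 h2).1, fun z hz => (h3 z hz).1⟩) hN
  have sum2 := sum_nodal_le hreg hT hℓ hfc (p := p) hsel (W := fun K => rad K ^ d / rad K ^ 2)
    (X := fun K => C₂ * (C₅ + 1) * b K) hM1 (fun K hK => by have := hradpos K hK; positivity)
    (fun K _ => mul_nonneg hc0 (hb0 K)) (fun K hK K' hK' hne i i' hf => by
      obtain ⟨h1, h2, h3⟩ := hJ K hK K' hK' hne i i' hf
      exact ⟨(hWle K hK K' hK' h1 h2).2, fun z hz => (h3 z hz).2⟩) hN
  rw [← hC₄, ← Finset.mul_sum] at sum1 sum2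
  set v := interpolant hT.1 ℓ w with hv
  have hvfe : v ∈ feSpace ℓ T := interpolant_mem_feSpace hT.1 ℓ w
  have hvFE : IsFE ℓ T₀ v := ⟨T, hT, hvfe⟩
  have iv := hvFE.integrableOn_sq hT₀ hu
  have iv' := hvFE.integrableOn_norm_sq hT₀ hu
  have hel : ∀ K ∈ T,
      ∫ x in K.carrier, (u x - v x) ^ 2 ≤ 2 * (C₅ * a K) + 2 * (C₃ * (rad K ^ d *
        ∑ α ∈ nodeIndex d ℓ, (p (sel (node ℓ K α)) (node ℓ K α) - p K (node ℓ K α)) ^ 2)) ∧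
      ∫ x in K.carrier, ‖G x - gradient v x‖ ^ 2 ≤ 2 * (C₅ * b K) + 2 * (C₃ *
        (rad K ^ d / rad K ^ 2 *
        ∑ α ∈ nodeIndex d ℓ, (p (sel (node ℓ K α)) (node ℓ K α) - p K (node ℓ K α)) ^ 2)) := by
    intro K hK
    obtain ⟨f, hf, hvf⟩ := exists_isPoly_eq_interpolant hT.1 ℓ w hK
    have hq := hf.sub (hp K hK).isPoly
    obtain ⟨n1, n2⟩ := hnodal K (cen K) (rad K) (hT.1.nondegenerate K hK)
      (hreg.isRegular K (hnode K hK)) _ hq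
    have hval : ∑ α ∈ nodeIndex d ℓ, (f (node ℓ K α) - p K (node ℓ K α)) ^ 2
        = ∑ α ∈ nodeIndex d ℓ,
          (p (sel (node ℓ K α)) (node ℓ K α) - p K (node ℓ K α)) ^ 2 := by
      refine Finset.sum_congr rfl fun α hα => ?_
      rw [← hvf _ (node_mem_carrier hℓ hα), interpolant_node hT.1 hℓ w hK hα]
    rw [hval] at n1 n2
    set S := ∑ α ∈ nodeIndex d ℓ, (p (sel (node ℓ K α)) (node ℓ K α) - p K (node ℓ K α)) ^ 2
    have hcpt : ∀ h : Pt d → ℝ, Continuous h → IntegrableOn h K.carrier := fun h hh =>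
      hh.continuousOn.integrableOn_compact isCompact_carrier
    constructor
    · have e1 : ∫ x in K.carrier, (v x - p K x) ^ 2 = ∫ x in K.carrier, (f x - p K x) ^ 2 :=
        setIntegral_congr_fun isClosed_carrier.measurableSet fun x hx => by simp only [hv, hvf x hx]
      have i1 : IntegrableOn (fun x => (v x - p K x) ^ 2) K.carrier :=
        (hcpt _ (hq.contDiff.continuous.pow 2)).congr_fun
          (fun x hx => by simp only [hv, hvf x hx, Pi.pow_apply]) isClosed_carrier.measurableSet
      have key := setIntegral_norm_sub_sq_le (S := K.carrier) (A := u) (B := v) (D := p K)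
        (by simpa only [Real.norm_eq_abs, sq_abs] using iv.mono_set (hKU K hK))
        (by simpa only [Real.norm_eq_abs, sq_abs] using (hp K hK).integrableOn_sq)
        (by simpa only [Real.norm_eq_abs, sq_abs] using i1)
      simp only [Real.norm_eq_abs, sq_abs] at key
      rw [e1] at key
      have := hpa K hK
      linarith
    · have hg : ∀ x ∈ interior K.carrier,
          gradient v x - gradient (p K) x = gradient (fun x => f x - p K x) x := by
        intro x hx
        rw [gradient_fun_sub hf.differentiableAt (hp K hK).isPoly.differentiableAt,
          gradient_eq_of_mem_interior (f := f) (fun x hx => hvf x hx) hx]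
      have e1 : ∫ x in K.carrier, ‖gradient v x - gradient (p K) x‖ ^ 2
          = ∫ x in K.carrier, ‖gradient (fun x => f x - p K x) x‖ ^ 2 := by
        rw [← restrict_interior_carrier]
        exact setIntegral_congr_fun isOpen_interior.measurableSet fun x hx => by
          simp only [hg x hx]
      have i1 : IntegrableOn (fun x => ‖gradient v x - gradient (p K) x‖ ^ 2) K.carrier := by
        have h1 := (hcpt _ ((continuous_gradient hq.contDiff).norm.pow 2)).mono_set
          (interior_subset (s := K.carrier))
        have h2 := h1.congr_fun (g := fun x => ‖gradient v x - gradient (p K) x‖ ^ 2)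
          (fun x hx => by simp only [hg x hx, Pi.pow_apply]) isOpen_interior.measurableSet
        rwa [IntegrableOn, restrict_interior_carrier] at h2
      have key := setIntegral_norm_sub_sq_le (S := K.carrier) (A := G) (B := gradient v)
        (D := gradient (p K)) (iv'.mono_set (hKU K hK)) (hp K hK).integrableOn_norm_sq i1
      rw [e1] at key
      have := hpb K hK
      linarith
  have hmu := meshUnion_of_mem_conformingRefinements hT₀ hT
  refine ⟨v, hvfe, ?_, ?_⟩
  · rw [← hmu] at iv ⊢
    rw [setIntegral_meshUnion hT.1 iv]
    refine (Finset.sum_le_sum fun K hK => (hel K hK).1).trans ?_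
    rw [Finset.sum_add_distrib, ← Finset.mul_sum, ← Finset.mul_sum, ← Finset.mul_sum,
      ← Finset.mul_sum]
    have := mul_le_mul_of_nonneg_left sum1 hC₃.le
    linarith
  · rw [← hmu] at iv' ⊢
    rw [setIntegral_meshUnion hT.1 iv']
    refine (Finset.sum_le_sum fun K hK => (hel K hK).2).trans ?_
    rw [Finset.sum_add_distrib, ← Finset.mul_sum, ← Finset.mul_sum, ← Finset.mul_sum,
      ← Finset.mul_sum]
    have := mul_le_mul_of_nonneg_left sum2 hC₃.le
    linarith

/-! ### Comparison of the local and the global best errors -/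

theorem rdError_sq {ε : ℝ} (hε : 0 ≤ ε) (W : Set (Pt d)) (u : Pt d → ℝ) (G : Pt d → Pt d)
    (v : Pt d → ℝ) : rdError ε W u G v ^ 2
      = (∫ x in W, (u x - v x) ^ 2) + ε * ∫ x in W, ‖G x - gradient v x‖ ^ 2 := by
  have h1 : 0 ≤ ∫ x in W, (u x - v x) ^ 2 := integral_nonneg fun x => sq_nonneg _
  have h2 : 0 ≤ ∫ x in W, ‖G x - gradient v x‖ ^ 2 := integral_nonneg fun x => sq_nonneg _
  rw [rdError, rdNorm, Real.sq_sqrt (by positivity)]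

theorem rdError_nonneg (ε : ℝ) (W : Set (Pt d)) (u : Pt d → ℝ) (G : Pt d → Pt d)
    (v : Pt d → ℝ) : 0 ≤ rdError ε W u G v := Real.sqrt_nonneg _

theorem bddBelow_rdError (ε : ℝ) (W : Set (Pt d)) (u : Pt d → ℝ) (G : Pt d → Pt d)
    (S : Set (Pt d → ℝ)) : BddBelow (Set.range fun v : S => rdError ε W u G v) :=
  ⟨0, by rintro _ ⟨v, rfl⟩; exact rdError_nonneg _ _ _ _ _⟩

theorem bddBelow_rdError_sq (ε : ℝ) (W : Set (Pt d)) (u : Pt d → ℝ) (G : Pt d → Pt d)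
    (S : Set (Pt d → ℝ)) : BddBelow (Set.range fun v : S => rdError ε W u G v ^ 2) :=
  ⟨0, by rintro _ ⟨v, rfl⟩; exact sq_nonneg _⟩

theorem zero_mem_feSpace (ℓ : ℕ) (T : Finset (TaggedSimplex d)) : (fun _ => 0) ∈ feSpace ℓ T :=
  ⟨continuousOn_const, fun _ _ => ⟨0, by simp, fun x _ => by simp⟩⟩

theorem mem_localSpace_of_mem_feSpace {ℓ : ℕ} {T₀ T : Finset (TaggedSimplex d)}
    (hT : T ∈ conformingRefinements T₀) {K : TaggedSimplex d} (hK : K ∈ T) (i : Fin (d + 1))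
    {v : Pt d → ℝ} (hv : v ∈ feSpace ℓ T) : v ∈ localSpace ℓ T₀ (K.face i) :=
  ⟨T, hT, ⟨K, hK, i, rfl⟩, hv⟩

theorem IsConforming.subset {T T' : Finset (TaggedSimplex d)} (hT : IsConforming T)
    (h : T' ⊆ T) : IsConforming T' :=
  ⟨fun K hK => hT.nondegenerate K (h hK),
    fun K hK K' hK' => hT.vertices_ne K (h hK) K' (h hK'),
    fun K hK K' hK' => hT.inter K (h hK) K' (h hK')⟩

open scoped Classical in
/-- The minimal pairs of all faces of all elements have finite overlap. -/
theorem sum_setIntegral_minimalPair_le (hd : 1 ≤ d) {T₀ : Finset (TaggedSimplex d)} {κ : ℝ}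
    {cen : TaggedSimplex d → Pt d} {rad : TaggedSimplex d → ℝ}
    (hreg : RegularFamily T₀ κ cen rad) {T : Finset (TaggedSimplex d)}
    (hT : T ∈ conformingRefinements T₀) {f : Pt d → ℝ} (hf : IntegrableOn f (meshUnion T))
    (h0 : ∀ x, 0 ≤ f x) :
    ∑ K ∈ T, ∑ i, ∫ x in minimalPair T₀ (K.face i), f x
      ≤ (d + 1) * ((d + 1) * (κ + 1) ^ d) * ∫ x in meshUnion T, f x := by
  have hloc : ∀ K ∈ T, ∀ i : Fin (d + 1), ∫ x in minimalPair T₀ (K.face i), f x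
      ≤ ∑ K' ∈ T.filter (fun K' => ∃ j, K'.vert j ∈ K.carrier), ∫ x in K'.carrier, f x := by
    intro K hK i
    set T' := T.filter (fun K' => ∃ j, K'.vert j ∈ K.carrier) with hT'
    have hsub : T' ⊆ T := Finset.filter_subset _ _
    have hint : IntegrableOn f (meshUnion T') :=
      hf.mono_set (Set.biUnion_subset_biUnion_left hsub)
    rw [← setIntegral_meshUnion (hT.1.subset hsub) hint]
    refine setIntegral_mono_set hint (Filter.Eventually.of_forall h0) ?_
    refine LE.le.eventuallyLE fun x hx => ?_
    obtain ⟨K', hK', ⟨i', hi'⟩, hxK'⟩ :=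
      mem_facePair.1 (minimalPair_subset_facePair hT ⟨K, hK, i, rfl⟩ hx)
    refine subset_meshUnion (Finset.mem_filter.2 ⟨hK', ?_⟩) hxK'
    obtain ⟨j, hj⟩ : ∃ j : Fin (d + 1), j ≠ i' :=
      have : Nontrivial (Fin (d + 1)) := Fin.nontrivial_iff_two_le.2 (by omega)
      exists_ne i'
    exact ⟨j, face_subset_carrier i
      (hi' ▸ (vert_mem_face_iff (hT.1.nondegenerate K' hK') i' j).2 hj)⟩
  calc _ ≤ ∑ K ∈ T, ∑ _i : Fin (d + 1),
        ∑ K' ∈ T.filter (fun K' => ∃ j, K'.vert j ∈ K.carrier), ∫ x in K'.carrier, f x :=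
        Finset.sum_le_sum fun K hK => Finset.sum_le_sum fun i _ => hloc K hK i
    _ = (d + 1) * ∑ K ∈ T, ∑ K' ∈ T.filter (fun K' => ∃ j, K'.vert j ∈ K.carrier),
          ∫ x in K'.carrier, f x := by
        simp only [Finset.sum_const, Finset.card_univ, Fintype.card_fin, nsmul_eq_mul,
          ← Finset.mul_sum]
        push_cast
        ring
    _ ≤ (d + 1) * ((d + 1) * (κ + 1) ^ d * ∑ K ∈ T, ∫ x in K.carrier, f x) :=
        mul_le_mul_of_nonneg_left
          (sum_sum_touching_le hreg hT fun K _ => integral_nonneg h0) (by positivity)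
    _ = _ := by rw [setIntegral_meshUnion hT.1 hf]; ring

/-- The global error of any finite element function dominates the tree error. -/
theorem exists_treeError_le (hd : 1 ≤ d) (ℓ : ℕ) {T₀ : Finset (TaggedSimplex d)}
    (hT₀ : IsConforming T₀) : ∃ C, 0 < C ∧ ∀ ε : ℝ, 0 ≤ ε →
    ∀ (u : Pt d → ℝ) (G : Pt d → Pt d), IsH1 (meshDomain T₀) u G →
    ∀ T ∈ conformingRefinements T₀, ∀ v ∈ feSpace ℓ T,
      ∑ K ∈ T, localError ℓ T₀ ε u G K ≤ C * rdError ε (meshDomain T) u G v ^ 2 := by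
  obtain ⟨κ, cen, rad, hreg⟩ := exists_regularFamily hT₀
  have hκ := hreg.one_le
  refine ⟨(d + 1) * ((d + 1) * (κ + 1) ^ d), by positivity, fun ε hε u G hu T hT v hv => ?_⟩
  have hFE : IsFE ℓ T₀ v := ⟨T, hT, hv⟩
  have i1 := hFE.integrableOn_sq hT₀ hu
  have i2 := hFE.integrableOn_norm_sq hT₀ hu
  rw [← meshUnion_of_mem_conformingRefinements hT₀ hT] at i1 i2
  have s1 := sum_setIntegral_minimalPair_le hd hreg hT i1 fun x => sq_nonneg _
  have s2 := mul_le_mul_of_nonneg_left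
    (sum_setIntegral_minimalPair_le hd hreg hT i2 fun x => sq_nonneg _) hε
  rw [rdError_sq hε, restrict_meshDomain]
  calc _ ≤ ∑ K ∈ T, ∑ i, ((∫ x in minimalPair T₀ (K.face i), (u x - v x) ^ 2)
          + ε * ∫ x in minimalPair T₀ (K.face i), ‖G x - gradient v x‖ ^ 2) := by
        refine Finset.sum_le_sum fun K hK => Finset.sum_le_sum fun i _ => ?_
        rw [← rdError_sq hε]
        exact ciInf_le (bddBelow_rdError_sq ε _ u G _)
          (⟨v, mem_localSpace_of_mem_feSpace hT hK i hv⟩ : localSpace ℓ T₀ (K.face i))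
    _ = (∑ K ∈ T, ∑ i, ∫ x in minimalPair T₀ (K.face i), (u x - v x) ^ 2)
          + ε * ∑ K ∈ T, ∑ i, ∫ x in minimalPair T₀ (K.face i), ‖G x - gradient v x‖ ^ 2 := by
        simp only [Finset.sum_add_distrib, Finset.mul_sum]
    _ ≤ _ := by linarith

/-- The square of the global best error is dominated by the tree error. -/
theorem exists_bestError_sq_le (hd : 2 ≤ d) {ℓ : ℕ} (hℓ : 1 ≤ ℓ) {T₀ : Finset (TaggedSimplex d)}
    (hT₀ : IsConforming T₀) : ∃ C, 0 < C ∧ ∀ ε : ℝ, 0 ≤ ε →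
    ∀ (u : Pt d → ℝ) (G : Pt d → Pt d), IsH1 (meshDomain T₀) u G →
    ∀ T ∈ conformingRefinements T₀, FaceConnected ℓ T →
      bestError ℓ ε u G T ^ 2 ≤ C * ∑ K ∈ T, localError ℓ T₀ ε u G K := by
  obtain ⟨C, hC, hquasi⟩ := exists_quasiInterpolant hd hℓ hT₀
  refine ⟨C, hC, fun ε hε u G hu T hT hfc => le_of_forall_pos_le_add fun η hη => ?_⟩
  -- the local infima need not be attained, so they are approximated up to `δ`
  set n : ℝ := T.card * (d + 1) with hn
  set δ := η / (C * (n + 1)) with hδ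
  have hn0 : 0 ≤ n := by positivity
  have hδ0 : 0 < δ := by positivity
  have hex : ∀ F : Set (Pt d), IsFaceOf T F → ∃ P ∈ localSpace ℓ T₀ F,
      rdError ε (minimalPair T₀ F) u G P ^ 2
        < (⨅ P : localSpace ℓ T₀ F, rdError ε (minimalPair T₀ F) u G P ^ 2) + δ := by
    rintro _ ⟨K, hK, i, rfl⟩
    have : Nonempty (localSpace ℓ T₀ (K.face i)) :=
      ⟨⟨_, mem_localSpace_of_mem_feSpace hT hK i (zero_mem_feSpace ℓ T)⟩⟩
    obtain ⟨P, hP⟩ := exists_lt_of_ciInf_lt (lt_add_of_pos_right (⨅ P : localSpace ℓ T₀ (K.face i),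
      rdError ε (minimalPair T₀ (K.face i)) u G P ^ 2) hδ0)
    exact ⟨P, P.2, hP⟩
  choose! P hP hPδ using hex
  obtain ⟨v, hv, e1, e2⟩ := hquasi u G hu T hT hfc P fun K hK i => hP _ ⟨K, hK, i, rfl⟩
  have : Nonempty (feSpace ℓ T) := ⟨⟨v, hv⟩⟩
  have hbest : bestError ℓ ε u G T ≤ rdError ε (meshDomain T) u G v :=
    ciInf_le (bddBelow_rdError ε _ u G _) (⟨v, hv⟩ : feSpace ℓ T)
  have hbest0 : 0 ≤ bestError ℓ ε u G T := le_ciInf fun v => rdError_nonneg _ _ _ _ _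
  have e3 := mul_le_mul_of_nonneg_left e2 hε
  calc _ ≤ rdError ε (meshDomain T) u G v ^ 2 := pow_le_pow_left₀ hbest0 hbest 2
    _ = (∫ x in meshUnion T₀, (u x - v x) ^ 2)
          + ε * ∫ x in meshUnion T₀, ‖G x - gradient v x‖ ^ 2 := by
        rw [rdError_sq hε, restrict_meshDomain, meshUnion_of_mem_conformingRefinements hT₀ hT]
    _ ≤ C * ∑ K ∈ T, ∑ i, rdError ε (minimalPair T₀ (K.face i)) u G (P (K.face i)) ^ 2 := by
        simp only [rdError_sq hε, Finset.sum_add_distrib, ← Finset.mul_sum]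
        linarith
    _ ≤ C * ∑ K ∈ T, ∑ i, ((⨅ P : localSpace ℓ T₀ (K.face i),
          rdError ε (minimalPair T₀ (K.face i)) u G P ^ 2) + δ) :=
        mul_le_mul_of_nonneg_left (Finset.sum_le_sum fun K hK => Finset.sum_le_sum fun i _ =>
          (hPδ _ ⟨K, hK, i, rfl⟩).le) hC.le
    _ = C * (∑ K ∈ T, localError ℓ T₀ ε u G K) + C * (n * δ) := by
        simp only [localError, Finset.sum_add_distrib, Finset.sum_const, Finset.card_univ,
          Fintype.card_fin, nsmul_eq_mul, hn]
        push_cast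
        ring
    _ ≤ _ := by
        have : C * (n * δ) ≤ C * ((n + 1) * δ) := by gcongr; linarith
        have h2 : C * ((n + 1) * δ) = η := by rw [hδ]; field_simp
        linarith

end TreeApprox

end

open TreeApprox in
theorem theorem6p3 (d ℓ : ℕ) (hd : 2 ≤ d) (hℓ : 1 ≤ ℓ)
    (T₀ : Finset (TaggedSimplex d)) (hT₀ : IsConforming T₀) (hmatch : MatchingCondition T₀) :
    ∃ c C : ℝ, 0 < c ∧ 0 < C ∧
      ∀ (ε : ℝ), 0 < ε →
      ∀ (u : Pt d → ℝ) (G : Pt d → Pt d), IsH1 (meshDomain T₀) u G →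
      ∀ T ∈ conformingRefinements T₀, FaceConnected ℓ T →
      ∀ 𝒯 : Finset (TaggedSimplex d), IsTree T₀ 𝒯 → leaves 𝒯 = T →
        c * Real.sqrt (treeError ℓ T₀ ε u G 𝒯) ≤ bestError ℓ ε u G T ∧
        bestError ℓ ε u G T ≤ C * Real.sqrt (treeError ℓ T₀ ε u G 𝒯) := by
  obtain ⟨C₁, hC₁, hlow⟩ := exists_treeError_le (by omega : 1 ≤ d) ℓ hT₀
  obtain ⟨C₂, hC₂, hup⟩ := exists_bestError_sq_le hd hℓ hT₀
  refine ⟨(Real.sqrt C₁)⁻¹, Real.sqrt C₂, by positivity, by positivity, ?_⟩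
  rintro ε hε u G hu T hT hfc 𝒯 - rfl
  have : Nonempty (feSpace ℓ (leaves 𝒯)) := ⟨⟨_, zero_mem_feSpace ℓ _⟩⟩
  constructor
  · refine le_ciInf fun v => ?_
    rw [inv_mul_le_iff₀ (by positivity)]
    refine Real.sqrt_le_iff.2 ⟨mul_nonneg (Real.sqrt_nonneg _) (rdError_nonneg _ _ _ _ _), ?_⟩
    rw [mul_pow, Real.sq_sqrt hC₁.le]
    exact hlow ε hε.le u G hu _ hT v v.2
  · rw [← Real.sqrt_mul hC₂.le]
    exact Real.le_sqrt_of_sq_le (hup ε hε.le u G hu _ hT hfc)
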